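/- **Theorem 3.14.** Let $1<p,s<\infty$. There are constants $C=C(p,s,n)>0$, which for $p\le s$ do not depend on $n$ (that is, $C=C(p,s)$), such that the following holds for every integer $n\ge 2$. *Setting.* Let $\Omega\subseteq\mathbb R^n$ be a domain (nonempty, connected, open); $\omega\Subset\Omega$ means that $\overline\omega$ is a compact subset of $\Omega$. Let $a=(a_1,\dots,a_n)$ be Lebesgue measurable functions on $\Omega$ such that for every domain $\omega\Subset\Omega$ there are positive constants $c_\omega,C_\omega$ with $c_\omega\le a_i\le C_\omega$ a.e. in $\omega$ for all $i$, and put $|\xi|_{s,a}=\big(\sum_{i=1}^n a_i(x)|\xi_i|^s\big)^{1/s}$. Let $A$ be a measurable function on $\Omega$ with values in the real $n\times n$ matrices such that (1) $A(x)$ is symmetric for almost all $x\in\Omega$; (2) for every domain $\omega\Subset\Omega$ there are positive constants $\theta_{1,\omega},\theta_{2,\omega}$ with $\theta_{1,\omega}|\xi|\le|\xi|_A:=\sqrt{A(x)\xi\cdot\xi}\le\theta_{2,\omega}|\xi|$ for almost all $x\in\omega$ and all $\xi\in\mathbb R^n$. Put $$H(x,\xi)=\big(|\xi|_{s,a}^p+|\xi|_A^p\big)^{1/p},\qquad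 \mathcal A(x,\xi)=\nabla_\xi\Big(\tfrac1p H(x,\xi)^p\Big).$$ Let $V\in M^q_{\rm loc}(p;\Omega)$, the local Morrey space: for every domain $\omega\Subset\Omega$, $V\in L^1_{\rm loc}(\omega)$ and, with the suprema taken over $y\in\omega$ and $0<r<\operatorname{diam}\omega$, * if $p<n$: $q>n/p$ and $\sup r^{-n/q'}\int_{\omega\cap B_r(y)}|V|\,dx<\infty$, where $q'=q/(q-1)$; * if $p=n$: $q>n$ and $\sup\big(\log(\operatorname{diam}(\omega)/r)\big)^{q/n'}\int_{\omega\cap B_r(y)}|V|\,dx<\infty$, where $n'=n/(n-1)$; * if $p>n$: $q=1$ and $V\in L^1(\omega)$. Let $Q[\phi]=\int_\Omega\big(H(x,\nabla\phi)^p+V|\phi|^p\big)\,dx$, and let $u\in W^{1,p}_{\rm loc}(\Omega)\cap C(\Omega)$ be a positive weak solution of $-\operatorname{div}\mathcal A(x,\nabla v)+V|v|^{p-2}v=0$ in $\Omega$, that is, $\int_\Omega\mathcal A(x,\nabla u)\cdot\nabla\phi\,dx+\int_\Omega V|u|^{p-2}u\,\phi\,dx=0$ for all $\phi\in C_c^\infty(\Omega)$.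 (The existence of such a $u$ implies $Q\ge0$ on $W^{1,p}(\Omega)\cap C_c(\Omega)$.) Let $\mathcal H(\Omega)$ be the set of all Hardy-weights of $Q$: all $g\in L^1_{\rm loc}(\Omega)$ for which there is a $c>0$ with $Q[\phi]\ge c\int_\Omega|g||\phi|^p\,dx$ for all $\phi\in C_c^\infty(\Omega)$. For $g\in L^1_{\rm loc}(\Omega)$ and compact $K\subseteq\Omega$ put, with values in $[0,\infty]$ (and $\inf\emptyset=\infty$, $\infty^{-1}=0$, $0^{-1}=\infty$), $$\|g\|_{\mathcal H}=\Big(\inf\Big\{\tfrac{Q[\phi]}{\int_\Omega|g||\phi|^p dx}\ \Big|\ \phi\in W^{1,p}(\Omega)\cap C_c(\Omega),\ \int_\Omega|g||\phi|^p dx>0\Big\}\Big)^{-1},$$ $$\operatorname{cap}(K,u)=\inf\{Q[\phi]\mid\phi\in W^{1,p}(\Omega)\cap C_c(\Omega),\ \phi\ge u\text{ on }K\},$$ $$\|g\|_u=\inf\Big\{L\in[0,\infty)\ \Big|\ \int_K|g||u|^p dx\le L\operatorname{cap}(K,u)\text{ for all compact }K\subseteq\Omega\Big\}.$$ *Conclusion.*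 1. For all $g\in L^1_{\rm loc}(\Omega)$: $g\in\mathcal H(\Omega)$ if and only if $\|g\|_u<\infty$. 2. For all $g\in\mathcal H(\Omega)$: $\|g\|_u\le\|g\|_{\mathcal H}\le C\,\|g\|_u$. 3. $(\mathcal H(\Omega),\|\cdot\|_u)$, with functions equal a.e. in $\Omega$ identified, is a Banach space. -/

import Mathlib

open MeasureTheory Set Filter Topology
open scoped ENNReal NNReal

noncomputable section

namespace FinslerHardy

/-- Euclidean space `ℝⁿ`. Functions on an open set `Ω` are represented by functions on `ℝⁿ`
of which only the restriction to `Ω` matters; functions with compact support in `Ω` are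
extended by zero. -/
abbrev E (n : ℕ) : Type := EuclideanSpace ℝ (Fin n)

variable {n : ℕ}

/-- A domain: a nonempty, connected, open set. -/
def IsDom (Ω : Set (E n)) : Prop := IsOpen Ω ∧ IsConnected Ω

/-- `ω ⋐ Ω`: `ω` is a domain whose closure is a compact subset of `Ω`. -/
def IsSubdom (ω Ω : Set (E n)) : Prop := IsDom ω ∧ IsCompact (closure ω) ∧ closure ω ⊆ Ω

/-! ### Function spaces -/

/-- `φ ∈ C_c^∞(Ω)`. -/
def IsTest (Ω : Set (E n)) (φ : E n → ℝ) : Prop :=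
  ContDiff ℝ (⊤ : ℕ∞) φ ∧ HasCompactSupport φ ∧ tsupport φ ⊆ Ω

/-- `G` is a weak gradient of `f` in `Ω`. -/
def HasWeakGrad (Ω : Set (E n)) (f : E n → ℝ) (G : E n → E n) : Prop :=
  LocallyIntegrableOn f Ω ∧ LocallyIntegrableOn G Ω ∧
    ∀ φ : E n → ℝ, IsTest Ω φ → ∀ i : Fin n,
      ∫ x in Ω, f x * fderiv ℝ φ x (EuclideanSpace.single i 1) = -∫ x in Ω, G x i * φ x

open Classical in
/-- The weak gradient `∇f` in `Ω` (unique up to a null subset of `Ω`; zero if there is none). -/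
def weakGrad (Ω : Set (E n)) (f : E n → ℝ) : E n → E n :=
  if h : ∃ G, HasWeakGrad Ω f G then h.choose else 0

/-- `f ∈ W^{1,p}(Ω)`. -/
def MemW1p (p : ℝ) (Ω : Set (E n)) (f : E n → ℝ) : Prop :=
  MemLp f (ENNReal.ofReal p) (volume.restrict Ω) ∧
    ∃ G, HasWeakGrad Ω f G ∧ MemLp G (ENNReal.ofReal p) (volume.restrict Ω)

/-- `f ∈ W^{1,p}_loc(Ω)`: `f` and its weak gradient are in `L^p(K)` for all compact `K ⊆ Ω`. -/
def MemW1pLoc (p : ℝ) (Ω : Set (E n)) (f : E n → ℝ) : Prop :=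
  (∀ K ⊆ Ω, IsCompact K → MemLp f (ENNReal.ofReal p) (volume.restrict K)) ∧
    ∃ G, HasWeakGrad Ω f G ∧
      ∀ K ⊆ Ω, IsCompact K → MemLp G (ENNReal.ofReal p) (volume.restrict K)

/-- `f ∈ W^{1,p}(Ω) ∩ C_c(Ω)`. -/
def MemW1pCc (p : ℝ) (Ω : Set (E n)) (f : E n → ℝ) : Prop :=
  MemW1p p Ω f ∧ Continuous f ∧ HasCompactSupport f ∧ tsupport f ⊆ Ω

/-- The Morrey norm of `M^q(p; ω)` for `p < n`, where `q' = q / (q - 1)`. -/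
def morreyNorm (q : ℝ) (ω : Set (E n)) (f : E n → ℝ) : ℝ≥0∞ :=
  ⨆ y ∈ ω, ⨆ r ∈ Ioo 0 (Metric.diam ω),
    ENNReal.ofReal (1 / r ^ ((n : ℝ) / (q / (q - 1)))) * ∫⁻ x in ω ∩ Metric.ball y r, ‖f x‖ₑ

/-- The Morrey norm of `M^q(n; ω)`, with weight `(log (diam ω / r))^{q / n'}`,
`n' = n / (n - 1)`. -/
def morreyNormCritical (q : ℝ) (ω : Set (E n)) (f : E n → ℝ) : ℝ≥0∞ :=
  ⨆ y ∈ ω, ⨆ r ∈ Ioo 0 (Metric.diam ω),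
    ENNReal.ofReal (Real.log (Metric.diam ω / r) ^ (q / ((n : ℝ) / ((n : ℝ) - 1)))) *
      ∫⁻ x in ω ∩ Metric.ball y r, ‖f x‖ₑ

/-- `f ∈ M^q(p; ω)`; the exponent `q` has to satisfy `q > n / p` if `p < n`, `q > n` if `p = n`,
and `q = 1` if `p > n`. -/
def MemMorrey (p q : ℝ) (ω : Set (E n)) (f : E n → ℝ) : Prop :=
  LocallyIntegrableOn f ω ∧
    ((p < n ∧ n / p < q ∧ morreyNorm q ω f < ⊤) ∨
      (p = n ∧ n < q ∧ morreyNormCritical q ω f < ⊤) ∨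
      (n < p ∧ q = 1 ∧ IntegrableOn f ω))

/-- `f ∈ M^q_loc(p; Ω)`. -/
def MemMorreyLoc (p q : ℝ) (Ω : Set (E n)) (f : E n → ℝ) : Prop :=
  ∀ ω, IsSubdom ω Ω → MemMorrey p q ω f

/-! ### The norms -/

/-- The weighted `s`-norm `|ξ|_{s,a}` at a point where the weight has the value `a`. -/
def sNorm (s : ℝ) (a : Fin n → ℝ) (ξ : E n) : ℝ := (∑ i, a i * |ξ i| ^ s) ^ (1 / s)

/-- `|ξ|_A = √(Aξ·ξ)`. -/
def matNorm (A : Matrix (Fin n) (Fin n) ℝ) (ξ : E n) : ℝ :=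
  Real.sqrt ((A.mulVec (fun i => ξ i)) ⬝ᵥ (fun i => ξ i))

/-- `H(x, ξ) = (|ξ|_{s,a(x)}^p + |ξ|_{A(x)}^p)^{1/p}`. -/
def mixedNorm (p s : ℝ) (a : E n → Fin n → ℝ) (A : E n → Matrix (Fin n) (Fin n) ℝ)
    (x ξ : E n) : ℝ :=
  (sNorm s (a x) ξ ^ p + matNorm (A x) ξ ^ p) ^ (1 / p)

/-- The weights `a₁, …, aₙ` are measurable in `Ω` and locally equivalent to `1`. -/
def IsWeight (Ω : Set (E n)) (a : E n → Fin n → ℝ) : Prop :=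
  (∀ i, AEMeasurable (fun x => a x i) (volume.restrict Ω)) ∧
    ∀ ω, IsSubdom ω Ω → ∃ c C : ℝ, 0 < c ∧ 0 < C ∧
      ∀ᵐ x ∂(volume.restrict ω), ∀ i, c ≤ a x i ∧ a x i ≤ C

/-- `A` is measurable and a.e. symmetric in `Ω`, locally uniformly elliptic and bounded. -/
def IsEllipticMatrix (Ω : Set (E n)) (A : E n → Matrix (Fin n) (Fin n) ℝ) : Prop :=
  (∀ i j, AEMeasurable (fun x => A x i j) (volume.restrict Ω)) ∧
    (∀ᵐ x ∂(volume.restrict Ω), (A x).IsSymm) ∧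
    ∀ ω, IsSubdom ω Ω → ∃ θ₁ θ₂ : ℝ, 0 < θ₁ ∧ 0 < θ₂ ∧
      ∀ᵐ x ∂(volume.restrict ω), ∀ ξ : E n,
        θ₁ * ‖ξ‖ ≤ matNorm (A x) ξ ∧ matNorm (A x) ξ ≤ θ₂ * ‖ξ‖

/-! ### The functional and the equation, for a family of norms `H` and a potential `V` -/

/-- `𝒜(x, ξ) = ∇_ξ F(x, ξ)`, where `F(x, ξ) = H(x, ξ)^p / p`. -/
def flux (p : ℝ) (H : E n → E n → ℝ) (x ξ : E n) : E n :=
  gradient (fun ζ => 1 / p * H x ζ ^ p) ξ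

/-- `Q[φ] = ∫_Ω (H(x, ∇φ)^p + V |φ|^p) dx`. -/
def energy (p : ℝ) (Ω : Set (E n)) (H : E n → E n → ℝ) (V φ : E n → ℝ) : ℝ :=
  ∫ x in Ω, (H x (weakGrad Ω φ x) ^ p + V x * |φ x| ^ p)

/-- `v ∈ W^{1,p}_loc(Ω)` is a weak solution of `Q'[v] = -div 𝒜(x, ∇v) + V |v|^{p-2} v = 0`
in `Ω`. -/
def IsSolution (p : ℝ) (Ω : Set (E n)) (H : E n → E n → ℝ) (V v : E n → ℝ) : Prop :=
  MemW1pLoc p Ω v ∧ ∀ φ, IsTest Ω φ →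
    (∫ x in Ω, inner ℝ (flux p H x (weakGrad Ω v x)) (gradient φ x)) +
      ∫ x in Ω, V x * |v x| ^ (p - 2) * v x * φ x = 0

/-- `g` is a Hardy-weight of `Q` in `Ω`, i.e. `g ∈ ℋ(Ω)`. -/
def IsHardyWeight (p : ℝ) (Ω : Set (E n)) (H : E n → E n → ℝ) (V g : E n → ℝ) : Prop :=
  LocallyIntegrableOn g Ω ∧ ∃ C : ℝ, 0 < C ∧ ∀ φ, IsTest Ω φ →
    C * ∫ x in Ω, |g x| * |φ x| ^ p ≤ energy p Ω H V φ

/-- The weighted integral `∫_S |g| |φ|^p dx ∈ [0, ∞]`. -/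
def wInt (p : ℝ) (S : Set (E n)) (g φ : E n → ℝ) : ℝ≥0∞ :=
  ∫⁻ x in S, ENNReal.ofReal (|g x| * |φ x| ^ p)

/-- The Hardy constant `S_g ∈ [0, ∞]`, the infimum of `Q[φ] / ∫_Ω |g| |φ|^p dx` over all
`φ ∈ W^{1,p}(Ω) ∩ C_c(Ω)` with positive denominator. It is meant for nonnegative `Q`, for which
`ENNReal.ofReal` truncates nothing. -/
def hardyConst (p : ℝ) (Ω : Set (E n)) (H : E n → E n → ℝ) (V g : E n → ℝ) : ℝ≥0∞ :=
  ⨅ (φ : E n → ℝ) (_ : MemW1pCc p Ω φ) (_ : 0 < wInt p Ω g φ),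
    ENNReal.ofReal (energy p Ω H V φ) / wInt p Ω g φ

/-- `‖g‖_ℋ = S_g⁻¹ ∈ [0, ∞]`. -/
def hardyNorm (p : ℝ) (Ω : Set (E n)) (H : E n → E n → ℝ) (V g : E n → ℝ) : ℝ≥0∞ :=
  (hardyConst p Ω H V g)⁻¹

/-- The `Q`-capacity of `K` with respect to `(u, Ω)`, the infimum of `Q[φ]` over all
`φ ∈ W^{1,p}(Ω) ∩ C_c(Ω)` with `φ ≥ u` on `K` (again for nonnegative `Q`). -/
def capacity (p : ℝ) (Ω : Set (E n)) (H : E n → E n → ℝ) (V u : E n → ℝ) (K : Set (E n)) :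
    ℝ≥0∞ :=
  ⨅ (φ : E n → ℝ) (_ : MemW1pCc p Ω φ) (_ : ∀ x ∈ K, u x ≤ φ x),
    ENNReal.ofReal (energy p Ω H V φ)

/-- `‖g‖_u ∈ [0, ∞]`, the infimum of all `L ∈ [0, ∞)` with `∫_K |g| |u|^p dx ≤ L cap(K, u)` for
all compact `K ⊆ Ω`. -/
def capNorm (p : ℝ) (Ω : Set (E n)) (H : E n → E n → ℝ) (V u g : E n → ℝ) : ℝ≥0∞ :=
  ⨅ (L : ℝ≥0) (_ : ∀ K ⊆ Ω, IsCompact K → wInt p K g u ≤ L * capacity p Ω H V u K), (L : ℝ≥0∞)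

/-- The set `S` is a linear subspace of `X` on which `N` is a (finite) norm, and `(S, N)` is
complete, i.e. it is a Banach space. -/
structure IsBanachSpace {X : Type} [AddCommGroup X] [Module ℝ X] (S : Set X) (N : X → ℝ≥0∞) :
    Prop where
  zero_mem : 0 ∈ S
  add_mem : ∀ f ∈ S, ∀ g ∈ S, f + g ∈ S
  smul_mem : ∀ (c : ℝ), ∀ f ∈ S, c • f ∈ S
  finite : ∀ f ∈ S, N f < ⊤
  eq_zero_iff : ∀ f ∈ S, N f = 0 ↔ f = 0
  smul : ∀ (c : ℝ), ∀ f ∈ S, N (c • f) = ENNReal.ofReal |c| * N f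
  triangle : ∀ f ∈ S, ∀ g ∈ S, N (f + g) ≤ N f + N g
  complete : ∀ F : ℕ → X, (∀ k, F k ∈ S) →
    (∀ ε : ℝ≥0∞, 0 < ε → ∃ k₀, ∀ j ≥ k₀, ∀ k ≥ k₀, N (F j - F k) < ε) →
    ∃ f ∈ S, Tendsto (fun k => N (F k - f)) atTop (𝓝 0)

end FinslerHardy

end

open FinslerHardy

/-! The function `F = H(x, ·)^p / p` is convex, and its Bregman distance
`F(Z) - F(X) - F'(X)(Z - X)` is symmetric up to a constant `C(p, s)` in every dimension. For
`|t|^r` with `r ≥ 2` this is Bernoulli's inequality, for `1 < r < 2` it follows by Legendre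
duality; the `p`-th power of the `ℓ^s`-norm is treated by the chain rule if `s ≤ p`, and by
duality if `p < s`. Quasi-symmetry controls the growth of Bregman distances along rays.

By Picone's identity, for a positive solution `u`, `Q[φ]` is the integral of `p` times the Bregman
distance of `F` from `(φ / u) ∇u` to `∇φ`. Hence `Q ≥ 0`, and truncating `φ / u` between the levels
`c` and `2 c` by a flat cutoff function costs only a constant times the part of `Q[φ]` living
between these levels. Summation over the dyadic levels, as in the capacitary inequality of Maz'ya,
bounds `∫ |g| |φ|^p` by a multiple of `‖g‖_u Q[φ]`. Completeness is Fatou's lemma for `‖·‖_u`. -/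

noncomputable section

namespace FinslerHardy

/-! ### Bregman distances -/

section Bregman

variable {W W₂ : Type*} [NormedAddCommGroup W] [NormedSpace ℝ W]
  [NormedAddCommGroup W₂] [NormedSpace ℝ W₂]

/-- The Bregman distance of a differentiable function `F`: the error at `Z` of the first order
Taylor expansion of `F` at `X`. -/
def bregman (F : W → ℝ) (X Z : W) : ℝ := F Z - F X - fderiv ℝ F X (Z - X)

/-- `F` is differentiable and convex (in the form of a nonnegative Bregman distance), and its
Bregman distance is symmetric up to the factor `C`. -/
structure IsBregmanQuasiSymm (C : ℝ) (F : W → ℝ) : Prop where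
  differentiable : Differentiable ℝ F
  nonneg : ∀ X Z, 0 ≤ bregman F X Z
  symm_le : ∀ X Z, bregman F Z X ≤ C * bregman F X Z

theorem bregman_self (F : W → ℝ) (X : W) : bregman F X X = 0 := by simp [bregman]

theorem bregman_comp {F : W₂ → ℝ} (hF : Differentiable ℝ F) (T : W →L[ℝ] W₂) (X Z : W) :
    bregman (fun x => F (T x)) X Z = bregman F (T X) (T Z) := by
  have hFT : HasFDerivAt (fun x => F (T x)) ((fderiv ℝ F (T X)).comp T) X :=
    (hF (T X)).hasFDerivAt.comp X T.hasFDerivAt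
  simp [bregman, hFT.fderiv]

theorem bregman_comp_real {Φ : ℝ → ℝ} {G : W → ℝ} {X : W} (hΦ : DifferentiableAt ℝ Φ (G X))
    (hG : DifferentiableAt ℝ G X) (Z : W) :
    bregman (fun x => Φ (G x)) X Z
      = bregman Φ (G X) (G Z) + deriv Φ (G X) * bregman G X Z := by
  have hΦG : HasFDerivAt (fun x => Φ (G x)) (deriv Φ (G X) • fderiv ℝ G X) X :=
    hΦ.hasDerivAt.comp_hasFDerivAt X hG.hasFDerivAt
  simp only [bregman, hΦG.fderiv, fderiv_eq_deriv_mul, _root_.smul_apply, smul_eq_mul]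
  ring

theorem bregman_add {F G : W → ℝ} (hF : Differentiable ℝ F) (hG : Differentiable ℝ G) (X Z : W) :
    bregman (fun x => F x + G x) X Z = bregman F X Z + bregman G X Z := by
  simp only [bregman, fderiv_fun_add (hF X) (hG X), _root_.add_apply]
  ring

theorem bregman_const_mul (F : W → ℝ) (c : ℝ) (X Z : W) :
    bregman (fun x => c * F x) X Z = c * bregman F X Z := by
  have hc : fderiv ℝ (fun x => c * F x) X = c • fderiv ℝ F X :=
    congrFun (fderiv_const_smul_field c) X
  simp only [bregman, hc, _root_.smul_apply, smul_eq_mul]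
  ring

theorem bregman_sum {ι : Type*} {s : Finset ι} {F : ι → W → ℝ}
    (hF : ∀ i, Differentiable ℝ (F i)) (X Z : W) :
    bregman (fun x => ∑ i ∈ s, F i x) X Z = ∑ i ∈ s, bregman (F i) X Z := by
  simp only [bregman, fderiv_fun_sum (fun i _ => hF i X), _root_.sum_apply,
    Finset.sum_sub_distrib]

theorem bregman_nonneg_of_convexOn {F : W → ℝ} (hconv : ConvexOn ℝ univ F)
    (hF : Differentiable ℝ F) (X Z : W) : 0 ≤ bregman F X Z := by
  have hline : HasDerivAt (F ∘ AffineMap.lineMap X Z) (fderiv ℝ F X (Z - X)) (0 : ℝ) := by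
    have hX : HasFDerivAt F (fderiv ℝ F X) (AffineMap.lineMap X Z (0 : ℝ)) := by
      simpa using (hF X).hasFDerivAt
    exact hX.comp_hasDerivAt 0 AffineMap.hasDerivAt_lineMap
  have hslope := (hconv.comp_affineMap (AffineMap.lineMap X Z)).le_slope_of_hasDerivAt
    (mem_univ (0 : ℝ)) (mem_univ 1) one_pos hline
  simp only [slope_def_field, Function.comp_apply, AffineMap.lineMap_apply_one,
    AffineMap.lineMap_apply_zero, sub_zero, div_one] at hslope
  exact sub_nonneg.2 hslope

namespace IsBregmanQuasiSymm

variable {C : ℝ} {F G : W → ℝ}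

theorem mono {C' : ℝ} (h : IsBregmanQuasiSymm C F) (hC : C ≤ C') : IsBregmanQuasiSymm C' F :=
  ⟨h.differentiable, h.nonneg, fun X Z =>
    (h.symm_le X Z).trans (mul_le_mul_of_nonneg_right hC (h.nonneg X Z))⟩

theorem comp {F : W₂ → ℝ} (h : IsBregmanQuasiSymm C F) (T : W →L[ℝ] W₂) :
    IsBregmanQuasiSymm C (fun x => F (T x)) where
  differentiable := h.differentiable.comp T.differentiable
  nonneg X Z := by rw [bregman_comp h.differentiable]; exact h.nonneg _ _
  symm_le X Z := by simpa only [bregman_comp h.differentiable] using h.symm_le _ _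

theorem add (hF : IsBregmanQuasiSymm C F) (hG : IsBregmanQuasiSymm C G) :
    IsBregmanQuasiSymm C (fun x => F x + G x) where
  differentiable := hF.differentiable.add hG.differentiable
  nonneg X Z := by
    rw [bregman_add hF.differentiable hG.differentiable]
    exact add_nonneg (hF.nonneg _ _) (hG.nonneg _ _)
  symm_le X Z := by
    simp only [bregman_add hF.differentiable hG.differentiable, mul_add]
    exact add_le_add (hF.symm_le _ _) (hG.symm_le _ _)

theorem const_mul (hF : IsBregmanQuasiSymm C F) {c : ℝ} (hc : 0 ≤ c) :
    IsBregmanQuasiSymm C (fun x => c * F x) where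
  differentiable := hF.differentiable.const_mul c
  nonneg X Z := by rw [bregman_const_mul]; exact mul_nonneg hc (hF.nonneg _ _)
  symm_le X Z := by
    rw [bregman_const_mul, bregman_const_mul, mul_left_comm]
    exact mul_le_mul_of_nonneg_left (hF.symm_le _ _) hc

theorem sum {ι : Type*} {s : Finset ι} {F : ι → W → ℝ} (hF : ∀ i, IsBregmanQuasiSymm C (F i)) :
    IsBregmanQuasiSymm C (fun x => ∑ i ∈ s, F i x) where
  differentiable := Differentiable.fun_sum fun i _ => (hF i).differentiable
  nonneg X Z := by
    rw [bregman_sum fun i => (hF i).differentiable]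
    exact Finset.sum_nonneg fun i _ => (hF i).nonneg _ _
  symm_le X Z := by
    simp only [bregman_sum fun i => (hF i).differentiable, Finset.mul_sum]
    exact Finset.sum_le_sum fun i _ => (hF i).symm_le _ _

end IsBregmanQuasiSymm

end Bregman

/-! ### Absolutely homogeneous functions -/

theorem abs_rpow_sub_two_mul_self_mul_self {p : ℝ} (hp : p ≠ 0) (c : ℝ) :
    |c| ^ (p - 2) * c * c = |c| ^ p := by
  rcases eq_or_ne c 0 with rfl | hc
  · simp [Real.zero_rpow hp]
  · rw [mul_assoc, ← abs_mul_abs_self, ← sq, ← Real.rpow_two, ← Real.rpow_add (abs_pos.2 hc)]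
    ring_nf

theorem abs_abs_rpow_sub_two_mul_self {p : ℝ} (hp : p ≠ 1) (c : ℝ) :
    |(|c| ^ (p - 2) * c)| = |c| ^ (p - 1) := by
  rcases eq_or_ne c 0 with rfl | hc
  · simp [Real.zero_rpow (sub_ne_zero.2 hp)]
  · rw [abs_mul, Real.abs_rpow_of_nonneg (abs_nonneg c), abs_abs,
      ← Real.rpow_add_one (abs_pos.2 hc).ne']
    ring_nf

section Homogeneous

variable {W : Type*} [NormedAddCommGroup W] [NormedSpace ℝ W] {F : W → ℝ} {p : ℝ}

/-- `F` is absolutely homogeneous of degree `p`, like the `p`-th power of a norm. -/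
def IsAbsHomogeneous (p : ℝ) (F : W → ℝ) : Prop := ∀ (c : ℝ) (X : W), F (c • X) = |c| ^ p * F X

namespace IsAbsHomogeneous

theorem map_zero (hF : IsAbsHomogeneous p F) (hp : p ≠ 0) : F 0 = 0 := by
  simpa [Real.zero_rpow hp] using hF 0 0

theorem const_mul (hF : IsAbsHomogeneous p F) (a : ℝ) : IsAbsHomogeneous p (fun X => a * F X) :=
  fun c X => by simp only [hF c X, mul_left_comm]

theorem mul_fderiv_smul (hF : IsAbsHomogeneous p F) (c : ℝ) (X Y : W) :
    c * fderiv ℝ F (c • X) Y = |c| ^ p * fderiv ℝ F X Y := by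
  have hscaled : (fun Y => F (c • Y)) = |c| ^ p • F := funext (hF c)
  have hfderiv := fderiv_comp_smul (f := F) (x := X) c
  rw [hscaled, fderiv_const_smul_field] at hfderiv
  exact (DFunLike.congr_fun hfderiv Y).symm

theorem bregman_smul_smul (hF : IsAbsHomogeneous p F) (c : ℝ) (X Z : W) :
    bregman F (c • X) (c • Z) = |c| ^ p * bregman F X Z := by
  rw [bregman, bregman, hF, hF, ← smul_sub, map_smul, smul_eq_mul, hF.mul_fderiv_smul]
  ring

theorem fderiv_zero (hF : IsAbsHomogeneous p F) (hd : DifferentiableAt ℝ F 0) (hp : 1 < p) :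
    fderiv ℝ F 0 = 0 := by
  ext Y
  have hchain : HasDerivAt (fun t : ℝ => F (t • Y)) (fderiv ℝ F 0 Y) 0 := by
    have hd' : HasFDerivAt F (fderiv ℝ F 0) ((0 : ℝ) • Y) := by simpa using hd.hasFDerivAt
    simpa [Function.comp_def] using
      hd'.comp_hasDerivAt (0 : ℝ) ((hasDerivAt_id (0 : ℝ)).smul_const Y)
  have hpow : HasDerivAt (fun t : ℝ => F (t • Y)) 0 0 := by
    simpa [funext fun t => hF t Y] using (hasDerivAt_abs_rpow 0 hp).mul_const (F Y)
  exact hchain.unique hpow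

theorem fderiv_smul (hF : IsAbsHomogeneous p F) (hd : DifferentiableAt ℝ F 0) (hp : 1 < p)
    (c : ℝ) (X Y : W) : fderiv ℝ F (c • X) Y = |c| ^ (p - 2) * c * fderiv ℝ F X Y := by
  rcases eq_or_ne c 0 with rfl | hc
  · simp [hF.fderiv_zero hd hp]
  · refine mul_left_cancel₀ hc ?_
    rw [hF.mul_fderiv_smul, ← abs_rpow_sub_two_mul_self_mul_self (by linarith : p ≠ 0) c]
    ring

theorem fderiv_self (hF : IsAbsHomogeneous p F) {X : W} (hd : DifferentiableAt ℝ F X)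
    (hp : 1 < p) : fderiv ℝ F X X = p * F X := by
  have hchain : HasDerivAt (fun t : ℝ => F (t • X)) (fderiv ℝ F X X) 1 := by
    have hd' : HasFDerivAt F (fderiv ℝ F X) ((1 : ℝ) • X) := by simpa using hd.hasFDerivAt
    simpa [Function.comp_def] using
      hd'.comp_hasDerivAt (1 : ℝ) ((hasDerivAt_id (1 : ℝ)).smul_const X)
  have hpow : HasDerivAt (fun t : ℝ => F (t • X)) (p * F X) 1 := by
    simpa [funext fun t => hF t X] using (hasDerivAt_abs_rpow 1 hp).mul_const (F X)
  exact hchain.unique hpow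

end IsAbsHomogeneous

end Homogeneous

/-! ### Growth of Bregman distances along rays -/

section Ray

variable {W : Type*} [NormedAddCommGroup W] [NormedSpace ℝ W] {F : W → ℝ} {C : ℝ}

theorem hasDerivAt_bregman_ray (hF : Differentiable ℝ F) (X Y : W) (t : ℝ) :
    HasDerivAt (fun t : ℝ => bregman F X (X + t • Y))
      (fderiv ℝ F (X + t • Y) Y - fderiv ℝ F X Y) t := by
  have hray : HasDerivAt (fun t : ℝ => X + t • Y) Y t := by
    simpa using ((hasDerivAt_id t).smul_const Y).const_add X
  have hlinear : HasDerivAt (fun t : ℝ => t * fderiv ℝ F X Y) (fderiv ℝ F X Y) t := by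
    simpa using (hasDerivAt_id t).mul_const (fderiv ℝ F X Y)
  refine ((((hF _).hasFDerivAt.comp_hasDerivAt t hray).sub_const (F X)).sub
    hlinear).congr_of_eventuallyEq (Eventually.of_forall fun t => ?_)
  simp [bregman]

theorem mul_deriv_bregman_ray (F : W → ℝ) (X Y : W) (t : ℝ) :
    t * (fderiv ℝ F (X + t • Y) Y - fderiv ℝ F X Y)
      = bregman F X (X + t • Y) + bregman F (X + t • Y) X := by
  simp only [bregman, add_sub_cancel_left, sub_add_cancel_left, map_neg, map_smul, smul_eq_mul]
  ring

namespace IsBregmanQuasiSymm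

theorem monotoneOn_bregman_ray (hF : IsBregmanQuasiSymm C F) (X Y : W) :
    MonotoneOn (fun t : ℝ => bregman F X (X + t • Y)) (Ici 0) := by
  have hderiv := hasDerivAt_bregman_ray hF.differentiable X Y
  refine monotoneOn_of_deriv_nonneg (convex_Ici 0)
    (fun t _ => (hderiv t).continuousAt.continuousWithinAt)
    (fun t _ => (hderiv t).differentiableAt.differentiableWithinAt) fun t ht => ?_
  rw [interior_Ici, mem_Ioi] at ht
  rw [(hderiv t).deriv]
  refine (mul_nonneg_iff_of_pos_left ht).1 ?_
  rw [mul_deriv_bregman_ray]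
  exact add_nonneg (hF.nonneg _ _) (hF.nonneg _ _)

theorem antitoneOn_rpow_mul_bregman_ray (hF : IsBregmanQuasiSymm C F) (X Y : W) :
    AntitoneOn (fun t : ℝ => t ^ (-(1 + C)) * bregman F X (X + t • Y)) (Ioi 0) := by
  have hderiv : ∀ t : ℝ, 0 < t → HasDerivAt
      (fun t : ℝ => t ^ (-(1 + C)) * bregman F X (X + t • Y))
      (-(1 + C) * t ^ (-(1 + C) - 1) * bregman F X (X + t • Y) + t ^ (-(1 + C)) *
        (fderiv ℝ F (X + t • Y) Y - fderiv ℝ F X Y)) t := fun t ht =>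
    (Real.hasDerivAt_rpow_const (Or.inl ht.ne')).mul
      (hasDerivAt_bregman_ray hF.differentiable X Y t)
  refine antitoneOn_of_deriv_nonpos (convex_Ioi 0)
    (fun t ht => (hderiv t ht).continuousAt.continuousWithinAt)
    (fun t ht => ?_) fun t ht => ?_ <;> rw [interior_Ioi, mem_Ioi] at ht
  · exact (hderiv t ht).differentiableAt.differentiableWithinAt
  · rw [(hderiv t ht).deriv]
    calc _ = t ^ (-(1 + C) - 1) * (t * (fderiv ℝ F (X + t • Y) Y - fderiv ℝ F X Y)
          - (1 + C) * bregman F X (X + t • Y)) := by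
          rw [show t ^ (-(1 + C)) = t ^ (-(1 + C) - 1) * t by
            rw [← Real.rpow_add_one ht.ne', sub_add_cancel]]
          ring
      _ = t ^ (-(1 + C) - 1) * (bregman F (X + t • Y) X - C * bregman F X (X + t • Y)) := by
          rw [mul_deriv_bregman_ray]; ring
      _ ≤ 0 := mul_nonpos_of_nonneg_of_nonpos (Real.rpow_nonneg ht.le _)
          (sub_nonpos.2 (hF.symm_le _ _))

theorem bregman_ray_le (hF : IsBregmanQuasiSymm C F) (X Y : W) {t l : ℝ} (ht : 0 ≤ t)
    (htl : t ≤ l) (hl : 1 ≤ l) :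
    bregman F X (X + t • Y) ≤ l ^ (1 + C) * bregman F X (X + Y) := by
  have hl0 : 0 < l := by linarith
  have hanti := hF.antitoneOn_rpow_mul_bregman_ray X Y (mem_Ioi.2 one_pos) (mem_Ioi.2 hl0) hl
  simp only [Real.one_rpow, one_mul, one_smul] at hanti
  rw [Real.rpow_neg hl0.le, inv_mul_le_iff₀ (Real.rpow_pos_of_pos hl0 _)] at hanti
  exact (hF.monotoneOn_bregman_ray X Y ht hl0.le htl).trans hanti

end IsBregmanQuasiSymm

end Ray

/-! ### Powers of `ℓ^s`-norms -/

section AbsRpow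

variable {r : ℝ}

theorem isAbsHomogeneous_abs_rpow (r : ℝ) : IsAbsHomogeneous r (fun t : ℝ => |t| ^ r) :=
  fun c t => by
    simp only [smul_eq_mul, abs_mul, Real.mul_rpow (abs_nonneg c) (abs_nonneg t)]

theorem differentiable_abs_rpow (hr : 1 < r) : Differentiable ℝ (fun t : ℝ => |t| ^ r) :=
  fun t => (hasDerivAt_abs_rpow t hr).differentiableAt

theorem convexOn_abs_rpow (hr : 1 ≤ r) : ConvexOn ℝ univ (fun t : ℝ => |t| ^ r) := by
  refine ⟨convex_univ, fun x _ y _ a b ha hb hab => ?_⟩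
  calc |a • x + b • y| ^ r ≤ (a • |x| + b • |y|) ^ r := by
        refine Real.rpow_le_rpow (abs_nonneg _) ((abs_add_le _ _).trans_eq ?_) (by linarith)
        simp only [smul_eq_mul, abs_mul, abs_of_nonneg ha, abs_of_nonneg hb]
    _ ≤ a • |x| ^ r + b • |y| ^ r :=
        (convexOn_rpow hr).2 (abs_nonneg x) (abs_nonneg y) ha hb hab

theorem bregman_abs_rpow (hr : 1 < r) (x z : ℝ) :
    bregman (fun t : ℝ => |t| ^ r) x z
      = |z| ^ r + (r - 1) * |x| ^ r - r * (|x| ^ (r - 2) * x * z) := by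
  rw [bregman, (hasDerivAt_abs_rpow x hr).hasFDerivAt.fderiv]
  simp only [ContinuousLinearMap.toSpanSingleton_apply, smul_eq_mul]
  rw [← abs_rpow_sub_two_mul_self_mul_self (by linarith : r ≠ 0) x]
  ring

theorem bregman_abs_rpow_of_nonneg (hr : 1 < r) {x z : ℝ} (hx : 0 ≤ x) (hz : 0 ≤ z) :
    bregman (fun t : ℝ => |t| ^ r) x z = z ^ r + (r - 1) * x ^ r - r * (x ^ (r - 1) * z) := by
  rw [bregman_abs_rpow hr, abs_of_nonneg hx, abs_of_nonneg hz,
    ← Real.rpow_add_one' hx (by linarith), show r - 2 + 1 = r - 1 by ring]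

theorem bregman_abs_rpow_nonneg (hr : 1 < r) (x z : ℝ) :
    0 ≤ bregman (fun t : ℝ => |t| ^ r) x z :=
  bregman_nonneg_of_convexOn (convexOn_abs_rpow hr.le) (differentiable_abs_rpow hr) x z

theorem bregman_abs_rpow_swap_one_le_of_nonneg (hr : 2 ≤ r) {t : ℝ} (ht : 0 ≤ t) :
    bregman (fun t : ℝ => |t| ^ r) t 1 ≤ (r - 1) * bregman (fun t : ℝ => |t| ^ r) 1 t := by
  have hbernoulli := one_add_mul_self_le_rpow_one_add (s := t - 1) (by linarith) (p := r - 1)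
    (by linarith)
  rw [add_sub_cancel] at hbernoulli
  rw [bregman_abs_rpow_of_nonneg (by linarith) ht zero_le_one,
    bregman_abs_rpow_of_nonneg (by linarith) zero_le_one ht]
  simp only [Real.one_rpow]
  nlinarith

theorem bregman_abs_rpow_swap_one_le_of_nonpos (hr : 2 ≤ r) {t : ℝ} (ht : t ≤ 0) :
    bregman (fun t : ℝ => |t| ^ r) t 1 ≤ 2 * r * bregman (fun t : ℝ => |t| ^ r) 1 t := by
  obtain ⟨y, rfl⟩ : ∃ y, t = -y := ⟨-t, by ring⟩
  have hy : 0 ≤ y := by linarith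
  have hpow : y ^ (r - 1) ≤ 1 + y ^ r := by
    have hyr := Real.rpow_nonneg hy r
    rcases le_total y 1 with h | h
    · linarith [Real.rpow_le_one hy h (by linarith : 0 ≤ r - 1)]
    · linarith [Real.rpow_le_rpow_of_exponent_le h (by linarith : r - 1 ≤ r)]
  have hsub : y ^ (r - 2) * y = y ^ (r - 1) := by
    rw [← Real.rpow_add_one' hy (by linarith), show r - 2 + 1 = r - 1 by ring]
  rw [bregman_abs_rpow (by linarith), bregman_abs_rpow (by linarith)]
  simp only [abs_neg, abs_one, Real.one_rpow, abs_of_nonneg hy, mul_neg, mul_one, one_mul, hsub]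
  nlinarith [mul_nonneg (by linarith : 0 ≤ r) hy, Real.rpow_nonneg hy r]

theorem isBregmanQuasiSymm_abs_rpow_of_two_le (hr : 2 ≤ r) :
    IsBregmanQuasiSymm (2 * r) (fun t : ℝ => |t| ^ r) where
  differentiable := differentiable_abs_rpow (by linarith)
  nonneg := bregman_abs_rpow_nonneg (by linarith)
  symm_le x z := by
    rcases eq_or_ne x 0 with rfl | hx
    · rw [bregman_abs_rpow (by linarith), bregman_abs_rpow (by linarith)]
      simp only [abs_zero, Real.zero_rpow (by linarith : r ≠ 0), mul_zero, zero_mul]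
      nlinarith [Real.rpow_nonneg (abs_nonneg z) r]
    -- By homogeneity it suffices to compare the points `z / x` and `1`.
    · have hscale := (isAbsHomogeneous_abs_rpow r).bregman_smul_smul x
      have hx1 : x • (1 : ℝ) = x := mul_one x
      have hxz : x • (z / x) = z := mul_div_cancel₀ z hx
      have hzx := hscale (z / x) 1
      have hxz' := hscale 1 (z / x)
      rw [hx1, hxz] at hzx hxz'
      rw [hzx, hxz', mul_left_comm]
      refine mul_le_mul_of_nonneg_left ?_ (Real.rpow_nonneg (abs_nonneg x) r)
      rcases le_total 0 (z / x) with h | h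
      · refine (bregman_abs_rpow_swap_one_le_of_nonneg hr h).trans
          (mul_le_mul_of_nonneg_right (by linarith) (bregman_abs_rpow_nonneg (by linarith) _ _))
      · exact bregman_abs_rpow_swap_one_le_of_nonpos hr h

theorem rpow_sub_one_mul_le_bregman_abs_rpow_add (hr : 1 < r) {s x z D : ℝ} (hs : 1 ≤ s)
    (hx : 0 ≤ x) (hz : 0 ≤ z) (hD : 0 ≤ D) (hDle : D ≤ 2 * (z + (s - 1) * x)) :
    z ^ (r - 1) * D ≤
      (2 * r + 4 * s) * (bregman (fun t : ℝ => |t| ^ r) x z + x ^ (r - 1) * D) := by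
  have hb := bregman_abs_rpow_nonneg hr x z
  have hxD : 0 ≤ x ^ (r - 1) * D := mul_nonneg (Real.rpow_nonneg hx _) hD
  rcases le_or_gt (z ^ (r - 1)) (2 * r * x ^ (r - 1)) with h | h
  · nlinarith [mul_le_mul_of_nonneg_right h hD, mul_nonneg (by linarith : 0 ≤ s) hb]
  · have hxz : x ≤ z := by
      by_contra! hlt
      nlinarith [Real.rpow_le_rpow hz hlt.le (by linarith : 0 ≤ r - 1), Real.rpow_nonneg hx (r - 1)]
    have hzz : z ^ (r - 1) * z = z ^ r := by
      rw [← Real.rpow_add_one' hz (by linarith), sub_add_cancel]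
    have hbz : z ^ r ≤ 2 * bregman (fun t : ℝ => |t| ^ r) x z := by
      rw [bregman_abs_rpow_of_nonneg hr hx hz]
      nlinarith [mul_le_mul_of_nonneg_right h.le hz,
        mul_nonneg (by linarith : 0 ≤ r - 1) (Real.rpow_nonneg hx r)]
    calc z ^ (r - 1) * D ≤ z ^ (r - 1) * (2 * s * z) :=
          mul_le_mul_of_nonneg_left (by nlinarith) (Real.rpow_nonneg hz _)
      _ = 2 * s * z ^ r := by rw [← hzz]; ring
      _ ≤ 4 * s * bregman (fun t : ℝ => |t| ^ r) x z := by nlinarith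
      _ ≤ _ := by nlinarith

end AbsRpow

section LpPow

variable {ι : Type*} [Fintype ι] {p s p' s' : ℝ}

/-- The `s`-th power `∑ |X i| ^ s` of the `ℓ^s`-norm. -/
def powSum (s : ℝ) (X : ι → ℝ) : ℝ := ∑ i, |X i| ^ s

/-- The `p`-th power of the `ℓ^s`-norm, divided by `p`. -/
def lpPow (p s : ℝ) (X : ι → ℝ) : ℝ := 1 / p * powSum s X ^ (p / s)

/-- The gradient of `lpPow p s`, that is, the duality map of the `ℓ^s`-norm with respect to the
gauge `t ↦ t ^ (p - 1)`. -/
def lpDual (p s : ℝ) (X : ι → ℝ) (i : ι) : ℝ :=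
  powSum s X ^ (p / s - 1) * (|X i| ^ (s - 2) * X i)

theorem powSum_nonneg (s : ℝ) (X : ι → ℝ) : 0 ≤ powSum s X :=
  Finset.sum_nonneg fun _ _ => Real.rpow_nonneg (abs_nonneg _) _

theorem powSum_zero (hs : s ≠ 0) : powSum s (0 : ι → ℝ) = 0 := by
  simp [powSum, Real.zero_rpow hs]

theorem powSum_pos (s : ℝ) {X : ι → ℝ} (hX : X ≠ 0) : 0 < powSum s X := by
  obtain ⟨i, hi⟩ := Function.ne_iff.1 hX
  exact Finset.sum_pos' (fun i _ => Real.rpow_nonneg (abs_nonneg _) _)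
    ⟨i, Finset.mem_univ i, Real.rpow_pos_of_pos (abs_pos.2 hi) s⟩

theorem powSum_le_card_mul_norm_rpow (hs : 0 ≤ s) (X : ι → ℝ) :
    powSum s X ≤ Fintype.card ι * ‖X‖ ^ s := by
  calc powSum s X ≤ ∑ _i : ι, ‖X‖ ^ s := Finset.sum_le_sum fun i _ =>
        Real.rpow_le_rpow (abs_nonneg _) (norm_le_pi_norm X i) hs
    _ = _ := by simp

theorem hasFDerivAt_powSum (hs : 1 < s) (X : ι → ℝ) :
    HasFDerivAt (powSum s) (∑ i, (s * (|X i| ^ (s - 2) * X i)) •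
      (ContinuousLinearMap.proj i : (ι → ℝ) →L[ℝ] ℝ)) X := by
  refine HasFDerivAt.fun_sum fun i _ => ?_
  rw [← mul_assoc]
  exact (hasDerivAt_abs_rpow (X i) hs).comp_hasFDerivAt X
    (ContinuousLinearMap.proj i : (ι → ℝ) →L[ℝ] ℝ).hasFDerivAt

theorem isBregmanQuasiSymm_powSum {C : ℝ} (h : IsBregmanQuasiSymm C (fun t : ℝ => |t| ^ s)) :
    IsBregmanQuasiSymm C (powSum s : (ι → ℝ) → ℝ) :=
  IsBregmanQuasiSymm.sum (F := fun i (X : ι → ℝ) => |X i| ^ s) fun i =>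
    h.comp (ContinuousLinearMap.proj i : (ι → ℝ) →L[ℝ] ℝ)

theorem lpPow_self (hs : s ≠ 0) :
    (lpPow s s : (ι → ℝ) → ℝ) = fun X => 1 / s * powSum s X := by
  ext X; rw [lpPow, div_self hs, Real.rpow_one]

/-! #### The derivative -/

theorem hasFDerivAt_zero_of_abs_le_norm_rpow {W : Type*} [NormedAddCommGroup W]
    [NormedSpace ℝ W] {F : W → ℝ} {c : ℝ} (hp : 1 < p) (hF : ∀ X, |F X| ≤ c * ‖X‖ ^ p) :
    HasFDerivAt F (0 : W →L[ℝ] ℝ) 0 := by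
  have hF0 : F 0 = 0 := by simpa [Real.zero_rpow (by linarith : p ≠ 0)] using hF 0
  have hpow : (fun t : ℝ => |t| ^ p) =o[𝓝 0] fun t => t := by
    simpa [hasDerivAt_iff_isLittleO_nhds_zero, Real.zero_rpow (by linarith : p ≠ 0)] using
      hasDerivAt_abs_rpow 0 hp
  have hnorm : Tendsto (fun X : W => ‖X‖) (𝓝 0) (𝓝 0) := by
    simpa using (continuous_norm (E := W)).tendsto 0
  have hO : F =O[𝓝 0] fun X => ‖X‖ ^ p := Asymptotics.IsBigO.of_bound c <|
    Eventually.of_forall fun X => by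
      rw [Real.norm_eq_abs, Real.norm_of_nonneg (Real.rpow_nonneg (norm_nonneg X) p)]
      exact hF X
  rw [hasFDerivAt_iff_isLittleO_nhds_zero]
  have hlittle : F =o[𝓝 0] fun X => X := hO.trans_isLittleO <| Asymptotics.IsLittleO.of_norm_right
    (by simpa [Function.comp_def] using hpow.comp_tendsto hnorm)
  simpa [hF0] using hlittle

theorem abs_lpPow_le_norm_rpow (hp : 0 < p) (hs : 0 < s) (X : ι → ℝ) :
    |lpPow p s X| ≤ 1 / p * (Fintype.card ι : ℝ) ^ (p / s) * ‖X‖ ^ p := by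
  have hpow : powSum s X ^ (p / s) ≤ (Fintype.card ι : ℝ) ^ (p / s) * ‖X‖ ^ p := by
    refine (Real.rpow_le_rpow (powSum_nonneg _ _) (powSum_le_card_mul_norm_rpow hs.le X)
      (by positivity)).trans_eq ?_
    rw [Real.mul_rpow (by positivity) (by positivity), ← Real.rpow_mul (norm_nonneg _),
      mul_div_cancel₀ p hs.ne']
  rw [lpPow, abs_mul, abs_of_nonneg (by positivity : 0 ≤ 1 / p),
    abs_of_nonneg (Real.rpow_nonneg (powSum_nonneg _ _) _), mul_assoc]
  exact mul_le_mul_of_nonneg_left hpow (by positivity)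

theorem hasFDerivAt_lpPow (hp : 1 < p) (hs : 1 < s) (X : ι → ℝ) :
    HasFDerivAt (lpPow p s) (∑ i, lpDual p s X i •
      (ContinuousLinearMap.proj i : (ι → ℝ) →L[ℝ] ℝ)) X := by
  rcases eq_or_ne X 0 with rfl | hX
  · simpa [lpDual] using hasFDerivAt_zero_of_abs_le_norm_rpow hp
      (abs_lpPow_le_norm_rpow (ι := ι) (by linarith : 0 < p) (by linarith : 0 < s))
  · have hpow := ((Real.hasDerivAt_rpow_const (p := p / s)
      (Or.inl (powSum_pos s hX).ne')).comp_hasFDerivAt X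
      (hasFDerivAt_powSum hs X)).const_mul (1 / p)
    refine hpow.congr_fderiv ?_
    simp only [Finset.smul_sum, smul_smul, lpDual]
    refine Finset.sum_congr rfl fun i _ => ?_
    congr 1
    field_simp

theorem differentiable_lpPow (hp : 1 < p) (hs : 1 < s) :
    Differentiable ℝ (lpPow p s : (ι → ℝ) → ℝ) :=
  fun X => (hasFDerivAt_lpPow hp hs X).differentiableAt

theorem sum_lpDual_mul_self (hp : 0 < p) (hs : 0 < s) (X : ι → ℝ) :
    ∑ i, lpDual p s X i * X i = powSum s X ^ (p / s) := by
  simp only [lpDual, mul_assoc, ← Finset.mul_sum]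
  simp only [← mul_assoc, abs_rpow_sub_two_mul_self_mul_self hs.ne']
  rw [← powSum, ← Real.rpow_add_one' (powSum_nonneg s X) (by rw [sub_add_cancel]; positivity),
    sub_add_cancel]

theorem bregman_lpPow (hp : 1 < p) (hs : 1 < s) (X Z : ι → ℝ) :
    bregman (lpPow p s) X Z = 1 / p * powSum s Z ^ (p / s)
      + (1 - 1 / p) * powSum s X ^ (p / s) - ∑ i, lpDual p s X i * Z i := by
  rw [bregman, (hasFDerivAt_lpPow hp hs X).fderiv]
  simp only [_root_.sum_apply, _root_.smul_apply, ContinuousLinearMap.proj_apply, Pi.sub_apply,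
    smul_eq_mul, mul_sub, Finset.sum_sub_distrib,
    sum_lpDual_mul_self (by linarith : 0 < p) (by linarith : 0 < s), lpPow]
  ring

/-! #### Legendre duality -/

theorem lpDual_zero (p s : ℝ) : lpDual p s (0 : ι → ℝ) = 0 := by
  ext; simp [lpDual]

theorem abs_lpDual (hs : s ≠ 1) (X : ι → ℝ) (i : ι) :
    |lpDual p s X i| = powSum s X ^ (p / s - 1) * |X i| ^ (s - 1) := by
  rw [lpDual, abs_mul, abs_abs_rpow_sub_two_mul_self hs,
    abs_of_nonneg (Real.rpow_nonneg (powSum_nonneg s X) _)]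

theorem powSum_lpDual (hp : p ≠ 1) (hs : s.HolderConjugate s') (X : ι → ℝ) :
    powSum s' (lpDual p s X) = powSum s X ^ ((p - 1) * s' / s) := by
  have hs1 := hs.sub_one_pos
  have hs0 := hs.ne_zero
  rcases eq_or_ne X 0 with rfl | hX
  · rw [lpDual_zero, powSum_zero hs.symm.ne_zero, powSum_zero hs.ne_zero, Real.zero_rpow]
    exact div_ne_zero (mul_ne_zero (sub_ne_zero.2 hp) hs.symm.ne_zero) hs.ne_zero
  have hG := powSum_pos s hX
  have hterm : ∀ i, |lpDual p s X i| ^ s' = powSum s X ^ ((p / s - 1) * s') * |X i| ^ s := by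
    intro i
    rw [abs_lpDual hs.lt.ne', Real.mul_rpow (Real.rpow_nonneg hG.le _)
      (Real.rpow_nonneg (abs_nonneg _) _), ← Real.rpow_mul hG.le,
      ← Real.rpow_mul (abs_nonneg _), hs.sub_one_mul_conj]
  rw [powSum, Finset.sum_congr rfl fun i _ => hterm i, ← Finset.mul_sum, ← powSum,
    ← Real.rpow_add_one hG.ne', hs.conjugate_eq]
  congr 1
  field_simp
  ring

theorem lpDual_lpDual (hp : p.HolderConjugate p') (hs : s.HolderConjugate s') (X : ι → ℝ) :
    lpDual p' s' (lpDual p s X) = X := by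
  have hp1 := hp.sub_one_pos
  have hs1 := hs.sub_one_pos
  have hs0 := hs.ne_zero
  ext i
  rcases eq_or_ne (X i) 0 with hi | hi
  · simp [lpDual, hi]
  have hG := powSum_pos s (X := X) fun h => hi (by simp [h])
  have hXi := abs_pos.2 hi
  rw [lpDual, powSum_lpDual hp.lt.ne' hs, abs_lpDual hs.lt.ne',
    Real.mul_rpow (Real.rpow_nonneg hG.le _) (Real.rpow_nonneg (abs_nonneg _) _),
    ← Real.rpow_mul hG.le, ← Real.rpow_mul (abs_nonneg _), ← Real.rpow_mul hG.le, lpDual]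
  have hexpG : (p - 1) * s' / s * (p' / s' - 1) + (p / s - 1) * (s' - 2) + (p / s - 1) = 0 := by
    rw [hs.conjugate_eq, hp.conjugate_eq]; field_simp; ring
  have hexpX : (s - 1) * (s' - 2) + (s - 2) = 0 := by
    rw [hs.conjugate_eq]; field_simp; ring
  calc _ = (powSum s X ^ ((p - 1) * s' / s * (p' / s' - 1))
          * powSum s X ^ ((p / s - 1) * (s' - 2)) * powSum s X ^ (p / s - 1))
        * (|X i| ^ ((s - 1) * (s' - 2)) * |X i| ^ (s - 2)) * X i := by ring
    _ = X i := by
      rw [← Real.rpow_add hG, ← Real.rpow_add hG, ← Real.rpow_add hXi, hexpG, hexpX,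
        Real.rpow_zero, Real.rpow_zero, one_mul, one_mul]

theorem bregman_lpPow_dual (hp : p.HolderConjugate p') (hs : s.HolderConjugate s')
    (X Z : ι → ℝ) :
    bregman (lpPow p s) X Z = bregman (lpPow p' s') (lpDual p s Z) (lpDual p s X) := by
  have hp1 := hp.sub_one_pos
  have hs1 := hs.sub_one_pos
  have hp0 := hp.ne_zero
  have hs0 := hs.ne_zero
  have hexp : (p - 1) * s' / s * (p' / s') = p / s := by
    rw [hs.conjugate_eq, hp.conjugate_eq]; field_simp
  have hcoeff : 1 / p' = 1 - 1 / p := by rw [hp.conjugate_eq]; field_simp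
  rw [bregman_lpPow hp.lt hs.lt, bregman_lpPow hp.symm.lt hs.symm.lt, lpDual_lpDual hp hs,
    powSum_lpDual hp.lt.ne' hs, powSum_lpDual hp.lt.ne' hs, ← Real.rpow_mul (powSum_nonneg _ _),
    ← Real.rpow_mul (powSum_nonneg _ _), hexp, hcoeff]
  simp only [mul_comm (Z _)]
  ring

theorem IsBregmanQuasiSymm.lpPow_dual {C : ℝ} (hp : p.HolderConjugate p')
    (hs : s.HolderConjugate s') (h : IsBregmanQuasiSymm C (lpPow p' s' : (ι → ℝ) → ℝ)) :
    IsBregmanQuasiSymm C (lpPow p s : (ι → ℝ) → ℝ) where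
  differentiable := differentiable_lpPow hp.lt hs.lt
  nonneg X Z := by rw [bregman_lpPow_dual hp hs]; exact h.nonneg _ _
  symm_le X Z := by
    rw [bregman_lpPow_dual hp hs, bregman_lpPow_dual hp hs]; exact h.symm_le _ _

theorem exists_isBregmanQuasiSymm_abs_rpow {r : ℝ} (hr : 1 < r) :
    ∃ C, 0 ≤ C ∧ IsBregmanQuasiSymm C (fun t : ℝ => |t| ^ r) := by
  rcases le_total 2 r with h2 | h2
  · exact ⟨2 * r, by linarith, isBregmanQuasiSymm_abs_rpow_of_two_le h2⟩
  have hconj := Real.HolderConjugate.conjExponent hr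
  have hdual : IsBregmanQuasiSymm (2 * r.conjExponent)
      (lpPow r.conjExponent r.conjExponent : (Unit → ℝ) → ℝ) := by
    rw [lpPow_self hconj.symm.ne_zero]
    refine (isBregmanQuasiSymm_powSum (isBregmanQuasiSymm_abs_rpow_of_two_le ?_)).const_mul
      (one_div_nonneg.2 hconj.symm.nonneg)
    rw [Real.conjExponent, le_div_iff₀ hconj.sub_one_pos]
    linarith
  have habs : (fun t : ℝ => |t| ^ r) = fun t => r * lpPow r r fun _ : Unit => t := by
    ext t
    rw [lpPow_self hconj.ne_zero]
    simp [powSum, hconj.ne_zero]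
  refine ⟨2 * r.conjExponent, by linarith [hconj.symm.pos], habs ▸ ?_⟩
  exact ((hdual.lpPow_dual hconj hconj).const_mul hconj.nonneg).comp
    (ContinuousLinearMap.pi fun _ : Unit => ContinuousLinearMap.id ℝ ℝ)

/-! #### Quasi-symmetry -/

theorem bregman_powSum_le (hs : 1 < s) (X Z : ι → ℝ) :
    bregman (powSum s) X Z ≤ 2 * (powSum s Z + (s - 1) * powSum s X) := by
  have hdiff : ∀ i, Differentiable ℝ (fun X : ι → ℝ => |X i| ^ s) := fun i =>
    (differentiable_abs_rpow hs).comp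
      (ContinuousLinearMap.proj i : (ι → ℝ) →L[ℝ] ℝ).differentiable
  have hsum : bregman (powSum s) X Z
      = ∑ i, bregman (fun t : ℝ => |t| ^ s) (X i) (Z i) :=
    (bregman_sum hdiff X Z).trans <| Finset.sum_congr rfl fun i _ =>
      bregman_comp (differentiable_abs_rpow hs)
        (ContinuousLinearMap.proj i : (ι → ℝ) →L[ℝ] ℝ) X Z
  rw [hsum, powSum, powSum, Finset.mul_sum, ← Finset.sum_add_distrib, Finset.mul_sum]
  refine Finset.sum_le_sum fun i _ => ?_
  -- The bound for the pair `X i, Z i` is nonnegativity for the pair `X i, -Z i`.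
  have hneg := bregman_abs_rpow_nonneg hs (X i) (-(Z i))
  rw [bregman_abs_rpow hs, abs_neg] at hneg
  rw [bregman_abs_rpow hs]
  linarith

theorem bregman_lpPow_of_lt (hs : 1 < s) (hps : s < p) (X Z : ι → ℝ) :
    p * bregman (lpPow p s) X Z = bregman (fun t : ℝ => |t| ^ (p / s)) (powSum s X) (powSum s Z)
      + p / s * powSum s X ^ (p / s - 1) * bregman (powSum s) X Z := by
  have hp0 : p ≠ 0 := by linarith
  have hr : 1 < p / s := by rwa [one_lt_div (by linarith)]
  have hlp : (lpPow p s : (ι → ℝ) → ℝ) = fun X => 1 / p * |powSum s X| ^ (p / s) := by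
    ext X; rw [lpPow, abs_of_nonneg (powSum_nonneg s X)]
  have hderiv : deriv (fun t : ℝ => |t| ^ (p / s)) (powSum s X)
      = p / s * powSum s X ^ (p / s - 1) := by
    rw [(hasDerivAt_abs_rpow _ hr).deriv, mul_assoc, abs_of_nonneg (powSum_nonneg s X),
      ← Real.rpow_add_one' (powSum_nonneg s X) (by linarith)]
    ring_nf
  rw [hlp, bregman_const_mul, ← mul_assoc, mul_one_div_cancel hp0, one_mul,
    bregman_comp_real (G := powSum s) (differentiable_abs_rpow hr _)
      (hasFDerivAt_powSum hs X).differentiableAt, hderiv]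

theorem isBregmanQuasiSymm_lpPow_of_lt {C₁ C₂ : ℝ} (hs : 1 < s) (hps : s < p) (hC₁ : 0 ≤ C₁)
    (hC₂ : 0 ≤ C₂) (h₁ : IsBregmanQuasiSymm C₁ (fun t : ℝ => |t| ^ (p / s)))
    (h₂ : IsBregmanQuasiSymm C₂ (fun t : ℝ => |t| ^ s)) :
    IsBregmanQuasiSymm (C₁ + C₂ * (p / s) * (2 * (p / s) + 4 * s))
      (lpPow p s : (ι → ℝ) → ℝ) := by
  have hp0 : 0 < p := by linarith
  have hr : 1 < p / s := by rwa [one_lt_div (by linarith)]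
  have hsum : IsBregmanQuasiSymm C₂ (powSum s : (ι → ℝ) → ℝ) := isBregmanQuasiSymm_powSum h₂
  refine ⟨differentiable_lpPow (by linarith) hs, fun X Z => ?_, fun X Z => ?_⟩
  · refine (mul_nonneg_iff_of_pos_left hp0).1 ?_
    rw [bregman_lpPow_of_lt hs hps]
    exact add_nonneg (h₁.nonneg _ _) (mul_nonneg (mul_nonneg (by positivity)
      (Real.rpow_nonneg (powSum_nonneg _ _) _)) (hsum.nonneg _ _))
  · refine le_of_mul_le_mul_left ?_ hp0
    rw [mul_left_comm, bregman_lpPow_of_lt hs hps, bregman_lpPow_of_lt hs hps]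
    have hkey := rpow_sub_one_mul_le_bregman_abs_rpow_add hr hs.le (powSum_nonneg s X)
      (powSum_nonneg s Z) (hsum.nonneg X Z) (bregman_powSum_le hs X Z)
    have hXr := Real.rpow_nonneg (powSum_nonneg s X) (p / s - 1)
    have hZr := Real.rpow_nonneg (powSum_nonneg s Z) (p / s - 1)
    have hD := hsum.nonneg X Z
    have hsymm₁ := h₁.symm_le (powSum s X) (powSum s Z)
    have hsymm₂ := hsum.symm_le X Z
    set r := p / s
    set D := bregman (powSum s) X Z
    set b := bregman (fun t : ℝ => |t| ^ r) (powSum s X) (powSum s Z)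
    set c := 2 * r + 4 * s
    have hr_mul : powSum s X ^ (r - 1) * D ≤ r * powSum s X ^ (r - 1) * D := by
      rw [mul_assoc]; exact le_mul_of_one_le_left (by positivity) hr.le
    have hsecond : r * powSum s Z ^ (r - 1) * bregman (powSum s) Z X
        ≤ C₂ * r * c * (b + r * powSum s X ^ (r - 1) * D) := by
      calc _ ≤ r * powSum s Z ^ (r - 1) * (C₂ * D) :=
            mul_le_mul_of_nonneg_left hsymm₂ (by positivity)
        _ = C₂ * r * (powSum s Z ^ (r - 1) * D) := by ring
        _ ≤ C₂ * r * (c * (b + powSum s X ^ (r - 1) * D)) :=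
            mul_le_mul_of_nonneg_left hkey (by positivity)
        _ ≤ C₂ * r * (c * (b + r * powSum s X ^ (r - 1) * D)) := by gcongr
        _ = _ := by ring
    have hrest : 0 ≤ C₁ * (r * powSum s X ^ (r - 1) * D) := by positivity
    linarith

theorem exists_isBregmanQuasiSymm_lpPow_of_le (hs : 1 < s) (hps : s ≤ p) :
    ∃ C, ∀ (ι : Type*) [Fintype ι], IsBregmanQuasiSymm C (lpPow p s : (ι → ℝ) → ℝ) := by
  obtain ⟨C₂, hC₂, h₂⟩ := exists_isBregmanQuasiSymm_abs_rpow hs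
  rcases hps.eq_or_lt with rfl | hps
  · refine ⟨C₂, fun ι _ => ?_⟩
    rw [lpPow_self (by linarith)]
    exact (isBregmanQuasiSymm_powSum h₂).const_mul (by positivity)
  · have hr : 1 < p / s := by rwa [one_lt_div (by linarith)]
    obtain ⟨C₁, hC₁, h₁⟩ := exists_isBregmanQuasiSymm_abs_rpow hr
    exact ⟨_, fun ι _ => isBregmanQuasiSymm_lpPow_of_lt hs hps hC₁ hC₂ h₁ h₂⟩

theorem exists_isBregmanQuasiSymm_lpPow (hp : 1 < p) (hs : 1 < s) :
    ∃ C, ∀ (ι : Type*) [Fintype ι], IsBregmanQuasiSymm C (lpPow p s : (ι → ℝ) → ℝ) := by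
  rcases le_total s p with hsp | hps
  · exact exists_isBregmanQuasiSymm_lpPow_of_le hs hsp
  · have hpc := Real.HolderConjugate.conjExponent hp
    have hsc := Real.HolderConjugate.conjExponent hs
    obtain ⟨C, hdual⟩ := exists_isBregmanQuasiSymm_lpPow_of_le hsc.symm.lt
      (p := p.conjExponent) (by
        rw [Real.conjExponent, Real.conjExponent,
          div_le_div_iff₀ hsc.sub_one_pos hpc.sub_one_pos]
        linarith)
    exact ⟨C, fun ι _ => (hdual ι).lpPow_dual hpc hsc⟩

end LpPow

/-! ### Flat cutoff functions -/

section Cutoff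

/-- A smooth even step: it vanishes on `[-1, 1]` and equals `1` outside `(-2, 2)`. Its
powers are the cutoff functions used to truncate quotients. -/
def smoothStep (t : ℝ) : ℝ := Real.smoothTransition ((t ^ 2 - 1) / 3)

theorem contDiff_smoothStep : ContDiff ℝ 1 smoothStep :=
  Real.smoothTransition.contDiff.comp (by fun_prop)

theorem smoothStep_nonneg (t : ℝ) : 0 ≤ smoothStep t := Real.smoothTransition.nonneg _

theorem smoothStep_le_one (t : ℝ) : smoothStep t ≤ 1 := Real.smoothTransition.le_one _

theorem smoothStep_of_abs_le_one {t : ℝ} (ht : |t| ≤ 1) : smoothStep t = 0 :=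
  Real.smoothTransition.zero_of_nonpos (by nlinarith [sq_abs t, abs_nonneg t])

theorem smoothStep_of_two_le_abs {t : ℝ} (ht : 2 ≤ |t|) : smoothStep t = 1 :=
  Real.smoothTransition.one_of_one_le (by nlinarith [sq_abs t, abs_nonneg t])

theorem smoothStep_pos {t : ℝ} (ht : 1 < |t|) : 0 < smoothStep t :=
  Real.smoothTransition.pos_of_pos (by nlinarith [sq_abs t, abs_nonneg t])

theorem mul_deriv_smoothStep_nonneg (t : ℝ) : 0 ≤ t * deriv smoothStep t := by
  have hinner : HasDerivAt (fun t : ℝ => (t ^ 2 - 1) / 3) (2 * t / 3) t := by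
    simpa using (((hasDerivAt_id t).pow 2).sub_const 1).div_const 3
  have hderiv : deriv smoothStep t
      = deriv Real.smoothTransition ((t ^ 2 - 1) / 3) * (2 * t / 3) :=
    (((Real.smoothTransition.contDiff (n := 1)).differentiable one_ne_zero
      ((t ^ 2 - 1) / 3)).hasDerivAt.comp t hinner).deriv
  have hmono := Real.smoothTransition.monotone.deriv_nonneg (x := (t ^ 2 - 1) / 3)
  rw [hderiv]
  nlinarith [mul_nonneg hmono (sq_nonneg t)]

theorem exists_forall_mul_deriv_smoothStep_le : ∃ B, 1 ≤ B ∧ ∀ t, t * deriv smoothStep t ≤ B := by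
  have hcont : Continuous fun t => t * deriv smoothStep t :=
    continuous_id.mul (contDiff_smoothStep.continuous_deriv le_rfl)
  obtain ⟨B, hB⟩ := (isCompact_Icc (a := (-2 : ℝ)) (b := 2)).exists_bound_of_continuousOn
    hcont.continuousOn
  refine ⟨max B 1, le_max_right B 1, fun t => ?_⟩
  rcases le_total 2 |t| with ht | ht
  · have hmax : IsLocalMax smoothStep t := Eventually.of_forall fun y => by
      rw [smoothStep_of_two_le_abs ht]; exact smoothStep_le_one y
    rw [hmax.deriv_eq_zero, mul_zero]
    exact zero_le_one.trans (le_max_right B 1)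
  · exact ((le_abs_self _).trans (hB t (abs_le.1 ht))).trans (le_max_left B 1)

/-- A cutoff function `ρ` that vanishes on `[-1, 1]`, equals `1` outside `(-2, 2)`, and is so flat
near its zeros that the large values of its logarithmic derivative there are compensated by the
smallness of `ρ`: the number `κ` in `exists_flat` bounds both, with exponents `p` and `b`. -/
structure IsFlatCutoff (p b M : ℝ) (ρ : ℝ → ℝ) : Prop where
  contDiff : ContDiff ℝ 1 ρ
  le_one : ∀ t, ρ t ≤ 1
  eq_zero : ∀ t, |t| ≤ 1 → ρ t = 0
  eq_one : ∀ t, 2 ≤ |t| → ρ t = 1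
  pos : ∀ t, 1 < |t| → 0 < ρ t
  mul_deriv_nonneg : ∀ t, 0 ≤ t * deriv ρ t
  exists_flat : ∀ t, 1 < |t| → ∃ κ, 0 < κ ∧ κ ≤ 1 ∧ t * deriv ρ t ≤ M / κ * ρ t ∧ ρ t ^ p ≤ κ ^ b

theorem exists_isFlatCutoff {p : ℝ} (hp : 0 < p) (b : ℝ) :
    ∃ (ρ : ℝ → ℝ) (M : ℝ), 1 ≤ M ∧ IsFlatCutoff p b M ρ := by
  obtain ⟨m, hm⟩ := exists_nat_ge (b / p)
  obtain ⟨B, hB, hBle⟩ := exists_forall_mul_deriv_smoothStep_le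
  have hmul_deriv : ∀ t, t * deriv (fun t => smoothStep t ^ (m + 1)) t
      = (m + 1) * smoothStep t ^ m * (t * deriv smoothStep t) := fun t => by
    have hdiff := contDiff_smoothStep.differentiable one_ne_zero t
    rw [(hdiff.hasDerivAt.fun_pow (m + 1)).deriv]
    push_cast [add_tsub_cancel_right]
    ring
  refine ⟨fun t => smoothStep t ^ (m + 1), (m + 1) * B, by nlinarith [m.cast_nonneg (α := ℝ)], ?_⟩
  exact {
    contDiff := contDiff_smoothStep.pow (m + 1)
    le_one := fun t => pow_le_one₀ (smoothStep_nonneg t) (smoothStep_le_one t)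
    eq_zero := fun t ht => by simp [smoothStep_of_abs_le_one ht]
    eq_one := fun t ht => by simp [smoothStep_of_two_le_abs ht]
    pos := fun t ht => pow_pos (smoothStep_pos ht) _
    mul_deriv_nonneg := fun t => by
      rw [hmul_deriv]
      have hstep := smoothStep_nonneg t
      have hderiv := mul_deriv_smoothStep_nonneg t
      positivity
    exists_flat := fun t ht => by
      have hpos := smoothStep_pos ht
      refine ⟨smoothStep t, hpos, smoothStep_le_one t, ?_, ?_⟩
      · rw [hmul_deriv]
        refine (mul_le_mul_of_nonneg_left (hBle t) (by positivity)).trans_eq ?_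
        rw [pow_succ]
        field_simp
      · rw [← Real.rpow_natCast, ← Real.rpow_mul hpos.le]
        refine Real.rpow_le_rpow_of_exponent_ge hpos (smoothStep_le_one t) ?_
        rw [← div_le_iff₀ hp]
        push_cast
        linarith }

namespace IsFlatCutoff

variable {p b M : ℝ} {ρ : ℝ → ℝ}

theorem deriv_of_abs_le_one (h : IsFlatCutoff p b M ρ) {t : ℝ} (ht : |t| ≤ 1) :
    deriv ρ t = 0 := by
  refine IsLocalMin.deriv_eq_zero (Eventually.of_forall fun y => ?_)
  rw [h.eq_zero t ht]
  rcases le_or_gt |y| 1 with hy | hy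
  · exact (h.eq_zero y hy).ge
  · exact (h.pos y hy).le

theorem deriv_of_two_le_abs (h : IsFlatCutoff p b M ρ) {t : ℝ} (ht : 2 ≤ |t|) :
    deriv ρ t = 0 :=
  IsLocalMax.deriv_eq_zero <| Eventually.of_forall fun y =>
    (h.le_one y).trans_eq (h.eq_one t ht).symm

theorem bregman_le {W : Type*} [NormedAddCommGroup W] [NormedSpace ℝ W] {F : W → ℝ} {C : ℝ}
    (h : IsFlatCutoff p (1 + C) M ρ) (hM : 1 ≤ M) (hp : 0 ≤ p) (hF : IsBregmanQuasiSymm C F)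
    (hhom : IsAbsHomogeneous p F) {t : ℝ} (ht : 1 < |t|) (X Y : W) :
    bregman F (ρ t • X) (ρ t • X + deriv ρ t • Y)
      ≤ M ^ (1 + C) * bregman F (t • X) (t • X + Y) := by
  have ht0 : t ≠ 0 := abs_pos.1 (by linarith)
  have hρ := h.pos t ht
  obtain ⟨κ, hκ, hκ1, hlog, hρκ⟩ := h.exists_flat t ht
  -- Pulling out the factors `ρ t` and `t`, both sides compare `X` with points of one ray from `X`.
  set Y' := t⁻¹ • Y with hY'
  have hleft : ρ t • X + deriv ρ t • Y = ρ t • (X + (t * deriv ρ t / ρ t) • Y') := by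
    rw [smul_add, smul_smul, hY', smul_smul]; congr 2; field_simp
  have hright : t • X + Y = t • (X + Y') := by
    rw [smul_add, hY', smul_smul, mul_inv_cancel₀ ht0, one_smul]
  rw [hleft, hright, hhom.bregman_smul_smul, hhom.bregman_smul_smul, abs_of_pos hρ]
  have hray : bregman F X (X + (t * deriv ρ t / ρ t) • Y')
      ≤ (M / κ) ^ (1 + C) * bregman F X (X + Y') :=
    hF.bregman_ray_le X Y' (div_nonneg (h.mul_deriv_nonneg t) hρ.le) (by rwa [div_le_iff₀ hρ])
      (by rw [le_div_iff₀ hκ]; linarith)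
  have hκp : 0 < κ ^ (1 + C) := Real.rpow_pos_of_pos hκ _
  calc ρ t ^ p * bregman F X (X + (t * deriv ρ t / ρ t) • Y')
      ≤ κ ^ (1 + C) * ((M / κ) ^ (1 + C) * bregman F X (X + Y')) :=
        mul_le_mul hρκ hray (hF.nonneg _ _) hκp.le
    _ = M ^ (1 + C) * (1 * bregman F X (X + Y')) := by
        rw [Real.div_rpow (by linarith) hκ.le]; field_simp
    _ ≤ M ^ (1 + C) * (|t| ^ p * bregman F X (X + Y')) :=
        mul_le_mul_of_nonneg_left
          (mul_le_mul_of_nonneg_right (Real.one_le_rpow ht.le hp) (hF.nonneg _ _))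
          (Real.rpow_nonneg (by linarith) _)

end IsFlatCutoff

end Cutoff

/-! ### The norms `H(x, ·)` -/

section MixedNorm

variable {n : ℕ} {p s : ℝ}

theorem sNorm_nonneg {a : Fin n → ℝ} (ha : ∀ i, 0 ≤ a i) (ξ : E n) : 0 ≤ sNorm s a ξ :=
  Real.rpow_nonneg (Finset.sum_nonneg fun i _ =>
    mul_nonneg (ha i) (Real.rpow_nonneg (abs_nonneg _) _)) _

theorem matNorm_nonneg (A : Matrix (Fin n) (Fin n) ℝ) (ξ : E n) : 0 ≤ matNorm A ξ :=
  Real.sqrt_nonneg _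

theorem sNorm_smul (hs : s ≠ 0) {a : Fin n → ℝ} (ha : ∀ i, 0 ≤ a i) (c : ℝ) (ξ : E n) :
    sNorm s a (c • ξ) = |c| * sNorm s a ξ := by
  have hsum : ∑ i, a i * |(c • ξ) i| ^ s = |c| ^ s * ∑ i, a i * |ξ i| ^ s := by
    rw [Finset.mul_sum]
    refine Finset.sum_congr rfl fun i _ => ?_
    rw [PiLp.smul_apply, smul_eq_mul, abs_mul, Real.mul_rpow (abs_nonneg _) (abs_nonneg _)]
    ring
  rw [sNorm, sNorm, hsum, Real.mul_rpow (Real.rpow_nonneg (abs_nonneg _) _)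
      (Finset.sum_nonneg fun i _ => mul_nonneg (ha i) (Real.rpow_nonneg (abs_nonneg _) _)),
    ← Real.rpow_mul (abs_nonneg _), mul_one_div_cancel hs, Real.rpow_one]

theorem matNorm_smul (A : Matrix (Fin n) (Fin n) ℝ) (c : ℝ) (ξ : E n) :
    matNorm A (c • ξ) = |c| * matNorm A ξ := by
  have hcoord : (fun i => (c • ξ) i) = c • fun i => ξ i := by ext; simp
  rw [matNorm, matNorm, hcoord, Matrix.mulVec_smul, smul_dotProduct, dotProduct_smul, smul_eq_mul,
    smul_eq_mul, ← mul_assoc, Real.sqrt_mul (mul_self_nonneg c), Real.sqrt_mul_self_eq_abs]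

theorem mixedNorm_rpow (hp : p ≠ 0) {a : E n → Fin n → ℝ} (A : E n → Matrix (Fin n) (Fin n) ℝ)
    {x : E n} (ha : ∀ i, 0 ≤ a x i) (ξ : E n) :
    mixedNorm p s a A x ξ ^ p = sNorm s (a x) ξ ^ p + matNorm (A x) ξ ^ p := by
  rw [mixedNorm, ← Real.rpow_mul, one_div_mul_cancel hp, Real.rpow_one]
  exact add_nonneg (Real.rpow_nonneg (sNorm_nonneg ha ξ) p)
    (Real.rpow_nonneg (matNorm_nonneg _ ξ) p)

theorem isAbsHomogeneous_mixedNorm_rpow (hp : p ≠ 0) (hs : s ≠ 0) {a : E n → Fin n → ℝ}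
    (A : E n → Matrix (Fin n) (Fin n) ℝ) {x : E n} (ha : ∀ i, 0 ≤ a x i) :
    IsAbsHomogeneous p (fun ξ => mixedNorm p s a A x ξ ^ p) := fun c ξ => by
  simp only [mixedNorm_rpow hp A ha, sNorm_smul hs ha, matNorm_smul,
    Real.mul_rpow (abs_nonneg c) (sNorm_nonneg ha ξ),
    Real.mul_rpow (abs_nonneg c) (matNorm_nonneg _ ξ), mul_add]

theorem sNorm_rpow_eq_lpPow (hs : s ≠ 0) {a : Fin n → ℝ} (ha : ∀ i, 0 ≤ a i) (ξ : E n) :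
    1 / p * sNorm s a ξ ^ p = lpPow p s (fun i => a i ^ (1 / s) * ξ i) := by
  have hterm : ∀ i, |a i ^ (1 / s) * ξ i| ^ s = a i * |ξ i| ^ s := fun i => by
    rw [abs_mul, abs_of_nonneg (Real.rpow_nonneg (ha i) _), Real.mul_rpow
      (Real.rpow_nonneg (ha i) _) (abs_nonneg _), ← Real.rpow_mul (ha i),
      one_div_mul_cancel hs, Real.rpow_one]
  rw [sNorm, lpPow, powSum, ← Real.rpow_mul (Finset.sum_nonneg fun i _ =>
    mul_nonneg (ha i) (Real.rpow_nonneg (abs_nonneg _) _)), one_div_mul_eq_div s p]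
  simp only [hterm]

theorem exists_matNorm_rpow_eq_lpPow {A : Matrix (Fin n) (Fin n) ℝ} (hA : A.PosSemidef) (p : ℝ) :
    ∃ B : Matrix (Fin n) (Fin n) ℝ, ∀ ξ : E n,
      1 / p * matNorm A ξ ^ p = lpPow p 2 (B.mulVec (fun i => ξ i)) := by
  open scoped MatrixOrder in
  obtain ⟨B, rfl⟩ := CStarAlgebra.nonneg_iff_eq_star_mul_self.mp hA.nonneg
  refine ⟨B, fun ξ => ?_⟩
  have hsq : ((star B * B).mulVec (fun i => ξ i)) ⬝ᵥ (fun i => ξ i)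
      = powSum 2 (B.mulVec (fun i => ξ i)) := by
    rw [Matrix.star_eq_conjTranspose, Matrix.conjTranspose_eq_transpose_of_trivial,
      ← Matrix.mulVec_mulVec, dotProduct_comm, Matrix.dotProduct_mulVec, Matrix.vecMul_transpose]
    simp only [powSum, Real.rpow_two, sq_abs, dotProduct, ← sq]
  rw [matNorm, hsq, lpPow, Real.sqrt_eq_rpow, ← Real.rpow_mul (powSum_nonneg _ _),
    one_div_mul_eq_div 2 p]

theorem exists_isBregmanQuasiSymm_mixedNorm (hp : 1 < p) (hs : 1 < s) :
    ∃ C, ∀ (n : ℕ) (a : E n → Fin n → ℝ) (A : E n → Matrix (Fin n) (Fin n) ℝ) (x : E n),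
      (∀ i, 0 ≤ a x i) → (A x).PosSemidef →
        IsBregmanQuasiSymm C (fun ξ => 1 / p * mixedNorm p s a A x ξ ^ p) := by
  obtain ⟨C₁, hlp⟩ := exists_isBregmanQuasiSymm_lpPow hp hs
  obtain ⟨C₂, hl2⟩ := exists_isBregmanQuasiSymm_lpPow hp one_lt_two
  refine ⟨max C₁ C₂, fun n a A x ha hA => ?_⟩
  obtain ⟨B, hB⟩ := exists_matNorm_rpow_eq_lpPow hA p
  have hsplit : (fun ξ => 1 / p * mixedNorm p s a A x ξ ^ p) = fun ξ =>
      lpPow p s (fun i => a x i ^ (1 / s) * ξ i) + lpPow p 2 (B.mulVec (fun i => ξ i)) := by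
    ext ξ
    rw [mixedNorm_rpow (by linarith) A ha, mul_add, sNorm_rpow_eq_lpPow (by linarith) ha, hB]
  rw [hsplit]
  have hweight := ((hlp (Fin n)).mono (le_max_left C₁ C₂)).comp (ContinuousLinearMap.pi fun i =>
    (a x i ^ (1 / s)) • (EuclideanSpace.proj i : E n →L[ℝ] ℝ))
  have hmatrix := ((hl2 (Fin n)).mono (le_max_right C₁ C₂)).comp
    ((Matrix.mulVecLin B).toContinuousLinearMap.comp
      (ContinuousLinearMap.pi fun i => (EuclideanSpace.proj i : E n →L[ℝ] ℝ)))
  exact hweight.add hmatrix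

end MixedNorm

/-! ### Weak gradients -/

section WeakGrad

variable {n : ℕ} {p : ℝ} {Ω K : Set (E n)}

theorem gradient_apply (f : E n → ℝ) (x : E n) (i : Fin n) :
    gradient f x i = fderiv ℝ f x (EuclideanSpace.single i 1) := by
  rw [← inner_gradient_left, EuclideanSpace.inner_single_right]
  simp

theorem continuous_fderiv_apply {f : E n → ℝ} (hf : ContDiff ℝ 1 f) (v : E n) :
    Continuous fun x => fderiv ℝ f x v :=
  (hf.continuous_fderiv one_ne_zero).clm_apply continuous_const

theorem continuous_gradient {f : E n → ℝ} (hf : ContDiff ℝ 1 f) : Continuous (gradient f) :=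
  (InnerProductSpace.toDual ℝ (E n)).symm.continuous.comp (hf.continuous_fderiv one_ne_zero)

theorem gradient_eq_zero_of_notMem_tsupport {f : E n → ℝ} {x : E n} (hx : x ∉ tsupport f) :
    gradient f x = 0 := by
  have hfderiv : fderiv ℝ f x = 0 := by
    by_contra h
    exact hx (support_fderiv_subset ℝ h)
  rw [gradient, hfderiv, map_zero]

theorem locallyIntegrableOn_apply {G : E n → E n} (hG : LocallyIntegrableOn G Ω) (i : Fin n) :
    LocallyIntegrableOn (fun x => G x i) Ω := fun x hx => by
  obtain ⟨t, ht, hGt⟩ := hG x hx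
  exact ⟨t, ht, (EuclideanSpace.proj i : E n →L[ℝ] ℝ).integrable_comp hGt⟩

theorem integrable_mul_of_locallyIntegrableOn {c g : E n → ℝ} (hc : Continuous c)
    (hcs : HasCompactSupport c) (hcΩ : tsupport c ⊆ Ω) (hg : LocallyIntegrableOn g Ω) :
    Integrable (fun x => c x * g x) := by
  have hcg : IntegrableOn (fun x => c x * g x) (tsupport c) :=
    (hg.integrableOn_compact_subset hcΩ hcs).continuousOn_mul hc.continuousOn hcs
  exact (integrableOn_iff_integrable_of_support_subset
    fun x hx => subset_tsupport c (left_ne_zero_of_mul hx)).1 hcg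

theorem continuous_smul_of_tsupport_subset {W : Type*} [NormedAddCommGroup W] [NormedSpace ℝ W]
    (hΩ : IsOpen Ω) {c : E n → W} {f : E n → ℝ} (hc : Continuous c) (hcΩ : tsupport c ⊆ Ω)
    (hf : ContinuousOn f Ω) : Continuous fun x => f x • c x := by
  refine continuous_iff_continuousAt.2 fun x => ?_
  by_cases hx : x ∈ tsupport c
  · exact (hf.continuousAt (hΩ.mem_nhds (hcΩ hx))).smul hc.continuousAt
  · refine (continuousAt_const (y := (0 : W))).congr ?_
    filter_upwards [notMem_tsupport_iff_eventuallyEq.1 hx] with y hy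
    rw [hy, Pi.zero_apply, smul_zero]

theorem integral_mul_fderiv_of_contDiff {f φ : E n → ℝ} (hf : ContDiff ℝ 1 f)
    (hφ : ContDiff ℝ 1 φ) (hφs : HasCompactSupport φ) (v : E n) :
    ∫ x, f x * fderiv ℝ φ x v = -∫ x, fderiv ℝ f x v * φ x :=
  integral_mul_fderiv_eq_neg_fderiv_mul_of_integrable
    (((continuous_fderiv_apply hf v).mul hφ.continuous).integrable_of_hasCompactSupport
      hφs.mul_left)
    ((hf.continuous.mul (continuous_fderiv_apply hφ v)).integrable_of_hasCompactSupport
      (hφs.fderiv_apply (𝕜 := ℝ) v).mul_left)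
    ((hf.continuous.mul hφ.continuous).integrable_of_hasCompactSupport hφs.mul_left)
    (fun x _ => hf.differentiable one_ne_zero x) (fun x _ => hφ.differentiable one_ne_zero x)

section IsTest

variable {φ χ : E n → ℝ}

theorem IsTest.contDiff_one (h : IsTest Ω φ) : ContDiff ℝ 1 φ :=
  h.1.of_le (by exact_mod_cast le_top)

theorem IsTest.eq_zero (h : IsTest Ω φ) {x : E n} (hx : x ∉ Ω) : φ x = 0 :=
  image_eq_zero_of_notMem_tsupport fun hx' => hx (h.2.2 hx')

theorem IsTest.fderiv_apply (h : IsTest Ω φ) (v : E n) : IsTest Ω fun x => fderiv ℝ φ x v :=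
  ⟨(h.1.fderiv_right (m := (⊤ : ℕ∞)) (by simp)).clm_apply contDiff_const,
    h.2.1.fderiv_apply (𝕜 := ℝ) v, (tsupport_fderiv_apply_subset ℝ v).trans h.2.2⟩

theorem IsTest.mul (h : IsTest Ω χ) (hφ : ContDiff ℝ (⊤ : ℕ∞) φ) :
    IsTest Ω fun x => χ x * φ x :=
  ⟨h.1.mul hφ, h.2.1.mul_right,
    (closure_mono (Function.support_mul_subset_left χ φ)).trans h.2.2⟩

theorem exists_isTest_one_nhds (hΩ : IsOpen Ω) (hK : IsCompact K) (hKΩ : K ⊆ Ω) :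
    ∃ χ : E n → ℝ, IsTest Ω χ ∧ (∀ x, 0 ≤ χ x ∧ χ x ≤ 1) ∧ ∀ᶠ x in 𝓝ˢ K, χ x = 1 := by
  obtain ⟨L, hL, hKL, hLΩ⟩ := exists_compact_between hK hΩ hKΩ
  obtain ⟨f, hone, hzero, hf⟩ := exists_contMDiffMap_one_nhds_of_subset_interior
    (n := (⊤ : ℕ∞)) (modelWithCornersSelf ℝ (E n)) hK.isClosed hKL
  have hsupp : tsupport f ⊆ L := closure_minimal (fun x hx => by
    by_contra hxL; exact hx (hzero x hxL)) hL.isClosed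
  exact ⟨f, ⟨f.contMDiff.contDiff, HasCompactSupport.intro hL hzero, hsupp.trans hLΩ⟩,
    fun x => ⟨(hf x).1, (hf x).2⟩, hone⟩

end IsTest

theorem HasWeakGrad.ae_eq (hΩ : IsOpen Ω) {f : E n → ℝ} {G G' : E n → E n}
    (h : HasWeakGrad Ω f G) (h' : HasWeakGrad Ω f G') : G =ᵐ[volume.restrict Ω] G' := by
  have hcoord : ∀ i : Fin n, ∀ᵐ x, x ∈ Ω → G x i - G' x i = 0 := fun i => by
    have hGi := locallyIntegrableOn_apply h.2.1 i
    have hGi' := locallyIntegrableOn_apply h'.2.1 i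
    refine hΩ.ae_eq_zero_of_integral_contDiff_smul_eq_zero (hGi.sub hGi') fun φ hφ hφs hφΩ => ?_
    have hφt : IsTest Ω φ := ⟨hφ, hφs, hφΩ⟩
    have hswap : ∀ G : E n → E n, ∫ x in Ω, G x i * φ x = ∫ x, φ x * G x i := fun G => by
      rw [setIntegral_eq_integral_of_forall_compl_eq_zero
        fun x hx => by rw [hφt.eq_zero hx, mul_zero]]
      simp only [mul_comm]
    have hG := h.2.2 φ hφt i
    have hG' := h'.2.2 φ hφt i
    rw [hswap] at hG hG'
    simp only [smul_eq_mul, mul_sub]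
    rw [integral_sub (integrable_mul_of_locallyIntegrableOn hφ.continuous hφs hφΩ hGi)
      (integrable_mul_of_locallyIntegrableOn hφ.continuous hφs hφΩ hGi')]
    linarith
  rw [Filter.EventuallyEq, ae_restrict_iff' hΩ.measurableSet]
  filter_upwards [ae_all_iff.2 hcoord] with x hx hxΩ
  ext i
  exact sub_eq_zero.1 (hx i hxΩ)

theorem HasWeakGrad.weakGrad_ae_eq (hΩ : IsOpen Ω) {f : E n → ℝ} {G : E n → E n}
    (h : HasWeakGrad Ω f G) : weakGrad Ω f =ᵐ[volume.restrict Ω] G := by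
  have hex : ∃ G, HasWeakGrad Ω f G := ⟨G, h⟩
  rw [weakGrad, dif_pos hex]
  exact hex.choose_spec.ae_eq hΩ h

theorem HasWeakGrad.sub_const {f : E n → ℝ} {G : E n → E n} (h : HasWeakGrad Ω f G) (c : ℝ) :
    HasWeakGrad Ω (fun x => f x - c) G := by
  refine ⟨h.1.sub (locallyIntegrableOn_const c), h.2.1, fun φ hφ i => ?_⟩
  have hφ' := hφ.fderiv_apply (EuclideanSpace.single i 1)
  have hconst : ∫ x in Ω, c * fderiv ℝ φ x (EuclideanSpace.single i 1) = 0 := by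
    rw [setIntegral_eq_integral_of_forall_compl_eq_zero
      fun x hx => by rw [hφ'.eq_zero hx, mul_zero],
      integral_mul_fderiv_of_contDiff (contDiff_const (c := c)) hφ.contDiff_one hφ.2.1]
    simp
  have hint := integrable_mul_of_locallyIntegrableOn hφ'.1.continuous hφ'.2.1 hφ'.2.2 h.1
  simp only [mul_comm] at hint
  have hint' := (hφ'.1.continuous.integrable_of_hasCompactSupport hφ'.2.1 (μ := volume)).const_mul c
  simp only [sub_mul]
  rw [integral_sub hint.integrableOn hint'.integrableOn, hconst, sub_zero, h.2.2 φ hφ i]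

theorem fderiv_mul_apply {χ φ : E n → ℝ} (hχ : ContDiff ℝ 1 χ) (hφ : ContDiff ℝ 1 φ) (e x : E n) :
    fderiv ℝ (fun x => χ x * φ x) x e = χ x * fderiv ℝ φ x e + φ x * fderiv ℝ χ x e := by
  rw [fderiv_fun_mul (hχ.differentiable one_ne_zero x) (hφ.differentiable one_ne_zero x)]
  simp

theorem HasWeakGrad.integral_test_mul (hΩ : IsOpen Ω) {f χ φ : E n → ℝ} {G : E n → E n}
    (h : HasWeakGrad Ω f G) (hf : ContinuousOn f Ω) (hχ : IsTest Ω χ)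
    (hφ : ContDiff ℝ (⊤ : ℕ∞) φ) (i : Fin n) :
    ∫ x, χ x * f x * fderiv ℝ φ x (EuclideanSpace.single i 1)
      = -∫ x, (χ x • G x + f x • gradient χ x) i * φ x := by
  set e : E n := EuclideanSpace.single i 1
  have hφ1 : ContDiff ℝ 1 φ := hφ.of_le (by exact_mod_cast le_top)
  have hχφ := hχ.mul hφ
  have hχ' := hχ.fderiv_apply e
  have hproduct : ∀ x, fderiv ℝ (fun x => χ x * φ x) x e
      = χ x * fderiv ℝ φ x e + φ x * fderiv ℝ χ x e := fderiv_mul_apply hχ.contDiff_one hφ1 e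
  have hfχ : Continuous fun x => f x * χ x :=
    continuous_smul_of_tsupport_subset hΩ hχ.1.continuous hχ.2.2 hf
  have hfχ' : Continuous fun x => f x * fderiv ℝ χ x e :=
    continuous_smul_of_tsupport_subset hΩ hχ'.1.continuous hχ'.2.2 hf
  have hint₁ : Integrable fun x => f x * χ x * fderiv ℝ φ x e :=
    (hfχ.mul (continuous_fderiv_apply hφ1 e)).integrable_of_hasCompactSupport
      hχ.2.1.mul_left.mul_right
  have hint₂ : Integrable fun x => f x * fderiv ℝ χ x e * φ x :=
    (hfχ'.mul hφ1.continuous).integrable_of_hasCompactSupport hχ'.2.1.mul_left.mul_right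
  have hint₃ : Integrable fun x => χ x * φ x * G x i :=
    integrable_mul_of_locallyIntegrableOn hχφ.1.continuous hχφ.2.1 hχφ.2.2
      (locallyIntegrableOn_apply h.2.1 i)
  have htest := h.2.2 _ hχφ i
  rw [setIntegral_eq_integral_of_forall_compl_eq_zero (fun x hx => by
      rw [hproduct, hχ.eq_zero hx, hχ'.eq_zero hx]; ring),
    setIntegral_eq_integral_of_forall_compl_eq_zero (fun x hx => by
      rw [hχ.eq_zero hx]; ring)] at htest
  calc ∫ x, χ x * f x * fderiv ℝ φ x e
      = (∫ x, f x * fderiv ℝ (fun x => χ x * φ x) x e) - ∫ x, f x * fderiv ℝ χ x e * φ x := by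
        rw [eq_sub_iff_add_eq, ← integral_add (by simpa only [mul_comm] using hint₁) hint₂]
        refine integral_congr_ae (Eventually.of_forall fun x => ?_)
        simp only [hproduct]; ring
    _ = -((∫ x, χ x * φ x * G x i) + ∫ x, f x * fderiv ℝ χ x e * φ x) := by
        rw [htest, neg_add']
        simp only [mul_comm]
    _ = -∫ x, (χ x • G x + f x • gradient χ x) i * φ x := by
        rw [← integral_add hint₃ hint₂]
        congr 1
        refine integral_congr_ae (Eventually.of_forall fun x => ?_)
        simp only [PiLp.add_apply, PiLp.smul_apply, smul_eq_mul, gradient_apply, e]; ring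

/-- `f` is a continuous Sobolev function living on `K`: it vanishes outside `K`, and `G ∈ L^p` is
its weak gradient in the whole space, which also vanishes (everywhere) outside `K`. -/
structure IsSobolevOn (p : ℝ) (K : Set (E n)) (f : E n → ℝ) (G : E n → E n) : Prop where
  continuous : Continuous f
  eq_zero : ∀ x ∉ K, f x = 0
  grad_eq_zero : ∀ x ∉ K, G x = 0
  memLp : MemLp G (ENNReal.ofReal p) volume
  integral_mul_fderiv : ∀ φ : E n → ℝ, ContDiff ℝ (⊤ : ℕ∞) φ → HasCompactSupport φ →
    ∀ i : Fin n, ∫ x, f x * fderiv ℝ φ x (EuclideanSpace.single i 1) = -∫ x, G x i * φ x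

namespace IsSobolevOn

variable {f : E n → ℝ} {G : E n → E n}

theorem tsupport_subset (h : IsSobolevOn p K f G) (hK : IsCompact K) : tsupport f ⊆ K :=
  closure_minimal (fun x hx => by by_contra hxK; exact hx (h.eq_zero x hxK)) hK.isClosed

theorem hasCompactSupport (h : IsSobolevOn p K f G) (hK : IsCompact K) : HasCompactSupport f :=
  HasCompactSupport.intro hK h.eq_zero

theorem hasWeakGrad (h : IsSobolevOn p K f G) (hp : 1 < p) (hK : K ⊆ Ω) :
    HasWeakGrad Ω f G := by
  refine ⟨h.continuous.locallyIntegrable.locallyIntegrableOn _,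
    (h.memLp.locallyIntegrable (ENNReal.one_le_ofReal.2 hp.le)).locallyIntegrableOn _,
    fun φ hφ i => ?_⟩
  rw [setIntegral_eq_integral_of_forall_compl_eq_zero,
    setIntegral_eq_integral_of_forall_compl_eq_zero, h.integral_mul_fderiv φ hφ.1 hφ.2.1]
  · intro x hx
    rw [h.grad_eq_zero x fun hx' => hx (hK hx'), PiLp.zero_apply, zero_mul]
  · intro x hx
    rw [h.eq_zero x fun hx' => hx (hK hx'), zero_mul]

theorem memW1pCc (h : IsSobolevOn p K f G) (hp : 1 < p) (hKc : IsCompact K) (hK : K ⊆ Ω) :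
    MemW1pCc p Ω f :=
  ⟨⟨(h.continuous.memLp_of_hasCompactSupport (h.hasCompactSupport hKc)).restrict _, G,
      h.hasWeakGrad hp hK, h.memLp.restrict _⟩,
    h.continuous, h.hasCompactSupport hKc, (h.tsupport_subset hKc).trans hK⟩

theorem weakGrad_ae_eq (h : IsSobolevOn p K f G) (hp : 1 < p) (hΩ : IsOpen Ω) (hK : K ⊆ Ω) :
    weakGrad Ω f =ᵐ[volume.restrict Ω] G :=
  (h.hasWeakGrad hp hK).weakGrad_ae_eq hΩ

end IsSobolevOn

theorem isSobolevOn_of_contDiff {f : E n → ℝ} (hf : ContDiff ℝ 1 f) (hfs : HasCompactSupport f) :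
    IsSobolevOn p (tsupport f) f (gradient f) where
  continuous := hf.continuous
  eq_zero _ hx := image_eq_zero_of_notMem_tsupport hx
  grad_eq_zero _ hx := gradient_eq_zero_of_notMem_tsupport hx
  memLp := (continuous_gradient hf).memLp_of_hasCompactSupport
    (HasCompactSupport.intro hfs fun _ hx => gradient_eq_zero_of_notMem_tsupport hx)
  integral_mul_fderiv φ hφ hφs i := by
    simp only [gradient_apply]
    exact integral_mul_fderiv_of_contDiff hf (hφ.of_le (by exact_mod_cast le_top)) hφs _

theorem memLp_smul_of_continuous {q : ℝ≥0∞} {χ : E n → ℝ} {G : E n → E n} (hχ : Continuous χ)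
    (hχs : HasCompactSupport χ) (hG : MemLp G q (volume.restrict (tsupport χ))) :
    MemLp (fun x => χ x • G x) q := by
  obtain ⟨B, hB⟩ := hχs.exists_bound_of_continuous hχ
  have hrestrict : MemLp (fun x => χ x • G x) q (volume.restrict (tsupport χ)) := by
    refine hG.of_le_mul (c := B) (hχ.aestronglyMeasurable.smul hG.1)
      (Eventually.of_forall fun x => ?_)
    rw [norm_smul]
    exact mul_le_mul_of_nonneg_right (hB x) (norm_nonneg _)
  rw [← memLp_indicator_iff_restrict (isClosed_tsupport χ).measurableSet] at hrestrict
  rwa [indicator_eq_self.2 fun x hx => subset_tsupport χ (left_ne_zero_of_smul hx)] at hrestrict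

theorem isSobolevOn_test_mul (hΩ : IsOpen Ω) {f χ : E n → ℝ} {G : E n → E n}
    (h : HasWeakGrad Ω f G) (hf : ContinuousOn f Ω)
    (hG : ∀ K ⊆ Ω, IsCompact K → MemLp G (ENNReal.ofReal p) (volume.restrict K))
    (hχ : IsTest Ω χ) :
    IsSobolevOn p (tsupport χ) (fun x => χ x * f x)
      (fun x => χ x • G x + f x • gradient χ x) := by
  have hzero : ∀ x ∉ tsupport χ, gradient χ x = 0 := fun x hx =>
    gradient_eq_zero_of_notMem_tsupport hx
  have hfgrad : Continuous fun x => f x • gradient χ x :=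
    continuous_smul_of_tsupport_subset hΩ (continuous_gradient hχ.contDiff_one)
      ((closure_minimal (fun x hx => by by_contra hx'; exact hx (hzero x hx'))
        (isClosed_tsupport χ)).trans hχ.2.2) hf
  exact
    { continuous := by
        simpa only [smul_eq_mul, mul_comm] using
          continuous_smul_of_tsupport_subset hΩ hχ.1.continuous hχ.2.2 hf
      eq_zero := fun x hx => by rw [image_eq_zero_of_notMem_tsupport hx, zero_mul]
      grad_eq_zero := fun x hx => by
        rw [hzero x hx, image_eq_zero_of_notMem_tsupport hx, zero_smul, smul_zero, add_zero]
      memLp := (memLp_smul_of_continuous hχ.1.continuous hχ.2.1 (hG _ hχ.2.2 hχ.2.1)).add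
        (hfgrad.memLp_of_hasCompactSupport (HasCompactSupport.intro hχ.2.1
          fun x hx => by rw [hzero x hx, smul_zero]))
      integral_mul_fderiv := fun φ hφ _ i => h.integral_test_mul hΩ hf hχ hφ i }

theorem MemW1pCc.exists_isSobolevOn (hΩ : IsOpen Ω) {φ : E n → ℝ} (h : MemW1pCc p Ω φ) :
    ∃ (K : Set (E n)) (G : E n → E n), IsCompact K ∧ K ⊆ Ω ∧ IsSobolevOn p K φ G := by
  obtain ⟨⟨-, G, hG, hGp⟩, hc, hs, hsΩ⟩ := h
  obtain ⟨χ, hχ, -, hχ1⟩ := exists_isTest_one_nhds hΩ hs hsΩ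
  have hχφ : (fun x => χ x * φ x) = φ := by
    ext x
    by_cases hx : x ∈ tsupport φ
    · rw [hχ1.self_of_nhdsSet x hx, one_mul]
    · rw [image_eq_zero_of_notMem_tsupport hx, mul_zero]
  have hsob := isSobolevOn_test_mul hΩ (p := p) hG hc.continuousOn
    (fun K hK _ => hGp.mono_measure (Measure.restrict_mono hK le_rfl)) hχ
  rw [hχφ] at hsob
  exact ⟨_, _, hχ.2.1, hχ.2.2, hsob⟩

end WeakGrad

/-! ### Mollification -/

section LpSequences

variable {α F : Type*} [MeasurableSpace α] [NormedAddCommGroup F] {μ : Measure α} {p : ℝ}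

theorem eLpNorm_ofReal_rpow (hp : 0 < p) (f : α → F) :
    eLpNorm f (ENNReal.ofReal p) μ ^ p = ∫⁻ x, ‖f x‖ₑ ^ p ∂μ := by
  have hpow := eLpNorm_nnreal_pow_eq_lintegral (f := f) (μ := μ) (p := p.toNNReal)
    (Real.toNNReal_pos.2 hp).ne'
  rwa [Real.coe_toNNReal p hp.le] at hpow

theorem memLp_toReal_rpow_inv (hp : 0 < p) {D : α → ℝ≥0∞} (hD : AEMeasurable D μ)
    (hfin : ∫⁻ x, D x ∂μ ≠ ⊤) : MemLp (fun x => (D x ^ p⁻¹).toReal) (ENNReal.ofReal p) μ := by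
  refine ⟨(hD.pow_const _).ennreal_toReal.aestronglyMeasurable, ?_⟩
  rw [← ENNReal.rpow_lt_top_iff_of_pos hp, eLpNorm_ofReal_rpow hp]
  refine lt_of_le_of_lt (lintegral_mono fun x => ?_) hfin.lt_top
  rw [Real.enorm_of_nonneg ENNReal.toReal_nonneg]
  exact (ENNReal.rpow_le_rpow ENNReal.ofReal_toReal_le hp.le).trans_eq
    (ENNReal.rpow_inv_rpow hp.ne' _)

theorem norm_le_toReal_tsum_rpow (hp : 0 < p) {v : ℕ → F} (hv : ∑' k, ‖v k‖ₑ ^ p ≠ ⊤) (k : ℕ) :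
    ‖v k‖ ≤ ((∑' j, ‖v j‖ₑ ^ p) ^ p⁻¹).toReal := by
  have hle : ‖v k‖ₑ ≤ (∑' j, ‖v j‖ₑ ^ p) ^ p⁻¹ :=
    (ENNReal.le_rpow_inv_iff hp).2 (ENNReal.le_tsum k)
  simpa using ENNReal.toReal_mono (ENNReal.rpow_ne_top_of_nonneg (by positivity) hv) hle

theorem tendsto_zero_of_tsum_rpow_ne_top (hp : 0 < p) {v : ℕ → F}
    (hv : ∑' k, ‖v k‖ₑ ^ p ≠ ⊤) : Tendsto v atTop (𝓝 0) := by
  have hroot := ((ENNReal.continuous_rpow_const (y := p⁻¹)).tendsto 0).comp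
    (ENNReal.tendsto_atTop_zero_of_tsum_ne_top hv)
  rw [ENNReal.zero_rpow_of_pos (inv_pos.2 hp)] at hroot
  rw [tendsto_iff_edist_tendsto_0]
  refine hroot.congr fun k => ?_
  rw [Function.comp_apply, ENNReal.rpow_rpow_inv hp.ne', edist_zero_right]

theorem exists_subseq_tendsto_ae_dominated (hp : 0 < p) {h : ℕ → α → F} {G : α → F}
    (hh : ∀ k, AEStronglyMeasurable (h k) μ) (hG : MemLp G (ENNReal.ofReal p) μ)
    (hlim : Tendsto (fun k => eLpNorm (h k - G) (ENNReal.ofReal p) μ) atTop (𝓝 0)) :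
    ∃ (ns : ℕ → ℕ) (H : α → ℝ), StrictMono ns ∧ MemLp H (ENNReal.ofReal p) μ ∧
      ∀ᵐ x ∂μ, Tendsto (fun k => h (ns k) x) atTop (𝓝 (G x)) ∧ ∀ k, ‖h (ns k) x‖ ≤ H x := by
  have hlim' : Tendsto (fun k => ∫⁻ x, ‖h k x - G x‖ₑ ^ p ∂μ) atTop (𝓝 0) := by
    have hpow := ((ENNReal.continuous_rpow_const (y := p)).tendsto 0).comp hlim
    rw [ENNReal.zero_rpow_of_pos hp] at hpow
    exact hpow.congr fun k => eLpNorm_ofReal_rpow hp (h k - G)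
  obtain ⟨ns, hns, hle⟩ := Filter.extraction_forall_of_eventually
    (P := fun k m => ∫⁻ x, ‖h m x - G x‖ₑ ^ p ∂μ ≤ (2⁻¹ : ℝ≥0∞) ^ k) fun k =>
      ENNReal.tendsto_nhds_zero.1 hlim' _
        (ENNReal.pow_pos (ENNReal.inv_pos.2 ENNReal.ofNat_ne_top) k)
  have hmeas : ∀ k, AEMeasurable (fun x => ‖h (ns k) x - G x‖ₑ ^ p) μ := fun k =>
    ((hh (ns k)).sub hG.1).enorm.pow_const p
  set D : α → ℝ≥0∞ := fun x => ∑' k, ‖h (ns k) x - G x‖ₑ ^ p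
  have hD : AEMeasurable D μ := AEMeasurable.tsum hmeas
  have hfin : ∫⁻ x, D x ∂μ ≠ ⊤ := by
    rw [lintegral_tsum hmeas]
    refine ((ENNReal.tsum_le_tsum hle).trans_lt ?_).ne
    simp [ENNReal.tsum_geometric]
  refine ⟨ns, fun x => ‖G x‖ + (D x ^ p⁻¹).toReal, hns,
    hG.norm.add (memLp_toReal_rpow_inv hp hD hfin), ?_⟩
  filter_upwards [ae_lt_top' hD hfin] with x hx
  refine ⟨tendsto_sub_nhds_zero_iff.1 (tendsto_zero_of_tsum_rpow_ne_top hp hx.ne), fun k => ?_⟩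
  have hnorm := norm_le_toReal_tsum_rpow hp hx.ne k
  linarith [norm_le_norm_add_norm_sub' (h (ns k) x) (G x)]

end LpSequences

section Mollify

variable {n : ℕ} {p : ℝ} {F : Type*} [NormedAddCommGroup F] [NormedSpace ℝ F]

/-- The convolution of `g` with a normalized bump function. -/
def mollify (φ : ContDiffBump (0 : E n)) (g : E n → F) : E n → F :=
  convolution (φ.normed volume) g (ContinuousLinearMap.lsmul ℝ ℝ) volume

theorem mollify_apply (φ : ContDiffBump (0 : E n)) (g : E n → F) (x : E n) :
    mollify φ g x = ∫ t, φ.normed volume t • g (x - t) := by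
  simp [mollify, convolution_def]

theorem continuous_mollify (φ : ContDiffBump (0 : E n)) {g : E n → F}
    (hg : LocallyIntegrable g) : Continuous (mollify φ g) :=
  HasCompactSupport.continuous_convolution_left _ φ.hasCompactSupport_normed
    φ.continuous_normed hg

theorem integrable_normed_smul (φ : ContDiffBump (0 : E n)) {g : E n → F}
    (hg : LocallyIntegrable g) (x : E n) :
    Integrable (fun t => φ.normed volume t • g (x - t)) := by
  have hconv := HasCompactSupport.convolutionExists_left (ContinuousLinearMap.lsmul ℝ ℝ)
    (φ.hasCompactSupport_normed (μ := volume)) φ.continuous_normed hg x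
  simpa [ConvolutionExistsAt] using hconv

theorem mollify_add (φ : ContDiffBump (0 : E n)) {g h : E n → F} (hg : LocallyIntegrable g)
    (hh : LocallyIntegrable h) : mollify φ (g + h) = mollify φ g + mollify φ h := by
  ext1 x
  simp only [mollify_apply, Pi.add_apply, smul_add]
  exact integral_add (integrable_normed_smul φ hg x) (integrable_normed_smul φ hh x)

theorem support_mollify_subset (φ : ContDiffBump (0 : E n)) {g : E n → F} {K : Set (E n)}
    (hK : ∀ x ∉ K, g x = 0) {δ : ℝ} (hδ : φ.rOut ≤ δ) :
    Function.support (mollify φ g) ⊆ Metric.cthickening δ K := by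
  intro x hx
  obtain ⟨a, ha, b, hb, rfl⟩ := Set.mem_add.1 (support_convolution_subset _ hx)
  rw [φ.support_normed_eq, mem_ball_zero_iff] at ha
  have hbK : b ∈ K := by by_contra h; exact hb (hK b h)
  refine Metric.mem_cthickening_of_dist_le _ b _ _ hbK ?_
  simpa [dist_eq_norm] using ha.le.trans hδ

theorem lintegral_ofReal_normed (φ : ContDiffBump (0 : E n)) :
    ∫⁻ t, ENNReal.ofReal (φ.normed volume t) = 1 := by
  rw [← ofReal_integral_eq_lintegral_ofReal φ.integrable_normed
    (Eventually.of_forall φ.nonneg_normed), φ.integral_normed, ENNReal.ofReal_one]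

theorem enorm_mollify_rpow_le (hp : 1 ≤ p) (φ : ContDiffBump (0 : E n)) {G : E n → F}
    (hG : StronglyMeasurable G) (x : E n) :
    ‖mollify φ G x‖ₑ ^ p ≤ ∫⁻ t, ENNReal.ofReal (φ.normed volume t) * ‖G (x - t)‖ₑ ^ p := by
  have hp0 : 0 < p := one_pos.trans_le hp
  have hφ : Measurable fun t => ENNReal.ofReal (φ.normed volume t) :=
    (φ.continuous_normed (μ := volume)).measurable.ennreal_ofReal
  set ν : Measure (E n) := volume.withDensity fun t => ENNReal.ofReal (φ.normed volume t)
  have hν : IsProbabilityMeasure ν := ⟨by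
    rw [withDensity_apply _ MeasurableSet.univ, Measure.restrict_univ, lintegral_ofReal_normed]⟩
  have hGx : StronglyMeasurable fun t => G (x - t) :=
    hG.comp_measurable (measurable_const.sub measurable_id)
  have hnorm : ‖mollify φ G x‖ₑ ≤ ∫⁻ t, ‖G (x - t)‖ₑ ∂ν := by
    rw [mollify_apply, lintegral_withDensity_eq_lintegral_mul _ hφ hGx.enorm]
    refine (enorm_integral_le_lintegral_enorm _).trans_eq (lintegral_congr fun t => ?_)
    rw [enorm_smul, Pi.mul_apply, Real.enorm_of_nonneg (φ.nonneg_normed t)]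
  have hjensen := eLpNorm'_le_eLpNorm'_of_exponent_le one_pos hp ν hGx.aestronglyMeasurable
  simp only [eLpNorm'_eq_lintegral_enorm, ENNReal.rpow_one, one_div, inv_one] at hjensen
  calc ‖mollify φ G x‖ₑ ^ p ≤ ∫⁻ t, ‖G (x - t)‖ₑ ^ p ∂ν :=
        (ENNReal.le_rpow_inv_iff hp0).1 (hnorm.trans hjensen)
    _ = _ := lintegral_withDensity_eq_lintegral_mul _ hφ (hGx.enorm.pow_const p)

theorem eLpNorm_mollify_le (hp : 1 ≤ p) (φ : ContDiffBump (0 : E n)) {G : E n → F}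
    (hG : AEStronglyMeasurable G volume) :
    eLpNorm (mollify φ G) (ENNReal.ofReal p) volume ≤ eLpNorm G (ENNReal.ofReal p) volume := by
  wlog hGm : StronglyMeasurable G generalizing G
  · have hmk : mollify φ G = mollify φ (hG.mk G) :=
      convolution_congr _ (ae_eq_refl _) hG.ae_eq_mk
    rw [hmk, eLpNorm_congr_ae hG.ae_eq_mk]
    exact this hG.stronglyMeasurable_mk.aestronglyMeasurable hG.stronglyMeasurable_mk
  have hp0 : 0 < p := one_pos.trans_le hp
  have hφ : Measurable fun t => ENNReal.ofReal (φ.normed volume t) :=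
    (φ.continuous_normed (μ := volume)).measurable.ennreal_ofReal
  rw [← ENNReal.rpow_le_rpow_iff hp0, eLpNorm_ofReal_rpow hp0, eLpNorm_ofReal_rpow hp0]
  calc ∫⁻ x, ‖mollify φ G x‖ₑ ^ p
      ≤ ∫⁻ x, ∫⁻ t, ENNReal.ofReal (φ.normed volume t) * ‖G (x - t)‖ₑ ^ p :=
        lintegral_mono fun x => enorm_mollify_rpow_le hp φ hGm x
    _ = ∫⁻ t, ∫⁻ x, ENNReal.ofReal (φ.normed volume t) * ‖G (x - t)‖ₑ ^ p :=
        lintegral_lintegral_swap ((hφ.comp measurable_snd).mul ((hGm.comp_measurable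
          (measurable_fst.sub measurable_snd)).enorm.pow_const p)).aemeasurable
    _ = ∫⁻ t, ENNReal.ofReal (φ.normed volume t) * ∫⁻ x, ‖G x‖ₑ ^ p := by
        refine lintegral_congr fun t => ?_
        rw [lintegral_const_mul' _ _ ENNReal.ofReal_ne_top,
          lintegral_sub_right_eq_self fun x => ‖G x‖ₑ ^ p]
    _ = ∫⁻ x, ‖G x‖ₑ ^ p := by
        rw [lintegral_mul_const _ hφ, lintegral_ofReal_normed, one_mul]

theorem norm_mollify_sub_le [CompleteSpace F] {g : E n → F} (hg : Continuous g)
    (hgs : HasCompactSupport g) {ε : ℝ} (hε : 0 < ε) :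
    ∃ δ > 0, ∀ φ : ContDiffBump (0 : E n), φ.rOut ≤ δ → ∀ x, ‖mollify φ g x - g x‖ ≤ ε := by
  obtain ⟨δ, hδ, hunif⟩ :=
    Metric.uniformContinuous_iff.1 (hgs.uniformContinuous_of_continuous hg) ε hε
  refine ⟨δ, hδ, fun φ hφ x => ?_⟩
  rw [← dist_eq_norm]
  exact ContDiffBump.dist_normed_convolution_le hg.aestronglyMeasurable
    fun y hy => (hunif (lt_of_lt_of_le hy hφ)).le

theorem tendsto_eLpNorm_mollify_sub_of_continuous [CompleteSpace F] (hp : 0 ≤ p)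
    {φ : ℕ → ContDiffBump (0 : E n)} (hφ : Tendsto (fun k => (φ k).rOut) atTop (𝓝 0))
    {g : E n → F} (hg : Continuous g) (hgs : HasCompactSupport g) :
    Tendsto (fun k => eLpNorm (mollify (φ k) g - g) (ENNReal.ofReal p) volume) atTop (𝓝 0) := by
  set L := Metric.cthickening 1 (tsupport g)
  have hL : volume L ^ p⁻¹ ≠ ⊤ :=
    ENNReal.rpow_ne_top_of_nonneg (inv_nonneg.2 hp) (IsCompact.cthickening hgs).measure_lt_top.ne
  rw [ENNReal.tendsto_nhds_zero]
  intro ε hε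
  obtain ⟨η, hη, hηε⟩ := ENNReal.exists_nnreal_pos_mul_lt hL hε.ne'
  obtain ⟨δ, hδ, hunif⟩ := norm_mollify_sub_le hg hgs (NNReal.coe_pos.2 hη)
  filter_upwards [hφ.eventually (ge_mem_nhds hδ), hφ.eventually (ge_mem_nhds one_pos)]
    with k hkδ hk1
  have hsupp : Function.support (mollify (φ k) g - g) ⊆ L :=
    (Function.support_sub _ _).trans (union_subset
      (support_mollify_subset _ (fun x hx => image_eq_zero_of_notMem_tsupport hx) hk1)
      ((subset_tsupport g).trans (Metric.self_subset_cthickening _)))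
  rw [← eLpNorm_restrict_eq_of_support_subset hsupp]
  refine (eLpNorm_le_of_ae_bound (C := η) (Eventually.of_forall (hunif (φ k) hkδ))).trans ?_
  rw [Measure.restrict_apply_univ, ENNReal.toReal_ofReal hp, ENNReal.ofReal_coe_nnreal, mul_comm]
  exact hηε.le

theorem tendsto_eLpNorm_mollify_sub [CompleteSpace F] (hp : 1 ≤ p)
    {φ : ℕ → ContDiffBump (0 : E n)} (hφ : Tendsto (fun k => (φ k).rOut) atTop (𝓝 0))
    {G : E n → F} (hG : MemLp G (ENNReal.ofReal p) volume) :
    Tendsto (fun k => eLpNorm (mollify (φ k) G - G) (ENNReal.ofReal p) volume) atTop (𝓝 0) := by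
  have hp1 := ENNReal.one_le_ofReal.2 hp
  rw [ENNReal.tendsto_nhds_zero]
  intro ε hε
  have hε3 : ε / 3 ≠ 0 := (ENNReal.div_pos hε.ne' (by norm_num)).ne'
  obtain ⟨g, hgs, hGg, hgc, hg⟩ :=
    hG.exists_hasCompactSupport_eLpNorm_sub_le ENNReal.ofReal_ne_top hε3
  have hGgi : LocallyIntegrable (G - g) := (hG.sub hg).locallyIntegrable hp1
  filter_upwards [ENNReal.tendsto_nhds_zero.1 (tendsto_eLpNorm_mollify_sub_of_continuous
    (zero_le_one.trans hp) hφ hgc hgs) _ (pos_iff_ne_zero.2 hε3)] with k hk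
  have hsplit : mollify (φ k) G - G
      = mollify (φ k) (G - g) + (mollify (φ k) g - g) - (G - g) := by
    have hadd := mollify_add (φ k) hGgi hgc.locallyIntegrable
    rw [sub_add_cancel] at hadd
    rw [hadd]
    abel
  have hm₁ := (continuous_mollify (φ k) hGgi).aestronglyMeasurable (μ := volume)
  have hm₂ := ((continuous_mollify (φ k) hgc.locallyIntegrable).sub hgc).aestronglyMeasurable
    (μ := volume)
  rw [hsplit]
  refine (eLpNorm_sub_le (hm₁.add hm₂) (hG.sub hg).1 hp1).trans ?_
  refine (add_le_add_left (eLpNorm_add_le hm₁ hm₂ hp1) _).trans ?_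
  refine le_trans ?_ (ENNReal.add_thirds ε).le
  gcongr
  exact (eLpNorm_mollify_le hp (φ k) (hG.sub hg).1).trans hGg

theorem fderiv_comp_const_sub {f : E n → ℝ} (x t : E n) (hf : DifferentiableAt ℝ f (x - t)) :
    fderiv ℝ (fun t => f (x - t)) t = -fderiv ℝ f (x - t) := by
  have hsub : HasFDerivAt (fun t : E n => x - t) (-ContinuousLinearMap.id ℝ (E n)) t := by
    simpa using (hasFDerivAt_id t).const_sub x
  exact (hf.hasFDerivAt.comp t hsub).fderiv.trans (by ext; simp)

theorem fderiv_mollify_apply (φ : ContDiffBump (0 : E n)) {f : E n → ℝ}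
    (hf : LocallyIntegrable f) (x v : E n) :
    fderiv ℝ (mollify φ f) x v = ∫ t, f t * fderiv ℝ (φ.normed volume) (x - t) v := by
  have hφ : ContDiff ℝ 1 (φ.normed volume) := φ.contDiff_normed (n := 1)
  have hderiv := (φ.hasCompactSupport_normed (μ := volume)).hasFDerivAt_convolution_left
    (ContinuousLinearMap.lsmul ℝ ℝ) hφ hf x
  have hint := HasCompactSupport.convolutionExists_left
    ((ContinuousLinearMap.lsmul ℝ ℝ : ℝ →L[ℝ] ℝ →L[ℝ] ℝ).precompL (E n))
    ((φ.hasCompactSupport_normed (μ := volume)).fderiv (𝕜 := ℝ))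
    (hφ.continuous_fderiv one_ne_zero) hf x
  rw [mollify, hderiv.fderiv, convolution_def, ContinuousLinearMap.integral_apply hint]
  simp only [ContinuousLinearMap.precompL_apply, ContinuousLinearMap.lsmul_apply, smul_eq_mul]
  rw [← integral_sub_left_eq_self _ volume x]
  simp only [sub_sub_cancel, mul_comm]

theorem gradient_mollify {K : Set (E n)} {f : E n → ℝ} {G : E n → E n} (hp : 1 ≤ p)
    (h : IsSobolevOn p K f G) (φ : ContDiffBump (0 : E n)) :
    gradient (mollify φ f) = mollify φ G := by
  have hG := h.memLp.locallyIntegrable (ENNReal.one_le_ofReal.2 hp)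
  have hφ : Differentiable ℝ (φ.normed volume) :=
    (φ.contDiff_normed (n := 1)).differentiable one_ne_zero
  ext x i
  have hGi : mollify φ G x i = ∫ t, φ.normed volume t * G (x - t) i := by
    rw [mollify_apply]
    simpa using ((EuclideanSpace.proj i : E n →L[ℝ] ℝ).integral_comp_comm
      (integrable_normed_smul φ hG x)).symm
  have htest := h.integral_mul_fderiv (fun t => φ.normed volume (x - t))
    ((φ.contDiff_normed (n := ⊤)).comp (contDiff_const.sub contDiff_id))
    ((φ.hasCompactSupport_normed (μ := volume)).comp_homeomorph (Homeomorph.subLeft x)) i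
  simp only [fderiv_comp_const_sub x _ (hφ _), neg_apply, mul_neg,
    integral_neg, neg_inj] at htest
  rw [gradient_apply, fderiv_mollify_apply φ h.continuous.locallyIntegrable, htest, hGi,
    ← integral_sub_left_eq_self _ volume x]
  simp only [sub_sub_cancel, mul_comm]

theorem exists_contDiffBump_rOut_tendsto_zero (n : ℕ) {δ : ℝ} (hδ : 0 < δ) :
    ∃ φ : ℕ → ContDiffBump (0 : E n), (∀ k, (φ k).rOut ≤ δ) ∧
      Tendsto (fun k => (φ k).rOut) atTop (𝓝 0) := by
  have hpos : ∀ k : ℕ, 0 < δ / (k + 1) := fun k => by positivity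
  refine ⟨fun k => ⟨δ / (k + 1) / 2, δ / (k + 1), half_pos (hpos k), half_lt_self (hpos k)⟩,
    fun k => div_le_self hδ.le (le_add_of_nonneg_left k.cast_nonneg), ?_⟩
  simpa [div_eq_mul_inv] using
    (tendsto_one_div_add_atTop_nhds_zero_nat (𝕜 := ℝ)).const_mul δ

theorem IsSobolevOn.exists_approx {K Ω : Set (E n)} {f : E n → ℝ} {G : E n → E n} (hp : 1 ≤ p)
    (h : IsSobolevOn p K f G) (hK : IsCompact K) (hΩ : IsOpen Ω) (hKΩ : K ⊆ Ω) {ε : ℝ}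
    (hε : 0 < ε) :
    ∃ (L : Set (E n)) (F : ℕ → E n → ℝ) (H : E n → ℝ), IsCompact L ∧ L ⊆ Ω ∧ K ⊆ L ∧
      (∀ k, ContDiff ℝ (⊤ : ℕ∞) (F k)) ∧ (∀ k, tsupport (F k) ⊆ L) ∧
      (∀ k x, |F k x - f x| ≤ ε) ∧ (∀ x, Tendsto (fun k => F k x) atTop (𝓝 (f x))) ∧
      MemLp H (ENNReal.ofReal p) volume ∧
      ∀ᵐ x, Tendsto (fun k => gradient (F k) x) atTop (𝓝 (G x)) ∧
        ∀ k, ‖gradient (F k) x‖ ≤ H x := by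
  obtain ⟨δ, hδ, hδΩ⟩ := hK.exists_cthickening_subset_open hΩ hKΩ
  obtain ⟨δ', hδ', hunif⟩ := norm_mollify_sub_le h.continuous (h.hasCompactSupport hK) hε
  obtain ⟨φ, hφle, hφ⟩ := exists_contDiffBump_rOut_tendsto_zero n (lt_min hδ hδ')
  have hG := h.memLp.locallyIntegrable (ENNReal.one_le_ofReal.2 hp)
  obtain ⟨ns, H, hns, hH, hae⟩ := exists_subseq_tendsto_ae_dominated (one_pos.trans_le hp)
    (fun k => (continuous_mollify (φ k) hG).aestronglyMeasurable) h.memLp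
    (tendsto_eLpNorm_mollify_sub hp hφ h.memLp)
  refine ⟨Metric.cthickening δ K, fun k => mollify (φ (ns k)) f, H, hK.cthickening, hδΩ,
    Metric.self_subset_cthickening K, fun k => ?_, fun k => ?_, fun k x => ?_, fun x => ?_, hH, ?_⟩
  · exact HasCompactSupport.contDiff_convolution_left _ (φ (ns k)).hasCompactSupport_normed
      (φ (ns k)).contDiff_normed h.continuous.locallyIntegrable
  · exact closure_minimal (support_mollify_subset _ h.eq_zero
      ((hφle _).trans (min_le_left _ _))) Metric.isClosed_cthickening
  · exact hunif _ ((hφle _).trans (min_le_right _ _)) x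
  · exact (ContDiffBump.convolution_tendsto_right_of_continuous hφ h.continuous x).comp
      hns.tendsto_atTop
  · simpa only [gradient_mollify hp h] using hae

end Mollify

/-! ### The chain rule for a function of two Sobolev functions -/

section Chain

variable {n : ℕ} {p : ℝ}

/-- The weak gradient of `x ↦ Φ (v x, f x)`, where `v` and `f` have the weak gradients `Gv` and
`Gf`. -/
def chainGrad (Φ : ℝ × ℝ → ℝ) (v f : E n → ℝ) (Gv Gf : E n → E n) (x : E n) : E n :=
  fderiv ℝ Φ (v x, f x) (1, 0) • Gv x + fderiv ℝ Φ (v x, f x) (0, 1) • Gf x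

theorem chainGrad_apply (Φ : ℝ × ℝ → ℝ) (v f : E n → ℝ) (Gv Gf : E n → E n) (x : E n)
    (i : Fin n) : chainGrad Φ v f Gv Gf x i = fderiv ℝ Φ (v x, f x) (Gv x i, Gf x i) := by
  have hpair : (Gv x i, Gf x i) = Gv x i • ((1 : ℝ), (0 : ℝ)) + Gf x i • ((0 : ℝ), (1 : ℝ)) := by
    simp
  rw [hpair, map_add, map_smul, map_smul]
  simp [chainGrad, mul_comm]

theorem chainGrad_apply_mul (Φ : ℝ × ℝ → ℝ) (v f : E n → ℝ) (Gv Gf : E n → E n) (x : E n)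
    (i : Fin n) (t : ℝ) :
    chainGrad Φ v f Gv Gf x i * t = fderiv ℝ Φ (v x, f x) (Gv x i * t, Gf x i * t) := by
  rw [chainGrad_apply, mul_comm, ← smul_eq_mul, ← map_smul, Prod.smul_mk, smul_eq_mul,
    smul_eq_mul, mul_comm t, mul_comm t]

theorem gradient_comp_pair {Φ : ℝ × ℝ → ℝ} {v f : E n → ℝ} {x : E n}
    (hΦ : DifferentiableAt ℝ Φ (v x, f x)) (hv : DifferentiableAt ℝ v x)
    (hf : DifferentiableAt ℝ f x) :
    gradient (fun x => Φ (v x, f x)) x = chainGrad Φ v f (gradient v) (gradient f) x := by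
  ext i
  have hcomp := hΦ.hasFDerivAt.comp x (hv.hasFDerivAt.prodMk hf.hasFDerivAt)
  rw [chainGrad_apply, gradient_apply, gradient_apply, gradient_apply]
  exact DFunLike.congr_fun hcomp.fderiv (EuclideanSpace.single i 1)

theorem isCompact_range_union_zero {F : Type*} [TopologicalSpace F] [Zero F] {f : E n → F}
    (hf : Continuous f) (hs : HasCompactSupport f) : IsCompact (range f ∪ {0}) := by
  have himage : range f ∪ {0} = f '' tsupport f ∪ {0} := by
    refine Subset.antisymm (union_subset ?_ subset_union_right)
      (union_subset_union_left _ (image_subset_range _ _))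
    rintro _ ⟨x, rfl⟩
    by_cases hx : x ∈ tsupport f
    · exact Or.inl ⟨x, hx, rfl⟩
    · exact Or.inr (image_eq_zero_of_notMem_tsupport hx)
  rw [himage]
  exact (hs.image hf).union isCompact_singleton

theorem fderiv_apply_one_zero_eq_zero {U : Set (ℝ × ℝ)} (hU : IsOpen U) {Φ : ℝ × ℝ → ℝ} {t : ℝ}
    (hΦ : DifferentiableAt ℝ Φ (t, 0)) (hΦ0 : ∀ t, (t, 0) ∈ U → Φ (t, 0) = 0)
    (ht : (t, 0) ∈ U) : fderiv ℝ Φ (t, 0) (1, 0) = 0 := by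
  have hline : HasDerivAt (fun s : ℝ => (s, (0 : ℝ))) (1, 0) t :=
    (hasDerivAt_id t).prodMk (hasDerivAt_const t 0)
  have hzero : (Φ ∘ fun s : ℝ => (s, (0 : ℝ))) =ᶠ[𝓝 t] fun _ => 0 := by
    filter_upwards [hline.continuousAt.eventually_mem (hU.mem_nhds ht)] with s hs using hΦ0 s hs
  exact (hΦ.hasFDerivAt.comp_hasDerivAt t hline).unique
    ((hasDerivAt_const t (0 : ℝ)).congr_of_eventuallyEq hzero)

theorem chainGrad_eq_zero {U : Set (ℝ × ℝ)} (hU : IsOpen U) {Φ : ℝ × ℝ → ℝ}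
    (hΦ : ContDiffOn ℝ 1 Φ U) (hΦ0 : ∀ t, (t, 0) ∈ U → Φ (t, 0) = 0) {v f : E n → ℝ}
    {Gv Gf : E n → E n} {x : E n} (hx : (v x, f x) ∈ U) (hf : f x = 0) (hGf : Gf x = 0) :
    chainGrad Φ v f Gv Gf x = 0 := by
  rw [hf] at hx
  rw [chainGrad, hf, hGf, fderiv_apply_one_zero_eq_zero hU
    ((hΦ.differentiableOn one_ne_zero).differentiableAt (hU.mem_nhds hx)) hΦ0 hx, zero_smul,
    smul_zero, add_zero]

theorem tendsto_integral_clm_comp_apply {X F : Type*} [TopologicalSpace X] [NormedAddCommGroup F]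
    [NormedSpace ℝ F] {S : Set X} (hS : IsCompact S) {c : X → F →L[ℝ] ℝ} (hc : ContinuousOn c S)
    {q : ℕ → E n → X} {q₀ : E n → X} (hq : ∀ k, Continuous (q k)) (hqS : ∀ k x, q k x ∈ S)
    (hq₀S : ∀ x, q₀ x ∈ S) (hlim : ∀ x, Tendsto (fun k => q k x) atTop (𝓝 (q₀ x)))
    {g : ℕ → E n → F} {g₀ : E n → F} {H : E n → ℝ} (hg : ∀ k, AEStronglyMeasurable (g k))
    (hH : Integrable H)
    (hgH : ∀ᵐ x, Tendsto (fun k => g k x) atTop (𝓝 (g₀ x)) ∧ ∀ k, ‖g k x‖ ≤ H x) :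
    Tendsto (fun k => ∫ x, c (q k x) (g k x)) atTop (𝓝 (∫ x, c (q₀ x) (g₀ x))) := by
  obtain ⟨B, hB⟩ := hS.exists_bound_of_continuousOn hc
  refine tendsto_integral_of_dominated_convergence (fun x => B * H x) (fun k => ?_)
    (hH.const_mul B) (fun k => ?_) ?_
  · exact (ContinuousLinearMap.apply ℝ ℝ).aestronglyMeasurable_comp₂ (hg k)
      (hc.comp_continuous (hq k) (hqS k)).aestronglyMeasurable
  · filter_upwards [hgH] with x hx
    exact (c (q k x)).le_of_opNorm_le_of_le (hB _ (hqS k x)) (hx.2 k)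
  · filter_upwards [hgH] with x hx
    have hcx : Tendsto (fun k => c (q k x)) atTop (𝓝 (c (q₀ x))) :=
      (hc _ (hq₀S x)).tendsto.comp
        (tendsto_nhdsWithin_iff.2 ⟨hlim x, Eventually.of_forall fun k => hqS k x⟩)
    exact isBoundedBilinearMap_apply.continuous.continuousAt.tendsto.comp (hcx.prodMk_nhds hx.1)

theorem tendsto_apply_mul_and_norm_le {g : ℕ → E n} {g₀ : E n} {B : ℝ}
    (h : Tendsto g atTop (𝓝 g₀) ∧ ∀ k, ‖g k‖ ≤ B) (i : Fin n) (t : ℝ) :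
    Tendsto (fun k => g k i * t) atTop (𝓝 (g₀ i * t)) ∧ ∀ k, ‖g k i * t‖ ≤ |t| * B := by
  refine ⟨(((EuclideanSpace.proj i : E n →L[ℝ] ℝ).continuous.tendsto _).comp h.1).mul_const t,
    fun k => ?_⟩
  rw [norm_mul, mul_comm, Real.norm_eq_abs t]
  exact mul_le_mul_of_nonneg_left ((PiLp.norm_apply_le _ i).trans (h.2 k)) (abs_nonneg t)

theorem integral_comp_pair_mul_fderiv {Φ : ℝ × ℝ → ℝ} {v f θ : E n → ℝ} {U : Set (ℝ × ℝ)}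
    (hU : IsOpen U) (hΦ : ContDiffOn ℝ 1 Φ U) (hv : ContDiff ℝ 1 v) (hf : ContDiff ℝ 1 f)
    (hvf : ∀ x, (v x, f x) ∈ U) (hθ : ContDiff ℝ 1 θ) (hθs : HasCompactSupport θ) (i : Fin n) :
    ∫ x, Φ (v x, f x) * fderiv ℝ θ x (EuclideanSpace.single i 1)
      = -∫ x, chainGrad Φ v f (gradient v) (gradient f) x i * θ x := by
  have hcomp : ContDiff ℝ 1 fun x => Φ (v x, f x) := contDiff_iff_contDiffAt.2 fun x =>
    (hΦ.contDiffAt (hU.mem_nhds (hvf x))).comp x (hv.prodMk hf).contDiffAt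
  rw [integral_mul_fderiv_of_contDiff hcomp hθ hθs]
  congr 2 with x
  have hΦx : DifferentiableAt ℝ Φ (v x, f x) :=
    (hΦ.differentiableOn one_ne_zero).differentiableAt (hU.mem_nhds (hvf x))
  rw [← gradient_apply, gradient_comp_pair hΦx (hv.differentiable one_ne_zero x)
    (hf.differentiable one_ne_zero x)]

namespace IsSobolevOn

variable {K₁ K₂ : Set (E n)} {v f : E n → ℝ} {Gv Gf : E n → E n} {U : Set (ℝ × ℝ)} {Φ : ℝ × ℝ → ℝ}

theorem exists_isCompact_pair_mem (hK₁ : IsCompact K₁) (hK₂ : IsCompact K₂)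
    (hv : IsSobolevOn p K₁ v Gv) (hf : IsSobolevOn p K₂ f Gf) (hU : IsOpen U)
    (hvf : ∀ x, (v x, f x) ∈ U) (hU0 : (0, 0) ∈ U) :
    ∃ δ > 0, ∃ S ⊆ U, IsCompact S ∧ ∀ x y, dist y (v x, f x) ≤ δ → y ∈ S := by
  have hcs : HasCompactSupport fun x => (v x, f x) := by
    refine HasCompactSupport.intro (hK₁.union hK₂) fun x hx => ?_
    rw [mem_union, not_or] at hx
    rw [hv.eq_zero x hx.1, hf.eq_zero x hx.2]
    rfl
  have hR := isCompact_range_union_zero (hv.continuous.prodMk hf.continuous) hcs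
  obtain ⟨δ, hδ, hδU⟩ := hR.exists_cthickening_subset_open hU
    (union_subset (range_subset_iff.2 hvf) (singleton_subset_iff.2 hU0))
  exact ⟨δ, hδ, _, hδU, hR.cthickening, fun x y hy =>
    Metric.mem_cthickening_of_dist_le y _ δ _ (Or.inl ⟨x, rfl⟩) hy⟩

theorem memLp_chainGrad (hK₁ : IsCompact K₁) (hK₂ : IsCompact K₂)
    (hv : IsSobolevOn p K₁ v Gv) (hf : IsSobolevOn p K₂ f Gf) (hU : IsOpen U)
    (hΦ : ContDiffOn ℝ 1 Φ U) (hvf : ∀ x, (v x, f x) ∈ U) (hU0 : (0, 0) ∈ U) :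
    MemLp (chainGrad Φ v f Gv Gf) (ENNReal.ofReal p) volume := by
  obtain ⟨δ, hδ, S, hSU, hS, hmem⟩ := exists_isCompact_pair_mem hK₁ hK₂ hv hf hU hvf hU0
  have hderiv : ∀ w : ℝ × ℝ, ContinuousOn (fun q => fderiv ℝ Φ q w) U := fun w =>
    (hΦ.continuousOn_fderiv_of_isOpen hU le_rfl).clm_apply continuousOn_const
  have hsmul : ∀ (w : ℝ × ℝ) {G : E n → E n}, MemLp G (ENNReal.ofReal p) volume →
      MemLp (fun x => fderiv ℝ Φ (v x, f x) w • G x) (ENNReal.ofReal p) volume := by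
    intro w G hG
    obtain ⟨B, hB⟩ := hS.exists_bound_of_continuousOn ((hderiv w).mono hSU)
    refine hG.of_le_mul (c := B) (((hderiv w).comp_continuous
      (hv.continuous.prodMk hf.continuous) hvf).aestronglyMeasurable.smul hG.1)
      (Eventually.of_forall fun x => ?_)
    rw [norm_smul]
    exact mul_le_mul_of_nonneg_right (hB _ (hmem x _ (by simpa using hδ.le))) (norm_nonneg _)
  exact (hsmul _ hv.memLp).add (hsmul _ hf.memLp)

theorem integral_comp_pair_mul_fderiv (hp : 1 ≤ p) (hK₁ : IsCompact K₁) (hK₂ : IsCompact K₂)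
    (hv : IsSobolevOn p K₁ v Gv) (hf : IsSobolevOn p K₂ f Gf) (hU : IsOpen U)
    (hΦ : ContDiffOn ℝ 1 Φ U) (hvf : ∀ x, (v x, f x) ∈ U) (hU0 : (0, 0) ∈ U) {θ : E n → ℝ}
    (hθ : ContDiff ℝ 1 θ) (hθs : HasCompactSupport θ) (i : Fin n) :
    ∫ x, Φ (v x, f x) * fderiv ℝ θ x (EuclideanSpace.single i 1)
      = -∫ x, chainGrad Φ v f Gv Gf x i * θ x := by
  obtain ⟨δ, hδ, S, hSU, hS, hmem⟩ := exists_isCompact_pair_mem hK₁ hK₂ hv hf hU hvf hU0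
  obtain ⟨-, vk, H₁, -, -, -, hvk, -, hvδ, hvlim, hH₁, hvgrad⟩ :=
    hv.exists_approx hp hK₁ isOpen_univ (subset_univ _) hδ
  obtain ⟨-, fk, H₂, -, -, -, hfk, -, hfδ, hflim, hH₂, hfgrad⟩ :=
    hf.exists_approx hp hK₂ isOpen_univ (subset_univ _) hδ
  have hvk1 : ∀ k, ContDiff ℝ 1 (vk k) := fun k => (hvk k).of_le (by exact_mod_cast le_top)
  have hfk1 : ∀ k, ContDiff ℝ 1 (fk k) := fun k => (hfk k).of_le (by exact_mod_cast le_top)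
  have hq : ∀ k, Continuous fun x => (vk k x, fk k x) := fun k =>
    (hvk1 k).continuous.prodMk (hfk1 k).continuous
  have hqS : ∀ k x, (vk k x, fk k x) ∈ S := fun k x =>
    hmem x _ (max_le (hvδ k x) (hfδ k x))
  have hq₀S : ∀ x, (v x, f x) ∈ S := fun x => hmem x _ (by simpa using hδ.le)
  have hlim : ∀ x, Tendsto (fun k => (vk k x, fk k x)) atTop (𝓝 (v x, f x)) := fun x =>
    (hvlim x).prodMk_nhds (hflim x)
  have hθ' := continuous_fderiv_apply hθ (EuclideanSpace.single i 1)
  have hleft := tendsto_integral_clm_comp_apply hS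
    ((hΦ.continuousOn.mono hSU).smul (continuousOn_const (c := ContinuousLinearMap.id ℝ ℝ)))
    hq hqS hq₀S hlim (fun _ => hθ'.aestronglyMeasurable)
    (hθ'.norm.integrable_of_hasCompactSupport (hθs.fderiv_apply (𝕜 := ℝ) _).norm)
    (Eventually.of_forall fun _ => ⟨tendsto_const_nhds, fun _ => le_rfl⟩)
  have hdom : ∀ {H : E n → ℝ}, MemLp H (ENNReal.ofReal p) volume →
      Integrable fun x => |θ x| * H x := fun hH =>
    (hH.locallyIntegrable
      (ENNReal.one_le_ofReal.2 hp)).integrable_smul_left_of_hasCompactSupport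
      hθ.continuous.abs hθs.norm
  have hright := tendsto_integral_clm_comp_apply hS
    (g := fun k x => (gradient (vk k) x i * θ x, gradient (fk k) x i * θ x))
    (g₀ := fun x => (Gv x i * θ x, Gf x i * θ x))
    ((hΦ.continuousOn_fderiv_of_isOpen hU le_rfl).mono hSU) hq hqS hq₀S hlim (fun k => ?_)
    ((hdom hH₁).sup (hdom hH₂)) ?_
  · simp only [chainGrad_apply_mul]
    refine tendsto_nhds_unique hleft (hright.neg.congr fun k => ?_)
    simp only [← chainGrad_apply_mul]
    exact (FinslerHardy.integral_comp_pair_mul_fderiv hU hΦ (hvk1 k) (hfk1 k)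
      (fun x => hSU (hqS k x)) hθ hθs i).symm
  · have hgrad : ∀ {g : E n → ℝ}, ContDiff ℝ 1 g → Continuous fun x => gradient g x i * θ x :=
      fun hg => ((EuclideanSpace.proj i : E n →L[ℝ] ℝ).continuous.comp
        (continuous_gradient hg)).mul hθ.continuous
    exact ((hgrad (hvk1 k)).prodMk (hgrad (hfk1 k))).aestronglyMeasurable
  · filter_upwards [hvgrad, hfgrad] with x hvx hfx
    obtain ⟨hvt, hvB⟩ := tendsto_apply_mul_and_norm_le hvx i (θ x)
    obtain ⟨hft, hfB⟩ := tendsto_apply_mul_and_norm_le hfx i (θ x)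
    exact ⟨hvt.prodMk_nhds hft, fun k => max_le_max (hvB k) (hfB k)⟩

theorem comp_pair (hp : 1 ≤ p) (hK₁ : IsCompact K₁) (hK₂ : IsCompact K₂)
    (hv : IsSobolevOn p K₁ v Gv) (hf : IsSobolevOn p K₂ f Gf) (hU : IsOpen U)
    (hΦ : ContDiffOn ℝ 1 Φ U) (hvf : ∀ x, (v x, f x) ∈ U) (hU0 : (0, 0) ∈ U)
    (hΦ0 : ∀ t, (t, 0) ∈ U → Φ (t, 0) = 0) :
    IsSobolevOn p K₂ (fun x => Φ (v x, f x)) (chainGrad Φ v f Gv Gf) where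
  continuous := hΦ.continuousOn.comp_continuous (hv.continuous.prodMk hf.continuous) hvf
  eq_zero x hx := by
    have hx0 := hvf x
    rw [hf.eq_zero x hx] at hx0 ⊢
    exact hΦ0 _ hx0
  grad_eq_zero x hx := chainGrad_eq_zero hU hΦ hΦ0 (hvf x) (hf.eq_zero x hx) (hf.grad_eq_zero x hx)
  memLp := memLp_chainGrad hK₁ hK₂ hv hf hU hΦ hvf hU0
  integral_mul_fderiv _ hθ hθs i := integral_comp_pair_mul_fderiv hp hK₁ hK₂ hv hf hU hΦ hvf hU0
    (hθ.of_le (by exact_mod_cast le_top)) hθs i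

end IsSobolevOn

end Chain

/-! ### Families of norms -/

section FinslerNorm

variable {n : ℕ} {p s : ℝ} {Ω K : Set (E n)}

/-- The Lagrangian `F(x, ξ) = H(x, ξ)^p / p`. -/
def lagrangian (p : ℝ) (H : E n → E n → ℝ) (x ξ : E n) : ℝ := 1 / p * H x ξ ^ p

/-- The properties of the norms `H(x, ·)` on which the theory depends. They concern only the
density `H(x, ·)^p`, whose quasi-symmetry constant `C` is the one constant that enters the final
estimates. -/
structure IsFinslerNorm (p C : ℝ) (Ω : Set (E n)) (H : E n → E n → ℝ) : Prop where
  isBregmanQuasiSymm : ∀ᵐ x ∂(volume.restrict Ω), IsBregmanQuasiSymm C (lagrangian p H x)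
  isAbsHomogeneous : ∀ᵐ x ∂(volume.restrict Ω), IsAbsHomogeneous p (fun ξ => H x ξ ^ p)
  nonneg : ∀ᵐ x ∂(volume.restrict Ω), ∀ ξ : E n, 0 ≤ H x ξ ^ p
  aemeasurable : ∀ G : E n → E n, AEMeasurable G (volume.restrict Ω) →
    AEMeasurable (fun x => H x (G x) ^ p) (volume.restrict Ω)
  exists_le : ∀ K ⊆ Ω, IsCompact K → ∃ c : ℝ, 0 ≤ c ∧
    ∀ᵐ x ∂(volume.restrict K), ∀ ξ : E n, H x ξ ^ p ≤ c * ‖ξ‖ ^ p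

theorem exists_isSubdom_ball (hΩ : IsOpen Ω) {x : E n} (hx : x ∈ Ω) :
    ∃ r > 0, IsSubdom (Metric.ball x r) Ω := by
  obtain ⟨r, hr, h⟩ := Metric.nhds_basis_closedBall.mem_iff.1 (hΩ.mem_nhds hx)
  refine ⟨r, hr, ⟨Metric.isOpen_ball, ⟨x, Metric.mem_ball_self hr⟩,
    (convex_ball x r).isPreconnected⟩, ?_, Metric.closure_ball_subset_closedBall.trans h⟩
  exact (isCompact_closedBall x r).of_isClosed_subset isClosed_closure
    Metric.closure_ball_subset_closedBall

theorem ae_of_forall_isSubdom (hΩ : IsOpen Ω) {P : E n → Prop}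
    (h : ∀ ω, IsSubdom ω Ω → ∀ᵐ x ∂(volume.restrict ω), P x) :
    ∀ᵐ x ∂(volume.restrict Ω), P x := by
  rw [ae_restrict_iff' hΩ.measurableSet, ae_iff]
  refine measure_null_of_locally_null _ fun x hx => ?_
  obtain ⟨r, hr, hball⟩ := exists_isSubdom_ball hΩ (Classical.not_imp.1 hx).1
  have hnull := h _ hball
  rw [ae_restrict_iff' measurableSet_ball, ae_iff] at hnull
  refine ⟨_, inter_mem_nhdsWithin _ (Metric.ball_mem_nhds x hr), measure_mono_null ?_ hnull⟩
  exact fun y hy => Classical.not_imp.2 ⟨hy.2, (Classical.not_imp.1 hy.1).2⟩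

theorem MemMorreyLoc.locallyIntegrableOn {q : ℝ} (hΩ : IsOpen Ω) {V : E n → ℝ}
    (h : MemMorreyLoc p q Ω V) : LocallyIntegrableOn V Ω := fun x hx => by
  obtain ⟨r, hr, hball⟩ := exists_isSubdom_ball hΩ hx
  have hx' := Metric.mem_ball_self (x := x) hr
  have hV := (h _ hball).1 x hx'
  rw [Metric.isOpen_ball.nhdsWithin_eq hx'] at hV
  exact hV.filter_mono nhdsWithin_le_nhds

theorem exists_ae_le_of_isCompact (hΩ : IsOpen Ω) {f : E n → E n → ℝ}
    (h : ∀ ω, IsSubdom ω Ω → ∃ c : ℝ, ∀ᵐ x ∂(volume.restrict ω), ∀ ξ : E n, f x ξ ≤ c * ‖ξ‖ ^ p)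
    (hKΩ : K ⊆ Ω) (hK : IsCompact K) :
    ∃ c : ℝ, 0 ≤ c ∧ ∀ᵐ x ∂(volume.restrict K), ∀ ξ : E n, f x ξ ≤ c * ‖ξ‖ ^ p := by
  have hmono : ∀ {S : Set (E n)} {c c' : ℝ}, c ≤ c' →
      (∀ᵐ x ∂(volume.restrict S), ∀ ξ : E n, f x ξ ≤ c * ‖ξ‖ ^ p) →
      ∀ᵐ x ∂(volume.restrict S), ∀ ξ : E n, f x ξ ≤ c' * ‖ξ‖ ^ p := by
    intro S c c' hcc h
    filter_upwards [h] with x hx ξ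
    exact (hx ξ).trans (mul_le_mul_of_nonneg_right hcc (Real.rpow_nonneg (norm_nonneg _) _))
  refine hK.induction_on (p := fun S => ∃ c : ℝ, 0 ≤ c ∧
    ∀ᵐ x ∂(volume.restrict S), ∀ ξ : E n, f x ξ ≤ c * ‖ξ‖ ^ p) ⟨0, le_rfl, by simp⟩ ?_ ?_ ?_
  · rintro S T hST ⟨c, hc, h⟩
    exact ⟨c, hc, ae_restrict_of_ae_restrict_of_subset hST h⟩
  · rintro S T ⟨c, hc, h⟩ ⟨c', -, h'⟩
    refine ⟨max c c', hc.trans (le_max_left _ _), ?_⟩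
    rw [ae_restrict_union_iff]
    exact ⟨hmono (le_max_left _ _) h, hmono (le_max_right _ _) h'⟩
  · intro x hx
    obtain ⟨r, hr, hball⟩ := exists_isSubdom_ball hΩ (hKΩ hx)
    obtain ⟨c, hc⟩ := h _ hball
    exact ⟨_, mem_nhdsWithin_of_mem_nhds (Metric.ball_mem_nhds x hr), max c 0, le_max_right _ _,
      hmono (le_max_left _ _) hc⟩

theorem sNorm_le (hs : 0 < s) {a : Fin n → ℝ} {c : ℝ} (hc : 0 ≤ c)
    (ha : ∀ i, 0 ≤ a i ∧ a i ≤ c) (ξ : E n) : sNorm s a ξ ≤ (n * c) ^ (1 / s) * ‖ξ‖ := by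
  have hsum : ∑ i, a i * |ξ i| ^ s ≤ n * c * ‖ξ‖ ^ s := by
    calc ∑ i, a i * |ξ i| ^ s ≤ ∑ _i : Fin n, c * ‖ξ‖ ^ s := by
          refine Finset.sum_le_sum fun i _ =>
            mul_le_mul (ha i).2 ?_ (Real.rpow_nonneg (abs_nonneg _) _) hc
          exact Real.rpow_le_rpow (abs_nonneg _) (PiLp.norm_apply_le ξ i) hs.le
      _ = n * c * ‖ξ‖ ^ s := by simp [mul_assoc]
  calc sNorm s a ξ ≤ (n * c * ‖ξ‖ ^ s) ^ (1 / s) :=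
        Real.rpow_le_rpow (Finset.sum_nonneg fun i _ =>
          mul_nonneg (ha i).1 (Real.rpow_nonneg (abs_nonneg _) _)) hsum (by positivity)
    _ = (n * c) ^ (1 / s) * ‖ξ‖ := by
        rw [Real.mul_rpow (by positivity) (Real.rpow_nonneg (norm_nonneg _) _),
          ← Real.rpow_mul (norm_nonneg _), mul_one_div_cancel hs.ne', Real.rpow_one]

theorem IsWeight.ae_nonneg (hΩ : IsOpen Ω) {a : E n → Fin n → ℝ} (ha : IsWeight Ω a) :
    ∀ᵐ x ∂(volume.restrict Ω), ∀ i, 0 ≤ a x i :=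
  ae_of_forall_isSubdom hΩ fun ω hω => by
    obtain ⟨c, _, hc, -, hac⟩ := ha.2 ω hω
    filter_upwards [hac] with x hx i using hc.le.trans (hx i).1

theorem IsEllipticMatrix.ae_posSemidef (hΩ : IsOpen Ω) {A : E n → Matrix (Fin n) (Fin n) ℝ}
    (hA : IsEllipticMatrix Ω A) : ∀ᵐ x ∂(volume.restrict Ω), (A x).PosSemidef := by
  have hquad : ∀ᵐ x ∂(volume.restrict Ω), ∀ ξ : E n,
      0 ≤ ((A x).mulVec (fun i => ξ i)) ⬝ᵥ (fun i => ξ i) := by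
    refine ae_of_forall_isSubdom hΩ fun ω hω => ?_
    obtain ⟨θ, _, hθ, -, hAθ⟩ := hA.2.2 ω hω
    filter_upwards [hAθ] with x hx ξ
    rcases eq_or_ne ξ 0 with rfl | hξ
    · simp [dotProduct]
    · exact (Real.sqrt_pos.1 ((mul_pos hθ (norm_pos_iff.2 hξ)).trans_le (hx ξ).1)).le
  filter_upwards [hquad, hA.2.1] with x hx hsymm
  refine Matrix.PosSemidef.of_dotProduct_mulVec_nonneg ?_ fun v => ?_
  · rwa [Matrix.IsHermitian, Matrix.conjTranspose_eq_transpose_of_trivial]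
  · have hv := hx (WithLp.toLp 2 v)
    rw [dotProduct_comm] at hv
    simpa using hv

theorem aemeasurable_mixedNorm {a : E n → Fin n → ℝ} {A : E n → Matrix (Fin n) (Fin n) ℝ}
    (ha : IsWeight Ω a) (hA : IsEllipticMatrix Ω A) {G : E n → E n}
    (hG : AEMeasurable G (volume.restrict Ω)) :
    AEMeasurable (fun x => mixedNorm p s a A x (G x)) (volume.restrict Ω) := by
  have hGi : ∀ i, AEMeasurable (fun x => G x i) (volume.restrict Ω) := fun i =>
    (EuclideanSpace.proj i : E n →L[ℝ] ℝ).continuous.measurable.comp_aemeasurable hG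
  have hsNorm : AEMeasurable (fun x => sNorm s (a x) (G x)) (volume.restrict Ω) :=
    (Finset.aemeasurable_fun_sum _ fun i _ => (ha.1 i).mul
      ((continuous_abs.measurable.comp_aemeasurable (hGi i)).pow_const _)).pow_const _
  have hmatNorm : AEMeasurable (fun x => matNorm (A x) (G x)) (volume.restrict Ω) := by
    refine Real.continuous_sqrt.measurable.comp_aemeasurable ?_
    simp only [dotProduct, Matrix.mulVec]
    exact Finset.aemeasurable_fun_sum _ fun i _ => AEMeasurable.mul
      (Finset.aemeasurable_fun_sum _ fun j _ => (hA.1 i j).mul (hGi j)) (hGi i)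
  exact ((hsNorm.pow_const _).add (hmatNorm.pow_const _)).pow_const _

theorem exists_mixedNorm_rpow_le (hp : 0 < p) (hs : 0 < s) {a : E n → Fin n → ℝ}
    {A : E n → Matrix (Fin n) (Fin n) ℝ} (ha : IsWeight Ω a) (hA : IsEllipticMatrix Ω A)
    {ω : Set (E n)} (hω : IsSubdom ω Ω) :
    ∃ c : ℝ, ∀ᵐ x ∂(volume.restrict ω), ∀ ξ : E n, mixedNorm p s a A x ξ ^ p ≤ c * ‖ξ‖ ^ p := by
  obtain ⟨c, C, hc, hC, haω⟩ := ha.2 ω hω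
  obtain ⟨_, θ, -, hθ, hAω⟩ := hA.2.2 ω hω
  refine ⟨((n * C) ^ (1 / s)) ^ p + θ ^ p, ?_⟩
  filter_upwards [haω, hAω] with x hax hAx ξ
  have ha0 : ∀ i, 0 ≤ a x i := fun i => hc.le.trans (hax i).1
  rw [mixedNorm_rpow hp.ne' A ha0, add_mul, ← Real.mul_rpow (by positivity) (norm_nonneg _),
    ← Real.mul_rpow hθ.le (norm_nonneg _)]
  exact add_le_add
    (Real.rpow_le_rpow (sNorm_nonneg ha0 ξ)
      (sNorm_le hs hC.le (fun i => ⟨ha0 i, (hax i).2⟩) ξ) hp.le)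
    (Real.rpow_le_rpow (matNorm_nonneg _ ξ) (hAx ξ).2 hp.le)

theorem exists_isFinslerNorm_mixedNorm (hp : 1 < p) (hs : 1 < s) :
    ∃ C, ∀ (n : ℕ) (Ω : Set (E n)) (a : E n → Fin n → ℝ)
      (A : E n → Matrix (Fin n) (Fin n) ℝ), IsOpen Ω → IsWeight Ω a → IsEllipticMatrix Ω A →
        IsFinslerNorm p C Ω (mixedNorm p s a A) := by
  obtain ⟨C, hquasi⟩ := exists_isBregmanQuasiSymm_mixedNorm hp hs
  have hp0 : 0 < p := by linarith
  have hs0 : 0 < s := by linarith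
  refine ⟨C, fun n Ω a A hΩ ha hA => ⟨?_, ?_, ?_, fun G hG =>
    (aemeasurable_mixedNorm ha hA hG).pow_const p, fun K hKΩ hK =>
    exists_ae_le_of_isCompact hΩ (fun ω => exists_mixedNorm_rpow_le hp0 hs0 ha hA) hKΩ hK⟩⟩
  · filter_upwards [ha.ae_nonneg hΩ, hA.ae_posSemidef hΩ] with x hax hAx
      using hquasi n a A x hax hAx
  · filter_upwards [ha.ae_nonneg hΩ] with x hax
      using isAbsHomogeneous_mixedNorm_rpow hp0.ne' hs0.ne' A hax
  · filter_upwards [ha.ae_nonneg hΩ] with x hax ξ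
    rw [mixedNorm_rpow hp0.ne' A hax]
    exact add_nonneg (Real.rpow_nonneg (sNorm_nonneg hax ξ) p)
      (Real.rpow_nonneg (matNorm_nonneg _ ξ) p)

end FinslerNorm

/-! ### The equation -/

section Equation

variable {n : ℕ} {p C : ℝ} {Ω K L : Set (E n)} {H : E n → E n → ℝ}

theorem inner_flux (x ξ η : E n) :
    inner ℝ (flux p H x ξ) η = fderiv ℝ (lagrangian p H x) ξ η := inner_gradient_left

theorem rpow_eq_mul_lagrangian (hp : p ≠ 0) (x ξ : E n) : H x ξ ^ p = p * lagrangian p H x ξ := by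
  rw [lagrangian]
  field_simp

theorem IsFinslerNorm.aemeasurable_lagrangian (hH : IsFinslerNorm p C Ω H) {G : E n → E n}
    (hG : AEMeasurable G (volume.restrict Ω)) :
    AEMeasurable (fun x => lagrangian p H x (G x)) (volume.restrict Ω) :=
  (hH.aemeasurable G hG).const_mul _

theorem IsFinslerNorm.aemeasurable_fderiv (hH : IsFinslerNorm p C Ω H) {X Y : E n → E n}
    (hX : AEMeasurable X (volume.restrict Ω)) (hY : AEMeasurable Y (volume.restrict Ω)) :
    AEMeasurable (fun x => fderiv ℝ (lagrangian p H x) (X x) (Y x)) (volume.restrict Ω) := by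
  refine aemeasurable_of_tendsto_metrizable_ae atTop
    (f := fun (k : ℕ) x => ((k : ℝ) + 1) • (lagrangian p H x (X x + ((k : ℝ) + 1)⁻¹ • Y x)
      - lagrangian p H x (X x))) (fun k => ?_) ?_
  · exact ((hH.aemeasurable_lagrangian (hX.add (hY.const_smul ((k : ℝ) + 1)⁻¹))).sub
      (hH.aemeasurable_lagrangian hX)).const_smul ((k : ℝ) + 1)
  · filter_upwards [hH.isBregmanQuasiSymm] with x hx
    refine HasFDerivAt.lim (hx.differentiable (X x)).hasFDerivAt (Y x) ?_
    exact tendsto_norm_atTop_atTop.comp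
      (tendsto_atTop_add_const_right _ _ tendsto_natCast_atTop_atTop)

theorem IsFinslerNorm.exists_ae_abs_fderiv_le (hH : IsFinslerNorm p C Ω H) (hp : 0 < p)
    (hLΩ : L ⊆ Ω) (hL : IsCompact L) : ∃ c : ℝ, 0 ≤ c ∧ ∀ᵐ x ∂(volume.restrict L), ∀ X Y : E n,
      |fderiv ℝ (lagrangian p H x) X Y| ≤ c * (‖X‖ + ‖Y‖) ^ p := by
  obtain ⟨c, hc, hle⟩ := hH.exists_le L hLΩ hL
  refine ⟨1 / p * c, by positivity, ?_⟩
  filter_upwards [hle, ae_restrict_of_ae_restrict_of_subset hLΩ hH.isBregmanQuasiSymm,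
    ae_restrict_of_ae_restrict_of_subset hLΩ hH.nonneg] with x hcx hquasi hnonneg X Y
  have hupper : ∀ Z, fderiv ℝ (lagrangian p H x) X Z ≤ 1 / p * c * (‖X‖ + ‖Z‖) ^ p := fun Z => by
    have hbregman := hquasi.nonneg X (X + Z)
    rw [bregman, add_sub_cancel_left] at hbregman
    have hX : 0 ≤ lagrangian p H x X := mul_nonneg (by positivity) (hnonneg X)
    calc fderiv ℝ (lagrangian p H x) X Z ≤ lagrangian p H x (X + Z) := by linarith
      _ ≤ 1 / p * (c * ‖X + Z‖ ^ p) := mul_le_mul_of_nonneg_left (hcx _) (by positivity)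
      _ ≤ 1 / p * c * (‖X‖ + ‖Z‖) ^ p := by
        rw [mul_assoc]
        gcongr
        exact norm_add_le X Z
  refine abs_le.2 ⟨?_, hupper Y⟩
  have hneg := hupper (-Y)
  rw [map_neg, norm_neg] at hneg
  linarith

theorem integrable_norm_rpow_of_memLp {F : Type*} [NormedAddCommGroup F] {μ : Measure (E n)}
    {f : E n → F} (hp : 0 < p) (hf : MemLp f (ENNReal.ofReal p) μ) :
    Integrable (fun x => ‖f x‖ ^ p) μ := by
  simpa only [ENNReal.toReal_ofReal hp.le] using
    hf.integrable_norm_rpow (by simpa using hp) ENNReal.ofReal_ne_top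

theorem IsFinslerNorm.exists_integrable_bound (hH : IsFinslerNorm p C Ω H) (hp : 0 < p)
    (hLΩ : L ⊆ Ω) (hL : IsCompact L) {X : E n → E n} {D : E n → ℝ}
    (hX : MemLp X (ENNReal.ofReal p) (volume.restrict L))
    (hD : MemLp D (ENNReal.ofReal p) (volume.restrict L)) :
    ∃ B : E n → ℝ, Integrable B ∧ ∀ᵐ x, ∀ Y : E n, ‖Y‖ ≤ D x → (x ∉ L → Y = 0) →
      ‖fderiv ℝ (lagrangian p H x) (X x) Y‖ ≤ B x := by
  obtain ⟨c, hc, hle⟩ := hH.exists_ae_abs_fderiv_le hp hLΩ hL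
  refine ⟨L.indicator fun x => c * ‖‖X x‖ + ‖D x‖‖ ^ p, ?_, ?_⟩
  · rw [integrable_indicator_iff hL.measurableSet]
    exact (integrable_norm_rpow_of_memLp hp (hX.norm.add hD.norm)).const_mul c
  · rw [ae_restrict_iff' hL.measurableSet] at hle
    filter_upwards [hle] with x hx Y hYD hY0
    by_cases hxL : x ∈ L
    · rw [indicator_of_mem hxL]
      refine (hx hxL _ Y).trans ?_
      gcongr
      exact (add_le_add_right (hYD.trans (Real.le_norm_self _)) _).trans (Real.le_norm_self _)
    · rw [indicator_of_notMem hxL, hY0 hxL, map_zero, norm_zero]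

theorem MemW1pLoc.hasWeakGrad_weakGrad {u : E n → ℝ} (hu : MemW1pLoc p Ω u) :
    HasWeakGrad Ω u (weakGrad Ω u) := by
  have hex : ∃ G, HasWeakGrad Ω u G := hu.2.imp fun _ hG => hG.1
  rw [weakGrad, dif_pos hex]
  exact hex.choose_spec

theorem MemW1pLoc.memLp_weakGrad {u : E n → ℝ} (hΩ : IsOpen Ω) (hu : MemW1pLoc p Ω u)
    (hKΩ : K ⊆ Ω) (hK : IsCompact K) :
    MemLp (weakGrad Ω u) (ENNReal.ofReal p) (volume.restrict K) := by
  obtain ⟨-, G, hG, hGp⟩ := hu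
  exact (memLp_congr_ae (ae_restrict_of_ae_restrict_of_subset hKΩ (hG.weakGrad_ae_eq hΩ))).2
    (hGp K hKΩ hK)

/-- Test functions `F k` supported in one set `L` that converge to `f` boundedly and pointwise,
and whose gradients converge to `G` almost everywhere, dominated by `D ∈ L^p`. -/
structure IsTestApprox (p : ℝ) (Ω L : Set (E n)) (f : E n → ℝ) (G : E n → E n)
    (F : ℕ → E n → ℝ) (D : E n → ℝ) : Prop where
  isTest : ∀ k, IsTest Ω (F k)
  tsupport_subset : ∀ k, tsupport (F k) ⊆ L
  exists_abs_le : ∃ B, ∀ k x, |F k x| ≤ B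
  tendsto : ∀ x, Tendsto (fun k => F k x) atTop (𝓝 (f x))
  memLp : MemLp D (ENNReal.ofReal p) volume
  ae_tendsto : ∀ᵐ x, Tendsto (fun k => gradient (F k) x) atTop (𝓝 (G x))
  ae_norm_le : ∀ᵐ x, ∀ k, ‖gradient (F k) x‖ ≤ D x

theorem IsSobolevOn.exists_isTestApprox {f : E n → ℝ} {G : E n → E n} (hp : 1 ≤ p)
    (h : IsSobolevOn p K f G) (hΩ : IsOpen Ω) (hK : IsCompact K) (hKΩ : K ⊆ Ω) :
    ∃ (L : Set (E n)) (F : ℕ → E n → ℝ) (D : E n → ℝ), IsCompact L ∧ L ⊆ Ω ∧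
      IsTestApprox p Ω L f G F D := by
  obtain ⟨L, F, D, hL, hLΩ, -, hsmooth, hsupp, hdist, hlim, hD, hae⟩ :=
    h.exists_approx hp hK hΩ hKΩ one_pos
  obtain ⟨B, hB⟩ := h.continuous.bounded_above_of_compact_support (h.hasCompactSupport hK)
  refine ⟨L, F, D, hL, hLΩ, fun k => ⟨hsmooth k, hL.of_isClosed_subset (isClosed_tsupport _)
    (hsupp k), (hsupp k).trans hLΩ⟩, hsupp, ⟨1 + B, fun k x => ?_⟩, hlim, hD,
    hae.mono fun x hx => hx.1, hae.mono fun x hx => hx.2⟩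
  calc |F k x| = |(F k x - f x) + f x| := by rw [sub_add_cancel]
    _ ≤ 1 + B := (abs_add_le _ _).trans (add_le_add (hdist k x) (hB x))

namespace IsTestApprox

variable {f : E n → ℝ} {G : E n → E n} {F : ℕ → E n → ℝ} {D : E n → ℝ}

theorem gradient_eq_zero (h : IsTestApprox p Ω L f G F D) (k : ℕ) {x : E n} (hx : x ∉ L) :
    gradient (F k) x = 0 :=
  gradient_eq_zero_of_notMem_tsupport fun hx' => hx (h.tsupport_subset k hx')

theorem aemeasurable_gradient (h : IsTestApprox p Ω L f G F D) (k : ℕ) :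
    AEMeasurable (gradient (F k)) (volume.restrict Ω) :=
  (continuous_gradient (h.isTest k).contDiff_one).measurable.aemeasurable

theorem tendsto_integral_mul_comp (h : IsTestApprox p Ω L f G F D) (hL : IsCompact L)
    (hLΩ : L ⊆ Ω) {W : E n → ℝ} (hW : LocallyIntegrableOn W Ω) {θ : ℝ → ℝ} (hθ : Continuous θ)
    (hθ0 : θ 0 = 0) :
    Tendsto (fun k => ∫ x in Ω, W x * θ (F k x)) atTop (𝓝 (∫ x in Ω, W x * θ (f x))) := by
  obtain ⟨B, hB⟩ := h.exists_abs_le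
  obtain ⟨M, hM⟩ := (isCompact_Icc (a := -B) (b := B)).exists_bound_of_continuousOn hθ.continuousOn
  refine tendsto_integral_of_dominated_convergence (L.indicator fun x => ‖W x‖ * M)
    (fun k => ?_) ?_ (fun k => Eventually.of_forall fun x => ?_)
    (Eventually.of_forall fun x => ((hθ.tendsto _).comp (h.tendsto x)).const_mul _)
  · exact hW.aestronglyMeasurable.mul
      (hθ.comp (h.isTest k).1.continuous).aestronglyMeasurable
  · refine Integrable.integrableOn ((integrable_indicator_iff hL.measurableSet).2 ?_)
    exact (hW.integrableOn_compact_subset hLΩ hL).norm.mul_const M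
  · by_cases hxL : x ∈ L
    · rw [indicator_of_mem hxL, norm_mul]
      exact mul_le_mul_of_nonneg_left (hM _ (abs_le.1 (hB k x))) (norm_nonneg _)
    · rw [indicator_of_notMem hxL,
        image_eq_zero_of_notMem_tsupport fun hx' => hxL (h.tsupport_subset k hx'), hθ0, mul_zero,
        norm_zero]

theorem tendsto_integral_fderiv (h : IsTestApprox p Ω L f G F D) (hH : IsFinslerNorm p C Ω H)
    (hp : 0 < p) (hL : IsCompact L) (hLΩ : L ⊆ Ω) {X : E n → E n}
    (hXm : AEMeasurable X (volume.restrict Ω))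
    (hX : MemLp X (ENNReal.ofReal p) (volume.restrict L)) :
    Tendsto (fun k => ∫ x in Ω, fderiv ℝ (lagrangian p H x) (X x) (gradient (F k) x)) atTop
      (𝓝 (∫ x in Ω, fderiv ℝ (lagrangian p H x) (X x) (G x))) := by
  obtain ⟨B, hBi, hB⟩ := hH.exists_integrable_bound hp hLΩ hL hX (h.memLp.restrict L)
  refine tendsto_integral_of_dominated_convergence B (fun k => ?_) hBi.integrableOn
    (fun k => ae_restrict_of_ae ?_) (ae_restrict_of_ae ?_)
  · exact (hH.aemeasurable_fderiv hXm (h.aemeasurable_gradient k)).aestronglyMeasurable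
  · filter_upwards [hB, h.ae_norm_le] with x hBx hDx
      using hBx _ (hDx k) fun hx => h.gradient_eq_zero k hx
  · filter_upwards [h.ae_tendsto] with x hx using
      ((fderiv ℝ (lagrangian p H x) (X x)).continuous.tendsto _).comp hx

end IsTestApprox

theorem IsFinslerNorm.integrableOn_fderiv (hH : IsFinslerNorm p C Ω H) (hp : 0 < p)
    (hK : IsCompact K) (hKΩ : K ⊆ Ω) {X G : E n → E n} {w : E n → ℝ}
    (hXm : AEMeasurable X (volume.restrict Ω))
    (hX : MemLp X (ENNReal.ofReal p) (volume.restrict K)) (hw : IsSobolevOn p K w G) :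
    IntegrableOn (fun x => fderiv ℝ (lagrangian p H x) (X x) (G x)) Ω := by
  obtain ⟨B, hBi, hB⟩ := hH.exists_integrable_bound hp hKΩ hK hX (hw.memLp.norm.restrict K)
  refine hBi.integrableOn.mono'
    (hH.aemeasurable_fderiv hXm hw.memLp.1.aemeasurable.restrict).aestronglyMeasurable
    (ae_restrict_of_ae ?_)
  filter_upwards [hB] with x hx using hx _ le_rfl (hw.grad_eq_zero x)

/-- The standing assumptions: `u` is a continuous positive solution of `Q'[u] = 0` in the open
set `Ω`. -/
structure IsPositiveSolution (p C : ℝ) (Ω : Set (E n)) (H : E n → E n → ℝ) (V u : E n → ℝ) :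
    Prop where
  one_lt : 1 < p
  isOpen : IsOpen Ω
  isFinslerNorm : IsFinslerNorm p C Ω H
  locallyIntegrableOn : LocallyIntegrableOn V Ω
  continuousOn : ContinuousOn u Ω
  pos : ∀ x ∈ Ω, 0 < u x
  isSolution : IsSolution p Ω H V u

namespace IsPositiveSolution

variable {V u : E n → ℝ}

theorem exponent_pos (hu : IsPositiveSolution p C Ω H V u) : 0 < p := one_pos.trans hu.one_lt

theorem aemeasurable_weakGrad (hu : IsPositiveSolution p C Ω H V u) :
    AEMeasurable (weakGrad Ω u) (volume.restrict Ω) :=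
  hu.isSolution.1.hasWeakGrad_weakGrad.2.1.aestronglyMeasurable.aemeasurable

theorem integrableOn_fderiv (hu : IsPositiveSolution p C Ω H V u) (hK : IsCompact K)
    (hKΩ : K ⊆ Ω) {w : E n → ℝ} {G : E n → E n} (hw : IsSobolevOn p K w G) :
    IntegrableOn (fun x => fderiv ℝ (lagrangian p H x) (weakGrad Ω u x) (G x)) Ω :=
  hu.isFinslerNorm.integrableOn_fderiv hu.exponent_pos hK hKΩ hu.aemeasurable_weakGrad
    (hu.isSolution.1.memLp_weakGrad hu.isOpen hKΩ hK) hw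

theorem integral_fderiv_add_integral_eq_zero (hu : IsPositiveSolution p C Ω H V u)
    (hK : IsCompact K) (hKΩ : K ⊆ Ω) {w : E n → ℝ} {G : E n → E n} (hw : IsSobolevOn p K w G) :
    (∫ x in Ω, fderiv ℝ (lagrangian p H x) (weakGrad Ω u x) (G x)) +
      ∫ x in Ω, V x * |u x| ^ (p - 2) * u x * w x = 0 := by
  obtain ⟨L, F, D, hL, hLΩ, hF⟩ :=
    hw.exists_isTestApprox hu.one_lt.le hu.isOpen hK hKΩ
  have hgrad := hF.tendsto_integral_fderiv hu.isFinslerNorm hu.exponent_pos hL hLΩ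
    hu.aemeasurable_weakGrad (hu.isSolution.1.memLp_weakGrad hu.isOpen hLΩ hL)
  have hVu : LocallyIntegrableOn (fun x => V x * |u x| ^ (p - 2) * u x) Ω :=
    (hu.locallyIntegrableOn.mul_continuousOn
      (hu.continuousOn.abs.rpow_const fun x hx => Or.inl (abs_pos.2 (hu.pos x hx).ne').ne')
      hu.isOpen.isLocallyClosed).mul_continuousOn hu.continuousOn hu.isOpen.isLocallyClosed
  have hpot := hF.tendsto_integral_mul_comp hL hLΩ hVu continuous_id rfl
  have htest := fun k => hu.isSolution.2 (F k) (hF.isTest k)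
  simp only [inner_flux] at htest
  exact tendsto_nhds_unique ((hgrad.add hpot).congr htest) tendsto_const_nhds

end IsPositiveSolution

end Equation

/-! ### Picone's identity and the energy -/

section Composition

variable {n : ℕ} {p : ℝ} {Ω K : Set (E n)}

theorem neg_one_lt_mul_sub_one {a b : ℝ} (ha : 0 ≤ a) (ha1 : a ≤ 1) (hb : 0 < b) :
    -1 < a * (b - 1) := by
  rcases ha.eq_or_lt with rfl | ha
  · norm_num
  · nlinarith [mul_pos ha hb]

theorem IsSobolevOn.comp_pos (hp : 1 ≤ p) (hΩ : IsOpen Ω) {u f : E n → ℝ} {G : E n → E n}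
    (huc : ContinuousOn u Ω) (hpos : ∀ x ∈ Ω, 0 < u x) (hu : MemW1pLoc p Ω u)
    (hK : IsCompact K) (hKΩ : K ⊆ Ω) (hf : IsSobolevOn p K f G) {Ψ : ℝ × ℝ → ℝ}
    (hΨ : ContDiffOn ℝ 1 Ψ {q | 0 < q.1}) (hΨ0 : ∀ t, Ψ (t, 0) = 0) :
    ∃ G', IsSobolevOn p K (fun x => Ψ (u x, f x)) G' ∧
      EqOn G' (chainGrad Ψ u f (weakGrad Ω u) G) Ω := by
  obtain ⟨χ, hχ, hχ01, hχ1⟩ := exists_isTest_one_nhds hΩ hK hKΩ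
  have hχK : ∀ x ∈ K, χ x = 1 := hχ1.self_of_nhdsSet
  have hgradχK : ∀ x ∈ K, gradient χ x = 0 := fun x hx =>
    (Filter.EventuallyEq.gradient_eq (hχ1.filter_mono (nhds_le_nhdsSet hx))).trans
      (gradient_fun_const x 1)
  -- `u` is replaced by the compactly supported `χ (u - 1)`, which is `u - 1` on `K` and `> -1`.
  have hv : IsSobolevOn p (tsupport χ) (fun x => χ x * (u x - 1))
      (fun x => χ x • weakGrad Ω u x + (u x - 1) • gradient χ x) :=
    isSobolevOn_test_mul hΩ (hu.hasWeakGrad_weakGrad.sub_const 1) (huc.sub continuousOn_const)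
      (fun L hLΩ hL => hu.memLp_weakGrad hΩ hLΩ hL) hχ
  have hvU : ∀ x, -1 < χ x * (u x - 1) := fun x => by
    by_cases hx : x ∈ Ω
    · exact neg_one_lt_mul_sub_one (hχ01 x).1 (hχ01 x).2 (hpos x hx)
    · rw [hχ.eq_zero hx, zero_mul]
      norm_num
  have hΦ : ContDiffOn ℝ 1 (fun q => Ψ ((1, 0) + q)) {q : ℝ × ℝ | -1 < q.1} :=
    hΨ.comp (contDiff_const.add contDiff_id).contDiffOn fun q (hq : -1 < q.1) =>
      show (0 : ℝ) < 1 + q.1 by linarith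
  have hcomp := hv.comp_pair hp hχ.2.1 hK hf (isOpen_lt continuous_const continuous_fst) hΦ hvU
    (by simp) (fun t _ => by simpa using hΨ0 (1 + t))
  have hfun : (fun x => Ψ ((1, 0) + (χ x * (u x - 1), f x))) = fun x => Ψ (u x, f x) := by
    ext x
    by_cases hx : x ∈ K
    · simp [hχK x hx]
    · simp [hf.eq_zero x hx, hΨ0]
  refine ⟨_, hfun ▸ hcomp, fun x hx => ?_⟩
  by_cases hxK : x ∈ K
  · simp [chainGrad, fderiv_comp_add_left, hχK x hxK, hgradχK x hxK]
  · rw [hcomp.grad_eq_zero x hxK, chainGrad_eq_zero (isOpen_lt continuous_const continuous_fst) hΨ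
      (fun t _ => hΨ0 t) (hpos x hx) (hf.eq_zero x hxK) (hf.grad_eq_zero x hxK)]

end Composition

section Picone

variable {n : ℕ} {p C : ℝ} {Ω : Set (E n)} {H : E n → E n → ℝ}

/-- The test function `|φ|^p u^{1-p}` of Picone's identity, as a function of the values
`(u, φ)`. -/
def piconeFun (p : ℝ) (q : ℝ × ℝ) : ℝ := |q.2| ^ p * q.1 ^ (1 - p)

theorem contDiffOn_piconeFun (hp : 1 < p) : ContDiffOn ℝ 1 (piconeFun p) {q | 0 < q.1} := by
  intro q hq
  have habs : ContDiff ℝ 1 fun t : ℝ => |t| ^ p := contDiff_norm_rpow hp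
  exact ((habs.comp contDiff_snd).contDiffAt.mul ((Real.contDiffAt_rpow_const_of_ne
    (ne_of_gt hq)).comp q contDiff_fst.contDiffAt)).contDiffWithinAt

theorem fderiv_piconeFun (hp : 1 < p) {a : ℝ} (ha : 0 < a) (b s t : ℝ) :
    fderiv ℝ (piconeFun p) (a, b) (s, t)
      = |b / a| ^ p * (1 - p) * s + p * (|b / a| ^ (p - 2) * (b / a)) * t := by
  have hsnd : HasFDerivAt (fun q : ℝ × ℝ => |q.2| ^ p)
      ((p * |b| ^ (p - 2) * b) • ContinuousLinearMap.snd ℝ ℝ ℝ) (a, b) :=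
    HasDerivAt.comp_hasFDerivAt (h₂ := fun t : ℝ => |t| ^ p) (f := Prod.snd) (a, b)
      (hasDerivAt_abs_rpow b hp) hasFDerivAt_snd
  have hfst : HasFDerivAt (fun q : ℝ × ℝ => q.1 ^ (1 - p))
      (((1 - p) * a ^ (1 - p - 1)) • ContinuousLinearMap.fst ℝ ℝ ℝ) (a, b) :=
    HasDerivAt.comp_hasFDerivAt (h₂ := fun t : ℝ => t ^ (1 - p)) (f := Prod.fst) (a, b)
      (Real.hasDerivAt_rpow_const (Or.inl ha.ne')) hasFDerivAt_fst
  have hneg : a ^ (1 - p - 1) = (a ^ p)⁻¹ := by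
    rw [← Real.rpow_neg ha.le]
    ring_nf
  have hsub : a ^ (1 - p) = (a ^ (p - 2))⁻¹ * a⁻¹ := by
    rw [← Real.rpow_neg ha.le, ← Real.rpow_neg_one, ← Real.rpow_add ha]
    ring_nf
  rw [HasFDerivAt.fderiv (f := piconeFun p) (hsnd.mul hfst), abs_div, abs_of_pos ha,
    Real.div_rpow (abs_nonneg _) ha.le, Real.div_rpow (abs_nonneg _) ha.le]
  simp only [_root_.add_apply, _root_.smul_apply, ContinuousLinearMap.coe_fst',
    ContinuousLinearMap.coe_snd', smul_eq_mul, hneg, hsub]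
  field_simp

theorem chainGrad_piconeFun (hp : 1 < p) {u φ : E n → ℝ} {Gu G : E n → E n} {x : E n}
    (hu : 0 < u x) :
    chainGrad (piconeFun p) u φ Gu G x = (|φ x / u x| ^ p * (1 - p)) • Gu x
      + (p * (|φ x / u x| ^ (p - 2) * (φ x / u x))) • G x := by
  rw [chainGrad, fderiv_piconeFun hp hu, fderiv_piconeFun hp hu]
  simp only [mul_one, mul_zero, add_zero, zero_add]

/-- The energy density of `φ`, whose gradient is `G`, relative to the positive solution `u`:
`p` times the Bregman distance of the Lagrangian from `(φ / u) ∇u` to `∇φ`. -/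
def energyDensity (p : ℝ) (Ω : Set (E n)) (H : E n → E n → ℝ) (u φ : E n → ℝ) (G : E n → E n)
    (x : E n) : ℝ :=
  p * bregman (lagrangian p H x) ((φ x / u x) • weakGrad Ω u x) (G x)

theorem energyDensity_eq_sub_fderiv (hp : 1 < p) {u φ : E n → ℝ} {G : E n → E n} {x : E n}
    (hquasi : IsBregmanQuasiSymm C (lagrangian p H x))
    (hhom : IsAbsHomogeneous p (lagrangian p H x)) (hu : 0 < u x) :
    energyDensity p Ω H u φ G x = H x (G x) ^ p - fderiv ℝ (lagrangian p H x) (weakGrad Ω u x)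
      (chainGrad (piconeFun p) u φ (weakGrad Ω u) G x) := by
  rw [energyDensity, bregman, chainGrad_piconeFun hp hu, map_sub,
    hhom.fderiv_self (hquasi.differentiable _) hp, hhom.fderiv_smul (hquasi.differentiable _) hp,
    hhom, map_add, map_smul, map_smul, hhom.fderiv_self (hquasi.differentiable _) hp,
    rpow_eq_mul_lagrangian (by linarith : p ≠ 0), smul_eq_mul, smul_eq_mul]
  ring

end Picone

section Energy

variable {n : ℕ} {p C : ℝ} {Ω K L : Set (E n)} {H : E n → E n → ℝ}

theorem IsFinslerNorm.exists_ae_norm_rpow_le (hH : IsFinslerNorm p C Ω H) (hp : p ≠ 0)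
    (hLΩ : L ⊆ Ω) (hL : IsCompact L) : ∃ c : ℝ, 0 ≤ c ∧
      ∀ᵐ x ∂(volume.restrict Ω), ∀ ξ : E n, (x ∉ L → ξ = 0) → ‖H x ξ ^ p‖ ≤ c * ‖ξ‖ ^ p := by
  obtain ⟨c, hc, hle⟩ := hH.exists_le L hLΩ hL
  refine ⟨c, hc, ?_⟩
  rw [ae_restrict_iff' hL.measurableSet] at hle
  filter_upwards [ae_restrict_of_ae hle, hH.isAbsHomogeneous, hH.nonneg] with x hx hhom hnonneg ξ hξ
  rw [Real.norm_of_nonneg (hnonneg ξ)]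
  by_cases hxL : x ∈ L
  · exact hx hxL ξ
  · rw [hξ hxL, hhom.map_zero hp]
    positivity

theorem IsFinslerNorm.ae_isAbsHomogeneous_lagrangian (hH : IsFinslerNorm p C Ω H) :
    ∀ᵐ x ∂(volume.restrict Ω), IsAbsHomogeneous p (lagrangian p H x) :=
  hH.isAbsHomogeneous.mono fun _ hx => hx.const_mul (1 / p)

theorem IsFinslerNorm.integrableOn_rpow (hH : IsFinslerNorm p C Ω H) (hp : 0 < p)
    (hK : IsCompact K) (hKΩ : K ⊆ Ω) {φ : E n → ℝ} {G : E n → E n}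
    (hφ : IsSobolevOn p K φ G) : IntegrableOn (fun x => H x (G x) ^ p) Ω := by
  obtain ⟨c, -, hle⟩ := hH.exists_ae_norm_rpow_le hp.ne' hKΩ hK
  refine ((integrable_norm_rpow_of_memLp hp hφ.memLp).const_mul c).integrableOn.mono'
    (hH.aemeasurable G hφ.memLp.1.aemeasurable.restrict).aestronglyMeasurable ?_
  filter_upwards [hle] with x hx using hx _ (hφ.grad_eq_zero x)

theorem IsSobolevOn.integrable_mul_abs_rpow (hp : 0 < p) {φ V : E n → ℝ} {G : E n → E n}
    (hV : LocallyIntegrableOn V Ω) (hK : IsCompact K) (hKΩ : K ⊆ Ω) (hφ : IsSobolevOn p K φ G) :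
    Integrable (fun x => V x * |φ x| ^ p) := by
  have hsupp : ∀ x ∉ K, |φ x| ^ p = 0 := fun x hx => by
    rw [hφ.eq_zero x hx, abs_zero, Real.zero_rpow hp.ne']
  simpa only [mul_comm] using integrable_mul_of_locallyIntegrableOn
    (hφ.continuous.abs.rpow_const fun _ => Or.inr hp.le) (HasCompactSupport.intro hK hsupp)
    ((closure_minimal (fun x hx => not_imp_comm.1 (hsupp x) hx) hK.isClosed).trans hKΩ) hV

theorem energy_eq_add (hp : 1 < p) (hH : IsFinslerNorm p C Ω H) (hΩ : IsOpen Ω)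
    {V φ : E n → ℝ} {G : E n → E n} (hV : LocallyIntegrableOn V Ω) (hK : IsCompact K)
    (hKΩ : K ⊆ Ω) (hφ : IsSobolevOn p K φ G) :
    energy p Ω H V φ = (∫ x in Ω, H x (G x) ^ p) + ∫ x in Ω, V x * |φ x| ^ p := by
  have hp0 : 0 < p := one_pos.trans hp
  rw [energy, ← integral_add (hH.integrableOn_rpow hp0 hK hKΩ hφ)
    (hφ.integrable_mul_abs_rpow hp0 hV hK hKΩ).integrableOn]
  refine integral_congr_ae ?_
  filter_upwards [hφ.weakGrad_ae_eq hp hΩ hKΩ] with x hx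
  rw [hx]

theorem energyDensity_nonneg_ae (hH : IsFinslerNorm p C Ω H) (hp : 0 ≤ p) (u φ : E n → ℝ)
    (G : E n → E n) : ∀ᵐ x ∂(volume.restrict Ω), 0 ≤ energyDensity p Ω H u φ G x :=
  hH.isBregmanQuasiSymm.mono fun _ hx => mul_nonneg hp (hx.nonneg _ _)

theorem IsTestApprox.tendsto_integral_rpow {f : E n → ℝ} {G : E n → E n} {F : ℕ → E n → ℝ}
    {D : E n → ℝ} (h : IsTestApprox p Ω L f G F D) (hH : IsFinslerNorm p C Ω H) (hp : 0 < p)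
    (hL : IsCompact L) (hLΩ : L ⊆ Ω) :
    Tendsto (fun k => ∫ x in Ω, H x (gradient (F k) x) ^ p) atTop
      (𝓝 (∫ x in Ω, H x (G x) ^ p)) := by
  obtain ⟨c, hc, hle⟩ := hH.exists_ae_norm_rpow_le hp.ne' hLΩ hL
  refine tendsto_integral_of_dominated_convergence (fun x => c * ‖D x‖ ^ p)
    (fun k => (hH.aemeasurable _ (h.aemeasurable_gradient k)).aestronglyMeasurable)
    ((integrable_norm_rpow_of_memLp hp h.memLp).const_mul c).integrableOn (fun k => ?_) ?_
  · filter_upwards [hle, ae_restrict_of_ae h.ae_norm_le] with x hx hDx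
    refine (hx _ fun hxL => h.gradient_eq_zero k hxL).trans ?_
    gcongr
    exact (hDx k).trans (Real.le_norm_self _)
  · filter_upwards [ae_restrict_of_ae h.ae_tendsto, hH.isBregmanQuasiSymm] with x hx hquasi
    simp only [rpow_eq_mul_lagrangian hp.ne']
    exact ((hquasi.differentiable.continuous.tendsto _).comp hx).const_mul p

theorem IsSobolevOn.exists_tendsto_energy (hp : 1 < p) (hΩ : IsOpen Ω)
    (hH : IsFinslerNorm p C Ω H) {V g : E n → ℝ} (hV : LocallyIntegrableOn V Ω)
    (hg : LocallyIntegrableOn g Ω) {φ : E n → ℝ} {G : E n → E n} (hK : IsCompact K) (hKΩ : K ⊆ Ω)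
    (hφ : IsSobolevOn p K φ G) :
    ∃ F : ℕ → E n → ℝ, (∀ k, IsTest Ω (F k)) ∧
      Tendsto (fun k => energy p Ω H V (F k)) atTop (𝓝 (energy p Ω H V φ)) ∧
      Tendsto (fun k => ∫ x in Ω, |g x| * |F k x| ^ p) atTop
        (𝓝 (∫ x in Ω, |g x| * |φ x| ^ p)) := by
  have hp0 : 0 < p := one_pos.trans hp
  obtain ⟨L, F, D, hL, hLΩ, hF⟩ := hφ.exists_isTestApprox hp.le hΩ hK hKΩ
  have hpot : ∀ {W : E n → ℝ}, LocallyIntegrableOn W Ω →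
      Tendsto (fun k => ∫ x in Ω, W x * |F k x| ^ p) atTop (𝓝 (∫ x in Ω, W x * |φ x| ^ p)) :=
    fun hW => hF.tendsto_integral_mul_comp hL hLΩ hW (θ := fun t => |t| ^ p)
      (continuous_abs.rpow_const fun _ => Or.inr hp0.le) (by simp [hp0.ne'])
  have henergy : ∀ k, energy p Ω H V (F k)
      = (∫ x in Ω, H x (gradient (F k) x) ^ p) + ∫ x in Ω, V x * |F k x| ^ p := fun k =>
    energy_eq_add hp hH hΩ hV (hF.isTest k).2.1 (hF.isTest k).2.2
      (isSobolevOn_of_contDiff (hF.isTest k).contDiff_one (hF.isTest k).2.1)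
  refine ⟨F, hF.isTest, ?_, hpot hg.norm⟩
  simp only [energy_eq_add hp hH hΩ hV hK hKΩ hφ, henergy]
  exact (hF.tendsto_integral_rpow hH hp0 hL hLΩ).add (hpot hV)

namespace IsPositiveSolution

variable {V u φ : E n → ℝ} {G : E n → E n}

theorem exists_isSobolevOn_piconeFun (hu : IsPositiveSolution p C Ω H V u) (hK : IsCompact K)
    (hKΩ : K ⊆ Ω) (hφ : IsSobolevOn p K φ G) :
    ∃ Gw, IsSobolevOn p K (fun x => piconeFun p (u x, φ x)) Gw ∧
      energyDensity p Ω H u φ G =ᵐ[volume.restrict Ω] fun x =>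
        H x (G x) ^ p - fderiv ℝ (lagrangian p H x) (weakGrad Ω u x) (Gw x) := by
  obtain ⟨Gw, hw, hGw⟩ := hφ.comp_pos hu.one_lt.le hu.isOpen hu.continuousOn hu.pos
    hu.isSolution.1 hK hKΩ (contDiffOn_piconeFun hu.one_lt)
    (fun t => by simp [piconeFun, Real.zero_rpow hu.exponent_pos.ne'])
  refine ⟨Gw, hw, ?_⟩
  filter_upwards [hu.isFinslerNorm.isBregmanQuasiSymm,
    hu.isFinslerNorm.ae_isAbsHomogeneous_lagrangian, ae_restrict_mem hu.isOpen.measurableSet]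
    with x hquasi hhom hx
  rw [energyDensity_eq_sub_fderiv hu.one_lt hquasi hhom (hu.pos x hx), hGw hx]

theorem integrableOn_energyDensity (hu : IsPositiveSolution p C Ω H V u) (hK : IsCompact K)
    (hKΩ : K ⊆ Ω) (hφ : IsSobolevOn p K φ G) : IntegrableOn (energyDensity p Ω H u φ G) Ω := by
  obtain ⟨Gw, hw, hae⟩ := hu.exists_isSobolevOn_piconeFun hK hKΩ hφ
  exact ((hu.isFinslerNorm.integrableOn_rpow hu.exponent_pos hK hKΩ hφ).sub
    (hu.integrableOn_fderiv hK hKΩ hw)).congr hae.symm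

theorem mul_piconeFun (hu : IsPositiveSolution p C Ω H V u) (φ : E n → ℝ) {x : E n}
    (hx : x ∈ Ω) :
    V x * |u x| ^ (p - 2) * u x * piconeFun p (u x, φ x) = V x * |φ x| ^ p := by
  have hux := hu.pos x hx
  have hcancel : |u x| ^ (p - 2) * u x * u x ^ (1 - p) = 1 := by
    rw [abs_of_pos hux, ← Real.rpow_add_one hux.ne', ← Real.rpow_add hux]
    ring_nf
    exact Real.rpow_zero _
  calc V x * |u x| ^ (p - 2) * u x * piconeFun p (u x, φ x)
      = V x * |φ x| ^ p * (|u x| ^ (p - 2) * u x * u x ^ (1 - p)) := by rw [piconeFun]; ring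
    _ = V x * |φ x| ^ p := by rw [hcancel, mul_one]

theorem energy_eq_integral_energyDensity (hu : IsPositiveSolution p C Ω H V u)
    (hK : IsCompact K) (hKΩ : K ⊆ Ω) (hφ : IsSobolevOn p K φ G) :
    energy p Ω H V φ = ∫ x in Ω, energyDensity p Ω H u φ G x := by
  obtain ⟨Gw, hw, hae⟩ := hu.exists_isSobolevOn_piconeFun hK hKΩ hφ
  have hsol := hu.integral_fderiv_add_integral_eq_zero hK hKΩ hw
  rw [setIntegral_congr_fun hu.isOpen.measurableSet fun x hx => hu.mul_piconeFun φ hx] at hsol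
  rw [integral_congr_ae hae,
    integral_sub (hu.isFinslerNorm.integrableOn_rpow hu.exponent_pos hK hKΩ hφ)
      (hu.integrableOn_fderiv hK hKΩ hw),
    energy_eq_add hu.one_lt hu.isFinslerNorm hu.isOpen hu.locallyIntegrableOn hK hKΩ hφ]
  linarith

end IsPositiveSolution

end Energy

/-! ### Truncation and the capacitary inequality -/

section Truncation

variable {n : ℕ} {p C M c : ℝ} {Ω K : Set (E n)} {H : E n → E n → ℝ} {ρ : ℝ → ℝ} {u φ : E n → ℝ}

/-- The truncation `u ρ (φ / (c u))` of `φ` relative to `u`, as a function of the values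
`(u, φ)`. For a cutoff `ρ` as in `IsFlatCutoff` it is `0` where `|φ| ≤ c u` and `u` where
`2 c u ≤ |φ|`. -/
def truncationFun (ρ : ℝ → ℝ) (c : ℝ) (q : ℝ × ℝ) : ℝ := q.1 * ρ (q.2 / q.1 / c)

theorem contDiffOn_truncationFun (hρ : ContDiff ℝ 1 ρ) (c : ℝ) :
    ContDiffOn ℝ 1 (truncationFun ρ c) {q | 0 < q.1} :=
  contDiff_fst.contDiffOn.mul (hρ.comp_contDiffOn
    ((contDiff_snd.contDiffOn.div contDiff_fst.contDiffOn fun _ hq => ne_of_gt hq).div_const c))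

theorem fderiv_truncationFun (hρ : Differentiable ℝ ρ) (c : ℝ) {a : ℝ} (ha : a ≠ 0) (b s t : ℝ) :
    fderiv ℝ (truncationFun ρ c) (a, b) (s, t)
      = (ρ (b / a / c) - b / a / c * deriv ρ (b / a / c)) * s
        + c⁻¹ * deriv ρ (b / a / c) * t := by
  have hquot : HasFDerivAt (fun q : ℝ × ℝ => q.2 / q.1 / c)
      (c⁻¹ • (a⁻¹ • ContinuousLinearMap.snd ℝ ℝ ℝ - (b / a ^ 2) • ContinuousLinearMap.fst ℝ ℝ ℝ))
      (a, b) := by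
    refine (((hasFDerivAt_snd (𝕜 := ℝ) (p := (a, b))).mul ((hasDerivAt_inv ha).comp_hasFDerivAt
      (a, b) hasFDerivAt_fst)).mul_const c⁻¹).congr_fderiv ?_
    ext <;> simp [div_eq_mul_inv]
  rw [HasFDerivAt.fderiv (f := truncationFun ρ c)
    (hasFDerivAt_fst.mul (HasDerivAt.comp_hasFDerivAt (a, b) (hρ _).hasDerivAt hquot))]
  simp only [_root_.add_apply, _root_.smul_apply, _root_.sub_apply, ContinuousLinearMap.coe_snd',
    ContinuousLinearMap.coe_fst', smul_eq_mul]
  field_simp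
  ring

theorem chainGrad_truncationFun (hρ : Differentiable ℝ ρ) (c : ℝ) {Gu G : E n → E n} {x : E n}
    (hu : u x ≠ 0) :
    chainGrad (truncationFun ρ c) u φ Gu G x = ρ (φ x / u x / c) • Gu x
      + deriv ρ (φ x / u x / c) • (c⁻¹ • G x - (φ x / u x / c) • Gu x) := by
  rw [chainGrad, fderiv_truncationFun hρ c hu, fderiv_truncationFun hρ c hu]
  module

/-- The part of `Ω` where `c < |φ| / u < d`. -/
def openShell (Ω : Set (E n)) (u φ : E n → ℝ) (c d : ℝ) : Set (E n) :=
  {x ∈ Ω | c * u x < |φ x| ∧ |φ x| < d * u x}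

/-- The part of `K` where `c ≤ |φ| / u`. -/
def superlevelSet (K : Set (E n)) (u φ : E n → ℝ) (c : ℝ) : Set (E n) :=
  {x ∈ K | c * u x ≤ |φ x|}

theorem isOpen_openShell (hΩ : IsOpen Ω) (hu : ContinuousOn u Ω) (hφ : Continuous φ) (c d : ℝ) :
    IsOpen (openShell Ω u φ c d) := by
  have hmaps : ContinuousOn (fun x => (|φ x| - c * u x, d * u x - |φ x|)) Ω := by fun_prop
  convert hmaps.isOpen_inter_preimage hΩ (isOpen_Ioi (a := (0 : ℝ)) |>.prod (isOpen_Ioi (a := 0)))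
    using 1
  ext x
  simp only [openShell, mem_inter_iff, mem_preimage, mem_prod, mem_Ioi, sub_pos, mem_ofPred_eq]

theorem isCompact_superlevelSet (hK : IsCompact K) (hu : ContinuousOn u K) (hφ : Continuous φ)
    (c : ℝ) : IsCompact (superlevelSet K u φ c) := by
  have hdiff : ContinuousOn (fun x => |φ x| - c * u x) K := by fun_prop
  convert hK.of_isClosed_subset (hdiff.preimage_isClosed_of_isClosed hK.isClosed
    (isClosed_Ici (a := 0))) inter_subset_left using 1
  ext x
  simp [superlevelSet]

theorem energyDensity_truncationFun (hρ : Differentiable ℝ ρ) {x : E n} (hu : u x ≠ 0)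
    (G : E n → E n) :
    energyDensity p Ω H u (fun x => truncationFun ρ c (u x, φ x))
        (chainGrad (truncationFun ρ c) u φ (weakGrad Ω u) G) x
      = p * bregman (lagrangian p H x) (ρ (φ x / u x / c) • weakGrad Ω u x)
          (ρ (φ x / u x / c) • weakGrad Ω u x
            + deriv ρ (φ x / u x / c) • (c⁻¹ • G x - (φ x / u x / c) • weakGrad Ω u x)) := by
  rw [energyDensity, chainGrad_truncationFun hρ c hu, truncationFun, mul_div_cancel_left₀ _ hu]

theorem energyDensity_eq_rpow_mul {x : E n} (hhom : IsAbsHomogeneous p (lagrangian p H x))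
    (hc : 0 < c) (G : E n → E n) :
    energyDensity p Ω H u φ G x = c ^ p * (p * bregman (lagrangian p H x)
      ((φ x / u x / c) • weakGrad Ω u x) (c⁻¹ • G x)) := by
  have hscale := hhom.bregman_smul_smul c ((φ x / u x / c) • weakGrad Ω u x) (c⁻¹ • G x)
  rw [smul_smul, mul_div_cancel₀ _ hc.ne', smul_inv_smul₀ hc.ne', abs_of_pos hc] at hscale
  rw [energyDensity, hscale]
  ring

theorem energyDensity_truncationFun_le (hp : 0 < p) (hM : 1 ≤ M)
    (hρ : IsFlatCutoff p (1 + C) M ρ) {x : E n}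
    (hquasi : IsBregmanQuasiSymm C (lagrangian p H x))
    (hhom : IsAbsHomogeneous p (lagrangian p H x)) (hc : 0 < c) (hx : x ∈ Ω) (hu : 0 < u x)
    (G : E n → E n) :
    c ^ p * energyDensity p Ω H u (fun x => truncationFun ρ c (u x, φ x))
        (chainGrad (truncationFun ρ c) u φ (weakGrad Ω u) G) x
      ≤ (openShell Ω u φ c (2 * c)).indicator
          (fun x => M ^ (1 + C) * energyDensity p Ω H u φ G x) x := by
  have hcu : 0 < c * u x := mul_pos hc hu
  have habs : |φ x / u x / c| = |φ x| / (c * u x) := by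
    rw [div_div, mul_comm (u x), abs_div, abs_of_pos hcu]
  rw [energyDensity_truncationFun (hρ.contDiff.differentiable one_ne_zero) hu.ne']
  by_cases hshell : x ∈ openShell Ω u φ c (2 * c)
  · have hlt : 1 < |φ x / u x / c| := by
      rw [habs, one_lt_div hcu]
      exact hshell.2.1
    have hcut := hρ.bregman_le hM hp.le hquasi hhom hlt (weakGrad Ω u x)
      (c⁻¹ • G x - (φ x / u x / c) • weakGrad Ω u x)
    rw [add_sub_cancel] at hcut
    rw [indicator_of_mem hshell, energyDensity_eq_rpow_mul hhom hc, mul_left_comm (M ^ (1 + C)),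
      mul_left_comm (M ^ (1 + C))]
    gcongr
  · have hderiv : deriv ρ (φ x / u x / c) = 0 := by
      rcases le_or_gt |φ x / u x / c| 1 with hle | hlt
      · exact hρ.deriv_of_abs_le_one hle
      · refine hρ.deriv_of_two_le_abs ?_
        rw [habs, one_lt_div hcu] at hlt
        rw [habs, le_div_iff₀ hcu, ← mul_assoc]
        exact not_lt.1 fun hlt2 => hshell ⟨hx, hlt, hlt2⟩
    rw [indicator_of_notMem hshell, hderiv, zero_smul, add_zero, bregman_self, mul_zero, mul_zero]

end Truncation

section Capacitary

variable {n : ℕ} {p C M c : ℝ} {Ω K S : Set (E n)} {H : E n → E n → ℝ} {V u φ g : E n → ℝ}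
  {G : E n → E n} {L : ℝ≥0}

theorem wInt_le_of_abs_le (hp : 0 ≤ p) (hc : 0 ≤ c) (hS : MeasurableSet S) (g : E n → ℝ)
    (hle : ∀ x ∈ S, |φ x| ≤ c * |u x|) : wInt p S g φ ≤ ENNReal.ofReal (c ^ p) * wInt p S g u := by
  rw [wInt, wInt, ← lintegral_const_mul' _ _ ENNReal.ofReal_ne_top]
  refine setLIntegral_mono' hS fun x hx => ?_
  rw [← ENNReal.ofReal_mul (by positivity), mul_left_comm, ← Real.mul_rpow hc (abs_nonneg _)]
  gcongr
  exact hle x hx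

namespace IsPositiveSolution

theorem ofReal_energy_eq_lintegral (hu : IsPositiveSolution p C Ω H V u) (hK : IsCompact K)
    (hKΩ : K ⊆ Ω) (hφ : IsSobolevOn p K φ G) :
    ENNReal.ofReal (energy p Ω H V φ)
      = ∫⁻ x in Ω, ENNReal.ofReal (energyDensity p Ω H u φ G x) := by
  rw [hu.energy_eq_integral_energyDensity hK hKΩ hφ, ofReal_integral_eq_lintegral_ofReal
    (hu.integrableOn_energyDensity hK hKΩ hφ)
    (energyDensity_nonneg_ae hu.isFinslerNorm hu.exponent_pos.le u φ G)]

theorem capacity_superlevelSet_le {ρ : ℝ → ℝ} (hu : IsPositiveSolution p C Ω H V u)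
    (hM : 1 ≤ M) (hρ : IsFlatCutoff p (1 + C) M ρ) (hK : IsCompact K) (hKΩ : K ⊆ Ω)
    (hφ : IsSobolevOn p K φ G) (hc : 0 < c) :
    ENNReal.ofReal (c ^ p) * capacity p Ω H V u (superlevelSet K u φ (2 * c))
      ≤ ENNReal.ofReal (M ^ (1 + C)) *
        ∫⁻ x in openShell Ω u φ c (2 * c), ENNReal.ofReal (energyDensity p Ω H u φ G x) := by
  obtain ⟨G', hφ', hG'⟩ := hφ.comp_pos hu.one_lt.le hu.isOpen hu.continuousOn hu.pos
    hu.isSolution.1 hK hKΩ (contDiffOn_truncationFun hρ.contDiff c)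
    (fun t => by simp [truncationFun, hρ.eq_zero])
  have hcap : capacity p Ω H V u (superlevelSet K u φ (2 * c))
      ≤ ENNReal.ofReal (energy p Ω H V fun x => truncationFun ρ c (u x, φ x)) := by
    refine iInf₂_le_of_le _ (hφ'.memW1pCc hu.one_lt hK hKΩ) (iInf_le _ fun x hx => ?_)
    have hux := hu.pos x (hKΩ hx.1)
    change u x ≤ u x * ρ (φ x / u x / c)
    rw [hρ.eq_one, mul_one]
    rw [abs_div, abs_div, abs_of_pos hux, abs_of_pos hc, div_div, le_div_iff₀ (mul_pos hux hc)]
    exact (by ring : 2 * (u x * c) = 2 * c * u x).trans_le hx.2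
  have hshell := (isOpen_openShell hu.isOpen hu.continuousOn hφ.continuous c (2 * c)).measurableSet
  refine (mul_le_mul_right hcap _).trans ?_
  rw [hu.ofReal_energy_eq_lintegral hK hKΩ hφ', ← lintegral_const_mul' _ _ ENNReal.ofReal_ne_top,
    ← lintegral_const_mul' _ _ ENNReal.ofReal_ne_top,
    ← Measure.restrict_restrict_of_subset (fun x hx => hx.1 : openShell Ω u φ c (2 * c) ⊆ Ω),
    ← lintegral_indicator hshell]
  refine lintegral_mono_ae ?_
  filter_upwards [hu.isFinslerNorm.isBregmanQuasiSymm,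
    hu.isFinslerNorm.ae_isAbsHomogeneous_lagrangian, ae_restrict_mem hu.isOpen.measurableSet]
    with x hquasi hhom hx
  have hle := energyDensity_truncationFun_le (φ := φ) hu.exponent_pos hM hρ hquasi hhom hc hx
    (hu.pos x hx) G
  rw [← ENNReal.ofReal_mul (by positivity), energyDensity, hG' hx]
  refine (ENNReal.ofReal_le_ofReal hle).trans ?_
  by_cases hxS : x ∈ openShell Ω u φ c (2 * c)
  · rw [indicator_of_mem hxS, indicator_of_mem hxS, ENNReal.ofReal_mul (by positivity)]
  · rw [indicator_of_notMem hxS, ENNReal.ofReal_zero]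
    exact zero_le

theorem wInt_superlevelSet_diff_le {ρ : ℝ → ℝ} (hu : IsPositiveSolution p C Ω H V u)
    (hM : 1 ≤ M) (hρ : IsFlatCutoff p (1 + C) M ρ) (hK : IsCompact K) (hKΩ : K ⊆ Ω)
    (hL : ∀ S ⊆ Ω, IsCompact S → wInt p S g u ≤ L * capacity p Ω H V u S)
    (hφ : IsSobolevOn p K φ G) (hc : 0 < c) :
    wInt p (superlevelSet K u φ (2 * c) \ superlevelSet K u φ (4 * c)) g φ
      ≤ ENNReal.ofReal (4 ^ p * M ^ (1 + C)) * L *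
        ∫⁻ x in openShell Ω u φ c (2 * c), ENNReal.ofReal (energyDensity p Ω H u φ G x) := by
  have hcompact := isCompact_superlevelSet hK (hu.continuousOn.mono hKΩ) hφ.continuous
  have hsub : superlevelSet K u φ (2 * c) ⊆ Ω := fun x hx => hKΩ hx.1
  calc wInt p (superlevelSet K u φ (2 * c) \ superlevelSet K u φ (4 * c)) g φ
      ≤ ENNReal.ofReal ((4 * c) ^ p) *
          wInt p (superlevelSet K u φ (2 * c) \ superlevelSet K u φ (4 * c)) g u := by
        refine wInt_le_of_abs_le hu.exponent_pos.le (by positivity)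
          ((hcompact _).measurableSet.diff (hcompact _).measurableSet) g fun x hx => ?_
        rw [abs_of_pos (hu.pos x (hsub hx.1))]
        exact le_of_not_ge fun hle => hx.2 ⟨hx.1.1, hle⟩
    _ ≤ ENNReal.ofReal ((4 * c) ^ p) * wInt p (superlevelSet K u φ (2 * c)) g u := by
        gcongr
        exact lintegral_mono_set sdiff_subset
    _ ≤ ENNReal.ofReal ((4 * c) ^ p) *
          (L * capacity p Ω H V u (superlevelSet K u φ (2 * c))) := by
        gcongr
        exact hL _ hsub (hcompact _)
    _ = ENNReal.ofReal (4 ^ p) * L *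
          (ENNReal.ofReal (c ^ p) * capacity p Ω H V u (superlevelSet K u φ (2 * c))) := by
        rw [Real.mul_rpow (by positivity) hc.le, ENNReal.ofReal_mul (by positivity)]
        ring
    _ ≤ ENNReal.ofReal (4 ^ p) * L * (ENNReal.ofReal (M ^ (1 + C)) *
          ∫⁻ x in openShell Ω u φ c (2 * c), ENNReal.ofReal (energyDensity p Ω H u φ G x)) := by
        exact mul_le_mul_right (hu.capacity_superlevelSet_le hM hρ hK hKΩ hφ hc) _
    _ = _ := by
        rw [ENNReal.ofReal_mul (by positivity)]
        ring

theorem pairwise_disjoint_openShell_zpow (hu : IsPositiveSolution p C Ω H V u) (φ : E n → ℝ) :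
    Pairwise (Function.onFun Disjoint fun j : ℤ => openShell Ω u φ (2 ^ j) (2 * 2 ^ j)) := by
  refine (pairwise_disjoint_on _).2 fun i j hij => Set.disjoint_left.2 fun x hi hj => ?_
  have hpow : (2 : ℝ) * 2 ^ i ≤ 2 ^ j := by
    rw [← zpow_one_add₀ two_ne_zero]
    exact zpow_le_zpow_right₀ one_le_two (by lia)
  exact (hi.2.2.trans_le (mul_le_mul_of_nonneg_right hpow (hu.pos x hi.1).le)).not_gt hj.2.1

theorem exists_mem_superlevelSet_diff (hu : IsPositiveSolution p C Ω H V u) (hKΩ : K ⊆ Ω) {x : E n}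
    (hx : x ∈ K) (hφ : φ x ≠ 0) :
    ∃ j : ℤ, x ∈ superlevelSet K u φ (2 * 2 ^ j) \ superlevelSet K u φ (4 * 2 ^ j) := by
  have hux := hu.pos x (hKΩ hx)
  obtain ⟨j, hle, hlt⟩ := exists_mem_Ico_zpow (div_pos (abs_pos.2 hφ) hux) (one_lt_two (α := ℝ))
  rw [le_div_iff₀ hux] at hle
  rw [div_lt_iff₀ hux] at hlt
  have hj : (2 : ℝ) * 2 ^ (j - 1) = 2 ^ j := by
    rw [← zpow_one_add₀ two_ne_zero, add_sub_cancel]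
  have hj' : (4 : ℝ) * 2 ^ (j - 1) = 2 ^ (j + 1) := by
    rw [zpow_add_one₀ two_ne_zero, ← hj]
    ring
  exact ⟨j - 1, ⟨hx, hj.symm ▸ hle⟩, fun hmem => hlt.not_ge (hj' ▸ hmem.2)⟩

theorem wInt_le_tsum (hu : IsPositiveSolution p C Ω H V u) (hKΩ : K ⊆ Ω)
    (hφ : ∀ x ∉ K, φ x = 0) (g : E n → ℝ) :
    wInt p Ω g φ ≤ ∑' j : ℤ,
      wInt p (superlevelSet K u φ (2 * 2 ^ j) \ superlevelSet K u φ (4 * 2 ^ j)) g φ := by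
  have hsupp : Function.support (fun x => ENNReal.ofReal (|g x| * |φ x| ^ p))
      ⊆ ⋃ j : ℤ, superlevelSet K u φ (2 * 2 ^ j) \ superlevelSet K u φ (4 * 2 ^ j) := fun x hx => by
    have hφx : φ x ≠ 0 := fun h => hx (by simp [h, Real.zero_rpow hu.exponent_pos.ne'])
    exact mem_iUnion.2 (hu.exists_mem_superlevelSet_diff hKΩ
      (not_imp_comm.1 (hφ x) hφx) hφx)
  calc wInt p Ω g φ ≤ ∫⁻ x, ENNReal.ofReal (|g x| * |φ x| ^ p) := setLIntegral_le_lintegral _ _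
    _ = ∫⁻ x in ⋃ j : ℤ, superlevelSet K u φ (2 * 2 ^ j) \ superlevelSet K u φ (4 * 2 ^ j),
          ENNReal.ofReal (|g x| * |φ x| ^ p) := (setLIntegral_eq_of_support_subset hsupp).symm
    _ ≤ _ := lintegral_iUnion_le _ _

end IsPositiveSolution

/-- Maz'ya's capacitary inequality: the capacitary bounds at the dyadic levels of `φ / u` add up,
since the energies that control them live on disjoint shells. -/
theorem exists_wInt_le_energy (hp : 0 < p) (C : ℝ) : ∃ D : ℝ≥0, 0 < D ∧
    ∀ {n : ℕ} {Ω : Set (E n)} {H : E n → E n → ℝ} {V u g : E n → ℝ} {L : ℝ≥0},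
      IsPositiveSolution p C Ω H V u →
      (∀ K ⊆ Ω, IsCompact K → wInt p K g u ≤ L * capacity p Ω H V u K) →
      ∀ φ, MemW1pCc p Ω φ → wInt p Ω g φ ≤ D * L * ENNReal.ofReal (energy p Ω H V φ) := by
  obtain ⟨ρ, M, hM, hρ⟩ := exists_isFlatCutoff hp (1 + C)
  refine ⟨(4 ^ p * M ^ (1 + C)).toNNReal, by simpa using by positivity, ?_⟩
  intro n Ω H V u g L hu hL φ hφ
  obtain ⟨K, G, hK, hKΩ, hφ⟩ := hφ.exists_isSobolevOn hu.isOpen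
  have hmeas : ∀ j : ℤ, MeasurableSet (openShell Ω u φ (2 ^ j) (2 * 2 ^ j)) := fun j =>
    (isOpen_openShell hu.isOpen hu.continuousOn hφ.continuous _ _).measurableSet
  calc wInt p Ω g φ
      ≤ ∑' j : ℤ, wInt p (superlevelSet K u φ (2 * 2 ^ j) \ superlevelSet K u φ (4 * 2 ^ j)) g φ :=
        hu.wInt_le_tsum hKΩ hφ.eq_zero g
    _ ≤ ∑' j : ℤ, ENNReal.ofReal (4 ^ p * M ^ (1 + C)) * L *
          ∫⁻ x in openShell Ω u φ (2 ^ j) (2 * 2 ^ j),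
            ENNReal.ofReal (energyDensity p Ω H u φ G x) :=
        ENNReal.tsum_le_tsum fun j =>
          hu.wInt_superlevelSet_diff_le hM hρ hK hKΩ hL hφ (zpow_pos two_pos j)
    _ = ENNReal.ofReal (4 ^ p * M ^ (1 + C)) * L *
          ∫⁻ x in ⋃ j : ℤ, openShell Ω u φ (2 ^ j) (2 * 2 ^ j),
            ENNReal.ofReal (energyDensity p Ω H u φ G x) := by
        rw [ENNReal.tsum_mul_left, lintegral_iUnion hmeas (hu.pairwise_disjoint_openShell_zpow φ)]
    _ ≤ ENNReal.ofReal (4 ^ p * M ^ (1 + C)) * L *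
          ∫⁻ x in Ω, ENNReal.ofReal (energyDensity p Ω H u φ G x) := by
        gcongr
        exact iUnion_subset fun j x hx => hx.1
    _ = ENNReal.ofReal (4 ^ p * M ^ (1 + C)) * L * ENNReal.ofReal (energy p Ω H V φ) := by
        rw [hu.ofReal_energy_eq_lintegral hK hKΩ hφ]

end Capacitary

/-! ### The capacitary norm -/

section CapNorm

variable {n : ℕ} {p : ℝ} {Ω K : Set (E n)} {H : E n → E n → ℝ} {V u : E n → ℝ}

theorem ae_restrict_of_forall_isCompact (hΩ : IsOpen Ω) {P : E n → Prop}
    (h : ∀ K ⊆ Ω, IsCompact K → ∀ᵐ x ∂(volume.restrict K), P x) :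
    ∀ᵐ x ∂(volume.restrict Ω), P x := by
  rw [ae_restrict_iff' hΩ.measurableSet, ae_iff]
  refine measure_null_of_locally_null _ fun x hx => ?_
  obtain ⟨K, hK, hxK, hKΩ⟩ := exists_compact_subset hΩ (Classical.not_imp.1 hx).1
  have hnull := h K hKΩ hK
  rw [ae_restrict_iff' hK.measurableSet, ae_iff] at hnull
  refine ⟨_, inter_mem_nhdsWithin _ (mem_interior_iff_mem_nhds.1 hxK),
    measure_mono_null (fun y hy => ?_) hnull⟩
  exact fun hPy => hy.1 fun _ => hPy hy.2

theorem aemeasurable_abs_mul_abs_rpow (hΩ : IsOpen Ω) (huc : ContinuousOn u Ω) (hKΩ : K ⊆ Ω)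
    {g : E n → ℝ} (hg : AEStronglyMeasurable g (volume.restrict Ω)) :
    AEMeasurable (fun x => |g x| * |u x| ^ p) (volume.restrict K) :=
  (hg.aemeasurable.norm.mul ((huc.aemeasurable hΩ.measurableSet).norm.pow_const p)).mono_measure
    (Measure.restrict_mono hKΩ le_rfl)

theorem wInt_mono (hKΩ : K ⊆ Ω) {g h φ : E n → ℝ}
    (hgh : ∀ᵐ x ∂(volume.restrict Ω), |g x| ≤ |h x|) : wInt p K g φ ≤ wInt p K h φ := by
  refine lintegral_mono_ae ?_
  filter_upwards [ae_restrict_of_ae_restrict_of_subset hKΩ hgh] with x hx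
  gcongr

theorem wInt_const_mul (c : ℝ) (g φ : E n → ℝ) :
    wInt p K (fun x => c * g x) φ = ENNReal.ofReal |c| * wInt p K g φ := by
  rw [wInt, wInt, ← lintegral_const_mul' _ _ ENNReal.ofReal_ne_top]
  refine lintegral_congr fun x => ?_
  rw [← ENNReal.ofReal_mul (abs_nonneg _), abs_mul, mul_assoc]

theorem wInt_add_le (hΩ : IsOpen Ω) (huc : ContinuousOn u Ω) (hKΩ : K ⊆ Ω) {g : E n → ℝ}
    (hg : AEStronglyMeasurable g (volume.restrict Ω)) (h : E n → ℝ) :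
    wInt p K (fun x => g x + h x) u ≤ wInt p K g u + wInt p K h u := by
  rw [wInt, wInt, wInt,
    ← lintegral_add_left' (aemeasurable_abs_mul_abs_rpow hΩ huc hKΩ hg).ennreal_ofReal]
  refine lintegral_mono fun x => ?_
  rw [← ENNReal.ofReal_add (by positivity) (by positivity), ← add_mul]
  gcongr
  exact abs_add_le _ _

theorem IsTest.memW1pCc (hp : 1 < p) {φ : E n → ℝ} (hφ : IsTest Ω φ) : MemW1pCc p Ω φ :=
  (isSobolevOn_of_contDiff hφ.contDiff_one hφ.2.1).memW1pCc hp hφ.2.1 hφ.2.2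

theorem exists_memW1pCc_ge (hp : 1 < p) (hΩ : IsOpen Ω) (huc : ContinuousOn u K)
    (hK : IsCompact K) (hKΩ : K ⊆ Ω) : ∃ φ, MemW1pCc p Ω φ ∧ ∀ x ∈ K, u x ≤ φ x := by
  obtain ⟨χ, hχ, -, hχ1⟩ := exists_isTest_one_nhds hΩ hK hKΩ
  obtain ⟨M, hM⟩ := hK.exists_bound_of_continuousOn huc
  refine ⟨fun x => M * χ x, IsTest.memW1pCc hp ⟨contDiff_const.mul hχ.1, hχ.2.1.mul_left,
    (closure_mono (Function.support_mul_subset_right _ _)).trans hχ.2.2⟩, fun x hx => ?_⟩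
  change u x ≤ M * χ x
  rw [hχ1.self_of_nhdsSet x hx, mul_one]
  exact (le_abs_self _).trans (hM x hx)

theorem capacity_lt_top (hp : 1 < p) (hΩ : IsOpen Ω) (huc : ContinuousOn u K)
    (hK : IsCompact K) (hKΩ : K ⊆ Ω) : capacity p Ω H V u K < ⊤ := by
  obtain ⟨φ, hφ, hge⟩ := exists_memW1pCc_ge hp hΩ huc hK hKΩ
  exact (iInf₂_le_of_le φ hφ (iInf_le _ hge)).trans_lt ENNReal.ofReal_lt_top

theorem capNorm_le {g : E n → ℝ} {L : ℝ≥0∞}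
    (h : ∀ K ⊆ Ω, IsCompact K → wInt p K g u ≤ L * capacity p Ω H V u K) :
    capNorm p Ω H V u g ≤ L := by
  induction L with
  | top => exact le_top
  | coe L => exact iInf₂_le L h

theorem wInt_le_capNorm_mul (hp : 1 < p) (hΩ : IsOpen Ω) (huc : ContinuousOn u Ω) {g : E n → ℝ}
    (hg : capNorm p Ω H V u g < ⊤) (hKΩ : K ⊆ Ω) (hK : IsCompact K) :
    wInt p K g u ≤ capNorm p Ω H V u g * capacity p Ω H V u K := by
  have hcap := (capacity_lt_top (H := H) (V := V) hp hΩ (huc.mono hKΩ) hK hKΩ).ne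
  by_cases hzero : capacity p Ω H V u K = 0
  · obtain ⟨L, hL, -⟩ := by simpa only [capNorm, iInf_lt_iff] using hg
    simpa only [hzero, mul_zero] using hL K hKΩ hK
  · rw [← ENNReal.div_le_iff hzero hcap]
    refine le_iInf₂ fun L hL => ?_
    rw [ENNReal.div_le_iff hzero hcap]
    exact hL K hKΩ hK

theorem capNorm_mono (hp : 1 < p) (hΩ : IsOpen Ω) (huc : ContinuousOn u Ω) {g h : E n → ℝ}
    (hgh : ∀ᵐ x ∂(volume.restrict Ω), |g x| ≤ |h x|) :
    capNorm p Ω H V u g ≤ capNorm p Ω H V u h := by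
  rcases eq_top_or_lt_top (capNorm p Ω H V u h) with htop | hlt
  · exact le_top.trans_eq htop.symm
  · exact capNorm_le fun K hKΩ hK =>
      (wInt_mono hKΩ hgh).trans (wInt_le_capNorm_mul hp hΩ huc hlt hKΩ hK)

theorem capNorm_congr (hp : 1 < p) (hΩ : IsOpen Ω) (huc : ContinuousOn u Ω) {g h : E n → ℝ}
    (hgh : g =ᵐ[volume.restrict Ω] h) : capNorm p Ω H V u g = capNorm p Ω H V u h :=
  le_antisymm (capNorm_mono hp hΩ huc (hgh.mono fun x hx => by rw [hx]))
    (capNorm_mono hp hΩ huc (hgh.mono fun x hx => by rw [hx]))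

theorem capNorm_add_le (hp : 1 < p) (hΩ : IsOpen Ω) (huc : ContinuousOn u Ω) {g : E n → ℝ}
    (hg : AEStronglyMeasurable g (volume.restrict Ω)) (h : E n → ℝ) :
    capNorm p Ω H V u (fun x => g x + h x) ≤ capNorm p Ω H V u g + capNorm p Ω H V u h := by
  rcases eq_top_or_lt_top (capNorm p Ω H V u g) with htop | hg_lt
  · simp [htop]
  rcases eq_top_or_lt_top (capNorm p Ω H V u h) with htop | hh_lt
  · simp [htop]
  refine capNorm_le fun K hKΩ hK => (wInt_add_le hΩ huc hKΩ hg h).trans ?_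
  rw [add_mul]
  exact add_le_add (wInt_le_capNorm_mul hp hΩ huc hg_lt hKΩ hK)
    (wInt_le_capNorm_mul hp hΩ huc hh_lt hKΩ hK)

theorem capNorm_zero : capNorm p Ω H V u (fun _ => 0) = 0 :=
  le_antisymm (capNorm_le fun K _ _ => by simp [wInt]) zero_le

theorem capNorm_const_mul_le (hp : 1 < p) (hΩ : IsOpen Ω) (huc : ContinuousOn u Ω) {c : ℝ}
    (hc : c ≠ 0) (g : E n → ℝ) :
    capNorm p Ω H V u (fun x => c * g x) ≤ ENNReal.ofReal |c| * capNorm p Ω H V u g := by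
  rcases eq_top_or_lt_top (capNorm p Ω H V u g) with htop | hlt
  · rw [htop, ENNReal.mul_top (by simpa using hc)]
    exact le_top
  · refine capNorm_le fun K hKΩ hK => ?_
    rw [wInt_const_mul, mul_assoc]
    gcongr
    exact wInt_le_capNorm_mul hp hΩ huc hlt hKΩ hK

theorem capNorm_const_mul (hp : 1 < p) (hΩ : IsOpen Ω) (huc : ContinuousOn u Ω) (c : ℝ)
    (g : E n → ℝ) :
    capNorm p Ω H V u (fun x => c * g x) = ENNReal.ofReal |c| * capNorm p Ω H V u g := by
  rcases eq_or_ne c 0 with rfl | hc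
  · simp [capNorm_zero]
  refine le_antisymm (capNorm_const_mul_le hp hΩ huc hc g) ?_
  have hinv := capNorm_const_mul_le (H := H) (V := V) hp hΩ huc (inv_ne_zero hc) fun x => c * g x
  simp only [inv_mul_cancel_left₀ hc] at hinv
  calc ENNReal.ofReal |c| * capNorm p Ω H V u g
      ≤ ENNReal.ofReal |c| * (ENNReal.ofReal |c⁻¹| * capNorm p Ω H V u fun x => c * g x) := by
        gcongr
    _ = capNorm p Ω H V u fun x => c * g x := by
        rw [← mul_assoc, ← ENNReal.ofReal_mul (abs_nonneg _), ← abs_mul, mul_inv_cancel₀ hc,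
          abs_one, ENNReal.ofReal_one, one_mul]

theorem ae_eq_zero_of_capNorm_eq_zero (hp : 1 < p) (hΩ : IsOpen Ω) (huc : ContinuousOn u Ω)
    (hpos : ∀ x ∈ Ω, 0 < u x) {g : E n → ℝ} (hg : AEStronglyMeasurable g (volume.restrict Ω))
    (hzero : capNorm p Ω H V u g = 0) : g =ᵐ[volume.restrict Ω] 0 := by
  refine ae_restrict_of_forall_isCompact hΩ fun K hKΩ hK => ?_
  have hint := wInt_le_capNorm_mul hp hΩ huc (hzero ▸ ENNReal.zero_lt_top) hKΩ hK
  rw [hzero, zero_mul, nonpos_iff_eq_zero, wInt, lintegral_eq_zero_iff'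
    (aemeasurable_abs_mul_abs_rpow hΩ huc hKΩ hg).ennreal_ofReal] at hint
  filter_upwards [hint, ae_restrict_mem hK.measurableSet] with x hx hxK
  have hux : 0 < |u x| ^ p := Real.rpow_pos_of_pos (abs_pos.2 (hpos x (hKΩ hxK)).ne') _
  exact abs_nonpos_iff.1 (nonpos_of_mul_nonpos_left (ENNReal.ofReal_eq_zero.1 hx) hux)

theorem locallyIntegrableOn_of_capNorm_lt_top (hp : 1 < p) (hΩ : IsOpen Ω)
    (huc : ContinuousOn u Ω) (hpos : ∀ x ∈ Ω, 0 < u x) {g : E n → ℝ}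
    (hg : AEStronglyMeasurable g (volume.restrict Ω)) (hlt : capNorm p Ω H V u g < ⊤) :
    LocallyIntegrableOn g Ω := by
  rw [locallyIntegrableOn_iff hΩ.isLocallyClosed]
  intro K hKΩ hK
  have hupos : ∀ x ∈ K, 0 < |u x| ^ p := fun x hx =>
    Real.rpow_pos_of_pos (abs_pos.2 (hpos x (hKΩ hx)).ne') _
  have hwInt : wInt p K g u < ⊤ := (wInt_le_capNorm_mul hp hΩ huc hlt hKΩ hK).trans_lt
    (ENNReal.mul_lt_top hlt (capacity_lt_top hp hΩ (huc.mono hKΩ) hK hKΩ))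
  have hgu : IntegrableOn (fun x => |g x| * |u x| ^ p) K :=
    (lintegral_ofReal_ne_top_iff_integrable
      (aemeasurable_abs_mul_abs_rpow hΩ huc hKΩ hg).aestronglyMeasurable
      (Eventually.of_forall fun x => by positivity)).1 hwInt.ne
  have hcont : ContinuousOn (fun x => (|u x| ^ p)⁻¹) K :=
    ((huc.mono hKΩ).abs.rpow_const fun _ _ => Or.inr (by linarith)).inv₀ fun x hx =>
      (hupos x hx).ne'
  refine Integrable.mono (hgu.mul_continuousOn hcont hK)
    (hg.mono_measure (Measure.restrict_mono hKΩ le_rfl)) ?_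
  filter_upwards [ae_restrict_mem hK.measurableSet] with x hx
  rw [mul_inv_cancel_right₀ (hupos x hx).ne', Real.norm_eq_abs, norm_abs_eq_norm, Real.norm_eq_abs]

theorem capNorm_le_of_tendsto_ae (hp : 1 < p) (hΩ : IsOpen Ω) (huc : ContinuousOn u Ω)
    {F : ℕ → E n → ℝ} {g : E n → ℝ} {L : ℝ≥0∞} (hL : L < ⊤)
    (hF : ∀ k, AEStronglyMeasurable (F k) (volume.restrict Ω))
    (hlim : ∀ᵐ x ∂(volume.restrict Ω), Tendsto (fun k => F k x) atTop (𝓝 (g x)))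
    (hle : ∀ᶠ k in atTop, capNorm p Ω H V u (F k) ≤ L) : capNorm p Ω H V u g ≤ L := by
  refine capNorm_le fun K hKΩ hK => ?_
  calc wInt p K g u
      ≤ ∫⁻ x in K, liminf (fun k => ENNReal.ofReal (|F k x| * |u x| ^ p)) atTop := by
        refine lintegral_mono_ae ?_
        filter_upwards [ae_restrict_of_ae_restrict_of_subset hKΩ hlim] with x hx
        exact (ENNReal.tendsto_ofReal (hx.abs.mul_const _)).liminf_eq.ge
    _ ≤ liminf (fun k => wInt p K (F k) u) atTop := lintegral_liminf_le' fun k =>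
        (aemeasurable_abs_mul_abs_rpow hΩ huc hKΩ (hF k)).ennreal_ofReal
    _ ≤ L * capacity p Ω H V u K := by
        refine liminf_le_of_frequently_le' (Eventually.frequently ?_)
        filter_upwards [hle] with k hk
        exact (wInt_le_capNorm_mul hp hΩ huc (hk.trans_lt hL) hKΩ hK).trans (by gcongr)

theorem ae_tsum_ofReal_lt_top_of_capNorm_le (hp : 1 < p) (hΩ : IsOpen Ω)
    (huc : ContinuousOn u Ω) (hpos : ∀ x ∈ Ω, 0 < u x) {F : ℕ → E n → ℝ} {ε : ℕ → ℝ≥0∞}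
    (hε : ∑' k, ε k < ⊤) (hF : ∀ k, AEStronglyMeasurable (F k) (volume.restrict Ω))
    (hle : ∀ k, capNorm p Ω H V u (F k) ≤ ε k) :
    ∀ᵐ x ∂(volume.restrict Ω), ∑' k, ENNReal.ofReal |F k x| < ⊤ := by
  refine ae_restrict_of_forall_isCompact hΩ fun K hKΩ hK => ?_
  have hmeas : ∀ k, AEMeasurable (fun x => ENNReal.ofReal (|F k x| * |u x| ^ p))
      (volume.restrict K) := fun k =>
    (aemeasurable_abs_mul_abs_rpow hΩ huc hKΩ (hF k)).ennreal_ofReal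
  have hlintegral : ∫⁻ x in K, ∑' k, ENNReal.ofReal (|F k x| * |u x| ^ p) < ⊤ := by
    calc ∫⁻ x in K, ∑' k, ENNReal.ofReal (|F k x| * |u x| ^ p)
        = ∑' k, wInt p K (F k) u := lintegral_tsum hmeas
      _ ≤ ∑' k, ε k * capacity p Ω H V u K := ENNReal.tsum_le_tsum fun k =>
          (wInt_le_capNorm_mul hp hΩ huc ((hle k).trans_lt ((ENNReal.le_tsum k).trans_lt hε))
            hKΩ hK).trans (by gcongr; exact hle k)
      _ = (∑' k, ε k) * capacity p Ω H V u K := ENNReal.tsum_mul_right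
      _ < ⊤ := ENNReal.mul_lt_top hε (capacity_lt_top hp hΩ (huc.mono hKΩ) hK hKΩ)
  filter_upwards [ae_lt_top' (AEMeasurable.tsum hmeas) hlintegral.ne,
    ae_restrict_mem hK.measurableSet] with x hx hxK
  have hux : 0 < |u x| ^ p := Real.rpow_pos_of_pos (abs_pos.2 (hpos x (hKΩ hxK)).ne') _
  simp only [ENNReal.ofReal_mul (abs_nonneg _), ENNReal.tsum_mul_right] at hx
  exact ENNReal.lt_top_of_mul_ne_top_left hx.ne (by simpa using hux)

theorem exists_tendsto_ae_of_capNorm_sub_le (hp : 1 < p) (hΩ : IsOpen Ω)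
    (huc : ContinuousOn u Ω) (hpos : ∀ x ∈ Ω, 0 < u x) {F : ℕ → E n → ℝ} {ε : ℕ → ℝ≥0∞}
    (hε : ∑' k, ε k < ⊤) (hF : ∀ k, AEStronglyMeasurable (F k) (volume.restrict Ω))
    (hle : ∀ k, capNorm p Ω H V u (fun x => F k x - F (k + 1) x) ≤ ε k) :
    ∃ g, StronglyMeasurable g ∧
      ∀ᵐ x ∂(volume.restrict Ω), Tendsto (fun k => F k x) atTop (𝓝 (g x)) := by
  refine exists_stronglyMeasurable_limit_of_tendsto_ae hF ?_
  filter_upwards [ae_tsum_ofReal_lt_top_of_capNorm_le hp hΩ huc hpos hε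
    (fun k => (hF k).sub (hF (k + 1))) hle] with x hx
  refine cauchySeq_tendsto_of_complete (cauchySeq_of_edist_le_of_tsum_ne_top
    (fun k => ENNReal.ofReal |F k x - F (k + 1) x|) (fun k => ?_) hx.ne)
  rw [edist_dist, Real.dist_eq]

end CapNorm

/-! ### Hardy weights -/

section HardyWeight

variable {n : ℕ} {p C : ℝ} {Ω K : Set (E n)} {H : E n → E n → ℝ} {V u : E n → ℝ}

theorem IsSobolevOn.wInt_eq_ofReal_integral (hp : 0 < p) (hK : IsCompact K) (hKΩ : K ⊆ Ω)
    {g φ : E n → ℝ} {G : E n → E n} (hg : LocallyIntegrableOn g Ω) (hφ : IsSobolevOn p K φ G) :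
    wInt p Ω g φ = ENNReal.ofReal (∫ x in Ω, |g x| * |φ x| ^ p) :=
  (ofReal_integral_eq_lintegral_ofReal (hφ.integrable_mul_abs_rpow hp hg.norm hK hKΩ).integrableOn
    (Eventually.of_forall fun x => by positivity)).symm

theorem IsPositiveSolution.energy_nonneg (hu : IsPositiveSolution p C Ω H V u) {φ : E n → ℝ}
    (hφ : MemW1pCc p Ω φ) : 0 ≤ energy p Ω H V φ := by
  obtain ⟨K, G, hK, hKΩ, hφ⟩ := hφ.exists_isSobolevOn hu.isOpen
  rw [hu.energy_eq_integral_energyDensity hK hKΩ hφ]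
  exact integral_nonneg_of_ae
    (energyDensity_nonneg_ae hu.isFinslerNorm hu.exponent_pos.le _ _ _)

theorem hardyNorm_le {g : E n → ℝ} {L : ℝ≥0∞}
    (h : ∀ φ, MemW1pCc p Ω φ → wInt p Ω g φ ≤ L * ENNReal.ofReal (energy p Ω H V φ)) :
    hardyNorm p Ω H V g ≤ L := by
  rw [hardyNorm, ENNReal.inv_le_iff_inv_le]
  refine le_iInf fun φ => le_iInf₂ fun hφ hw => ?_
  rw [ENNReal.le_div_iff_mul_le (Or.inl hw.ne') (Or.inr ENNReal.ofReal_ne_top), mul_comm,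
    ← div_eq_mul_inv]
  exact ENNReal.div_le_of_le_mul' (h φ hφ)

theorem wInt_le_hardyNorm_mul {g φ : E n → ℝ} (hg : hardyNorm p Ω H V g < ⊤)
    (hφ : MemW1pCc p Ω φ) :
    wInt p Ω g φ ≤ hardyNorm p Ω H V g * ENNReal.ofReal (energy p Ω H V φ) := by
  rcases eq_or_ne (wInt p Ω g φ) 0 with hzero | hne
  · exact hzero.trans_le zero_le
  have hle : hardyConst p Ω H V g * wInt p Ω g φ ≤ ENNReal.ofReal (energy p Ω H V φ) :=
    ENNReal.mul_le_of_le_div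
      (iInf_le_of_le φ (iInf₂_le_of_le hφ (pos_iff_ne_zero.2 hne) le_rfl))
  have hconst_ne_zero : hardyConst p Ω H V g ≠ 0 := (ENNReal.inv_lt_top.1 hg).ne'
  have hconst_ne_top : hardyConst p Ω H V g ≠ ⊤ := fun htop => by
    rw [htop, ENNReal.top_mul hne] at hle
    exact ENNReal.ofReal_ne_top (top_le_iff.1 hle)
  calc wInt p Ω g φ = hardyNorm p Ω H V g * (hardyConst p Ω H V g * wInt p Ω g φ) := by
        rw [← mul_assoc, hardyNorm, ENNReal.inv_mul_cancel hconst_ne_zero hconst_ne_top, one_mul]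
    _ ≤ hardyNorm p Ω H V g * ENNReal.ofReal (energy p Ω H V φ) := by gcongr

theorem wInt_le_wInt_of_le (hp : 0 ≤ p) (hK : IsCompact K) (hKΩ : K ⊆ Ω) (g : E n → ℝ)
    {φ : E n → ℝ} (hpos : ∀ x ∈ K, 0 ≤ u x) (hle : ∀ x ∈ K, u x ≤ φ x) :
    wInt p K g u ≤ wInt p Ω g φ := by
  refine (setLIntegral_mono' hK.measurableSet fun x hx => ?_).trans (lintegral_mono_set hKΩ)
  have habs : |u x| ≤ |φ x| := abs_le_abs_of_nonneg (hpos x hx) (hle x hx)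
  gcongr

theorem capNorm_le_hardyNorm (hp : 1 < p) (hΩ : IsOpen Ω) (huc : ContinuousOn u Ω)
    (hpos : ∀ x ∈ Ω, 0 < u x) (g : E n → ℝ) :
    capNorm p Ω H V u g ≤ hardyNorm p Ω H V g := by
  rcases eq_top_or_lt_top (hardyNorm p Ω H V g) with htop | hg
  · exact le_top.trans_eq htop.symm
  refine capNorm_le fun K hKΩ hK => ?_
  have hle : ∀ φ, MemW1pCc p Ω φ → (∀ x ∈ K, u x ≤ φ x) →
      wInt p K g u ≤ hardyNorm p Ω H V g * ENNReal.ofReal (energy p Ω H V φ) := fun φ hφ hφK =>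
    (wInt_le_wInt_of_le (by linarith) hK hKΩ g (fun x hx => (hpos x (hKΩ hx)).le) hφK).trans
      (wInt_le_hardyNorm_mul hg hφ)
  rcases eq_or_ne (hardyNorm p Ω H V g) 0 with hzero | hne
  · obtain ⟨φ, hφ, hφK⟩ := exists_memW1pCc_ge hp hΩ (huc.mono hKΩ) hK hKΩ
    simpa only [hzero, zero_mul] using hle φ hφ hφK
  · rw [← ENNReal.div_le_iff' hne hg.ne]
    exact le_iInf fun φ => le_iInf₂ fun hφ hφK => ENNReal.div_le_of_le_mul' (hle φ hφ hφK)

theorem IsHardyWeight.hardyNorm_lt_top (hp : 1 < p) (hΩ : IsOpen Ω)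
    (hH : IsFinslerNorm p C Ω H) (hV : LocallyIntegrableOn V Ω) {g : E n → ℝ}
    (hg : IsHardyWeight p Ω H V g) : hardyNorm p Ω H V g < ⊤ := by
  obtain ⟨hgi, c, hc, hardy⟩ := hg
  refine (hardyNorm_le (L := ENNReal.ofReal c⁻¹) fun φ hφ => ?_).trans_lt ENNReal.ofReal_lt_top
  obtain ⟨K, G, hK, hKΩ, hφ⟩ := hφ.exists_isSobolevOn hΩ
  obtain ⟨F, hF, henergy, hweight⟩ := hφ.exists_tendsto_energy hp hΩ hH hV hgi hK hKΩ
  have hlimit : c * ∫ x in Ω, |g x| * |φ x| ^ p ≤ energy p Ω H V φ :=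
    le_of_tendsto_of_tendsto' (hweight.const_mul c) henergy fun k => hardy _ (hF k)
  rw [hφ.wInt_eq_ofReal_integral (by linarith) hK hKΩ hgi, ← ENNReal.ofReal_mul (by positivity)]
  exact ENNReal.ofReal_le_ofReal ((le_inv_mul_iff₀ hc).2 hlimit)

theorem isHardyWeight_of_wInt_le (hp : 1 < p) {g : E n → ℝ} (hg : LocallyIntegrableOn g Ω)
    (hnonneg : ∀ φ, IsTest Ω φ → 0 ≤ energy p Ω H V φ) {L : ℝ≥0∞} (hL : L ≠ ⊤)
    (h : ∀ φ, IsTest Ω φ → wInt p Ω g φ ≤ L * ENNReal.ofReal (energy p Ω H V φ)) :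
    IsHardyWeight p Ω H V g := by
  lift L to ℝ≥0 using hL
  refine ⟨hg, (L + 1 : ℝ)⁻¹, by positivity, fun φ hφ => ?_⟩
  have henergy := hnonneg φ hφ
  have hle := h φ hφ
  rw [(isSobolevOn_of_contDiff hφ.contDiff_one hφ.2.1).wInt_eq_ofReal_integral (by linarith)
      hφ.2.1 hφ.2.2 hg, ← ENNReal.ofReal_coe_nnreal, ← ENNReal.ofReal_mul L.coe_nonneg,
    ENNReal.ofReal_le_ofReal_iff (by positivity)] at hle
  rw [inv_mul_le_iff₀ (by positivity)]
  linarith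

theorem exists_wInt_le_capNorm_mul_energy (hp : 1 < p) (C : ℝ) : ∃ D : ℝ≥0, 0 < D ∧
    ∀ {n : ℕ} {Ω : Set (E n)} {H : E n → E n → ℝ} {V u g φ : E n → ℝ},
      IsPositiveSolution p C Ω H V u → capNorm p Ω H V u g < ⊤ → MemW1pCc p Ω φ →
      wInt p Ω g φ ≤ D * capNorm p Ω H V u g * ENNReal.ofReal (energy p Ω H V φ) := by
  obtain ⟨D, hD, hmazya⟩ := exists_wInt_le_energy (zero_lt_one.trans hp) C
  refine ⟨D, hD, fun {n Ω H V u g φ} hu hg hφ => ?_⟩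
  rw [← ENNReal.coe_toNNReal hg.ne]
  refine hmazya hu (fun K hKΩ hK => ?_) φ hφ
  rw [ENNReal.coe_toNNReal hg.ne]
  exact wInt_le_capNorm_mul hp hu.isOpen hu.continuousOn hg hKΩ hK

theorem IsPositiveSolution.capNorm_lt_top (hu : IsPositiveSolution p C Ω H V u) {g : E n → ℝ}
    (hg : IsHardyWeight p Ω H V g) : capNorm p Ω H V u g < ⊤ :=
  (capNorm_le_hardyNorm hu.one_lt hu.isOpen hu.continuousOn hu.pos g).trans_lt
    (hg.hardyNorm_lt_top hu.one_lt hu.isOpen hu.isFinslerNorm hu.locallyIntegrableOn)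

theorem IsPositiveSolution.isHardyWeight_iff (hu : IsPositiveSolution p C Ω H V u) {g : E n → ℝ}
    (hg : LocallyIntegrableOn g Ω) : IsHardyWeight p Ω H V g ↔ capNorm p Ω H V u g < ⊤ := by
  refine ⟨hu.capNorm_lt_top, fun hlt => ?_⟩
  obtain ⟨D, -, hle⟩ := exists_wInt_le_capNorm_mul_energy hu.one_lt C
  exact isHardyWeight_of_wInt_le hu.one_lt hg
    (fun φ hφ => hu.energy_nonneg (hφ.memW1pCc hu.one_lt))
    (ENNReal.mul_ne_top ENNReal.coe_ne_top hlt.ne)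
    (fun φ hφ => hle hu hlt (hφ.memW1pCc hu.one_lt))

theorem exists_hardyNorm_le_mul_capNorm (hp : 1 < p) (C : ℝ) : ∃ D : ℝ≥0, 0 < D ∧
    ∀ {n : ℕ} {Ω : Set (E n)} {H : E n → E n → ℝ} {V u g : E n → ℝ},
      IsPositiveSolution p C Ω H V u → IsHardyWeight p Ω H V g →
      hardyNorm p Ω H V g ≤ D * capNorm p Ω H V u g := by
  obtain ⟨D, hD, hle⟩ := exists_wInt_le_capNorm_mul_energy hp C
  exact ⟨D, hD, fun hu hg => hardyNorm_le fun φ hφ => hle hu (hu.capNorm_lt_top hg) hφ⟩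

end HardyWeight

/-! ### Completeness -/

section Completeness

variable {n : ℕ} {p C : ℝ} {Ω : Set (E n)} {H : E n → E n → ℝ} {V u : E n → ℝ}

theorem exists_tendsto_capNorm_sub (hp : 1 < p) (hΩ : IsOpen Ω) (huc : ContinuousOn u Ω)
    (hpos : ∀ x ∈ Ω, 0 < u x) {F : ℕ → E n → ℝ}
    (hF : ∀ k, AEStronglyMeasurable (F k) (volume.restrict Ω))
    (hcauchy : ∀ ε : ℝ≥0∞, 0 < ε → ∃ k₀, ∀ j ≥ k₀, ∀ k ≥ k₀,
      capNorm p Ω H V u (fun x => F j x - F k x) < ε) :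
    ∃ g, StronglyMeasurable g ∧
      Tendsto (fun k => capNorm p Ω H V u fun x => F k x - g x) atTop (𝓝 0) := by
  obtain ⟨κ, hκ, hfast⟩ := extraction_forall_of_eventually'
    (P := fun m N => ∀ j ≥ N, ∀ k ≥ N, capNorm p Ω H V u (fun x => F j x - F k x) < 2⁻¹ ^ m)
    fun m => (hcauchy _ (ENNReal.pow_pos (by simp) m)).imp fun N hN M hM j hj k hk =>
      hN j (hM.trans hj) k (hM.trans hk)
  obtain ⟨g, hg, hlim⟩ := exists_tendsto_ae_of_capNorm_sub_le (H := H) (V := V) hp hΩ huc hpos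
    (F := fun k => F (κ k)) (ε := fun m => 2⁻¹ ^ m) (by rw [ENNReal.tsum_geometric]; simp)
    (fun k => hF _) (fun k => (hfast k _ le_rfl _ (hκ.monotone k.le_succ)).le)
  have hrate : ∀ m, ∀ j ≥ κ m, capNorm p Ω H V u (fun x => F j x - g x) ≤ 2⁻¹ ^ m := by
    refine fun m j hj => capNorm_le_of_tendsto_ae hp hΩ huc
      (F := fun k x => F j x - F (κ k) x) (ENNReal.pow_lt_top (by simp))
      (fun k => (hF j).sub (hF (κ k))) (hlim.mono fun x hx => hx.const_sub _) ?_
    filter_upwards [eventually_ge_atTop m] with k hk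
    exact (hfast m j hj _ (hκ.monotone hk)).le
  refine ⟨g, hg, ENNReal.tendsto_nhds_zero.2 fun δ hδ => ?_⟩
  obtain ⟨m, hm⟩ := ENNReal.exists_inv_two_pow_lt hδ.ne'
  filter_upwards [eventually_ge_atTop (κ m)] with j hj
  exact (hrate m j hj).trans hm.le

theorem capNorm_coe_zero (hp : 1 < p) (hΩ : IsOpen Ω) (huc : ContinuousOn u Ω) :
    capNorm p Ω H V u (0 : E n →ₘ[volume.restrict Ω] ℝ) = 0 :=
  (capNorm_congr hp hΩ huc AEEqFun.coeFn_zero).trans capNorm_zero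

theorem capNorm_coe_add_le (hp : 1 < p) (hΩ : IsOpen Ω) (huc : ContinuousOn u Ω)
    (f g : E n →ₘ[volume.restrict Ω] ℝ) :
    capNorm p Ω H V u ↑(f + g) ≤ capNorm p Ω H V u f + capNorm p Ω H V u g :=
  (capNorm_congr hp hΩ huc (AEEqFun.coeFn_add f g)).trans_le
    (capNorm_add_le hp hΩ huc f.aestronglyMeasurable g)

theorem capNorm_coe_smul (hp : 1 < p) (hΩ : IsOpen Ω) (huc : ContinuousOn u Ω) (c : ℝ)
    (f : E n →ₘ[volume.restrict Ω] ℝ) :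
    capNorm p Ω H V u ↑(c • f) = ENNReal.ofReal |c| * capNorm p Ω H V u f :=
  (capNorm_congr hp hΩ huc (AEEqFun.coeFn_smul c f)).trans (capNorm_const_mul hp hΩ huc c f)

theorem capNorm_coe_eq_zero_iff (hp : 1 < p) (hΩ : IsOpen Ω) (huc : ContinuousOn u Ω)
    (hpos : ∀ x ∈ Ω, 0 < u x) {f : E n →ₘ[volume.restrict Ω] ℝ} :
    capNorm p Ω H V u f = 0 ↔ f = 0 := by
  refine ⟨fun hzero => AEEqFun.ext ?_, fun hf => hf ▸ capNorm_coe_zero hp hΩ huc⟩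
  exact (ae_eq_zero_of_capNorm_eq_zero hp hΩ huc hpos f.aestronglyMeasurable hzero).trans
    AEEqFun.coeFn_zero.symm

theorem exists_tendsto_capNorm_coe_sub (hp : 1 < p) (hΩ : IsOpen Ω) (huc : ContinuousOn u Ω)
    (hpos : ∀ x ∈ Ω, 0 < u x) {F : ℕ → E n →ₘ[volume.restrict Ω] ℝ}
    (hF : ∀ k, capNorm p Ω H V u (F k) < ⊤)
    (hcauchy : ∀ ε : ℝ≥0∞, 0 < ε → ∃ k₀, ∀ j ≥ k₀, ∀ k ≥ k₀,
      capNorm p Ω H V u ↑(F j - F k) < ε) :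
    ∃ f : E n →ₘ[volume.restrict Ω] ℝ, capNorm p Ω H V u f < ⊤ ∧
      Tendsto (fun k => capNorm p Ω H V u ↑(F k - f)) atTop (𝓝 0) := by
  have hsub : ∀ f g : E n →ₘ[volume.restrict Ω] ℝ,
      capNorm p Ω H V u ↑(f - g) = capNorm p Ω H V u (fun x => f x - g x) := fun f g =>
    capNorm_congr hp hΩ huc (AEEqFun.coeFn_sub f g)
  simp only [hsub] at hcauchy
  obtain ⟨g, hg, hlim⟩ := exists_tendsto_capNorm_sub hp hΩ huc hpos
    (fun k => (F k).aestronglyMeasurable) hcauchy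
  set f : E n →ₘ[volume.restrict Ω] ℝ := AEEqFun.mk g hg.aestronglyMeasurable
  have hlim_coe : Tendsto (fun k => capNorm p Ω H V u ↑(F k - f)) atTop (𝓝 0) := by
    refine hlim.congr fun k => (hsub (F k) f ▸ capNorm_congr hp hΩ huc ?_)
    filter_upwards [AEEqFun.coeFn_mk g hg.aestronglyMeasurable] with x hx
    rw [hx]
  refine ⟨f, ?_, hlim_coe⟩
  obtain ⟨k, hk⟩ := (hlim_coe.eventually_lt_const zero_lt_one).exists
  have htriangle := capNorm_coe_add_le (H := H) (V := V) hp hΩ huc (F k) ((-1 : ℝ) • (F k - f))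
  rw [capNorm_coe_smul hp hΩ huc, neg_one_smul, neg_sub, add_sub_cancel] at htriangle
  exact htriangle.trans_lt (ENNReal.add_lt_top.2
    ⟨hF k, ENNReal.mul_lt_top ENNReal.ofReal_lt_top (hk.trans ENNReal.one_lt_top)⟩)

theorem isBanachSpace_capNorm (hp : 1 < p) (hΩ : IsOpen Ω) (huc : ContinuousOn u Ω)
    (hpos : ∀ x ∈ Ω, 0 < u x) :
    IsBanachSpace {f : E n →ₘ[volume.restrict Ω] ℝ | capNorm p Ω H V u f < ⊤}
      (fun f => capNorm p Ω H V u f) where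
  zero_mem := (capNorm_coe_zero hp hΩ huc).trans_lt ENNReal.zero_lt_top
  add_mem f hf g hg :=
    (capNorm_coe_add_le hp hΩ huc f g).trans_lt (ENNReal.add_lt_top.2 ⟨hf, hg⟩)
  smul_mem c f hf :=
    (capNorm_coe_smul hp hΩ huc c f).trans_lt (ENNReal.mul_lt_top ENNReal.ofReal_lt_top hf)
  finite _ hf := hf
  eq_zero_iff _ _ := capNorm_coe_eq_zero_iff hp hΩ huc hpos
  smul c f _ := capNorm_coe_smul hp hΩ huc c f
  triangle f _ g _ := capNorm_coe_add_le hp hΩ huc f g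
  complete _ hF hcauchy := exists_tendsto_capNorm_coe_sub hp hΩ huc hpos hF hcauchy

theorem IsPositiveSolution.isBanachSpace (hu : IsPositiveSolution p C Ω H V u) :
    IsBanachSpace {f : E n →ₘ[volume.restrict Ω] ℝ | IsHardyWeight p Ω H V f}
      (fun f => capNorm p Ω H V u f) := by
  have heq : {f : E n →ₘ[volume.restrict Ω] ℝ | IsHardyWeight p Ω H V f}
      = {f : E n →ₘ[volume.restrict Ω] ℝ | capNorm p Ω H V u f < ⊤} := by
    ext f
    exact ⟨hu.capNorm_lt_top, fun hlt => (hu.isHardyWeight_iff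
      (locallyIntegrableOn_of_capNorm_lt_top hu.one_lt hu.isOpen hu.continuousOn hu.pos
        f.aestronglyMeasurable hlt)).2 hlt⟩
  rw [heq]
  exact isBanachSpace_capNorm hu.one_lt hu.isOpen hu.continuousOn hu.pos

end Completeness

end FinslerHardy

end

theorem theorem3p14_general (p s : ℝ) (hp : 1 < p) (hs : 1 < s) :
    ∃ C : ℝ≥0, 0 < C ∧
      ∀ (n : ℕ) (Ω : Set (E n)), IsOpen Ω →
      ∀ (a : E n → Fin n → ℝ), IsWeight Ω a →
      ∀ (A : E n → Matrix (Fin n) (Fin n) ℝ), IsEllipticMatrix Ω A →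
      ∀ (V : E n → ℝ), LocallyIntegrableOn V Ω →
      ∀ (u : E n → ℝ), ContinuousOn u Ω → (∀ x ∈ Ω, 0 < u x) →
        IsSolution p Ω (mixedNorm p s a A) V u →
        (∀ g : E n → ℝ, LocallyIntegrableOn g Ω →
          (IsHardyWeight p Ω (mixedNorm p s a A) V g ↔
            capNorm p Ω (mixedNorm p s a A) V u g < ⊤)) ∧
        (∀ g : E n → ℝ, IsHardyWeight p Ω (mixedNorm p s a A) V g →
          capNorm p Ω (mixedNorm p s a A) V u g ≤ hardyNorm p Ω (mixedNorm p s a A) V g ∧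
          hardyNorm p Ω (mixedNorm p s a A) V g ≤
            C * capNorm p Ω (mixedNorm p s a A) V u g) ∧
        IsBanachSpace
          {f : E n →ₘ[volume.restrict Ω] ℝ | IsHardyWeight p Ω (mixedNorm p s a A) V f}
          (fun f => capNorm p Ω (mixedNorm p s a A) V u f) := by
  obtain ⟨C, hnorm⟩ := exists_isFinslerNorm_mixedNorm hp hs
  obtain ⟨D, hD, hhardy⟩ := exists_hardyNorm_le_mul_capNorm hp C
  refine ⟨D, hD, fun n Ω hΩ a ha A hA V hV u huc hpos hsol => ?_⟩
  have hu : IsPositiveSolution p C Ω (mixedNorm p s a A) V u :=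
    ⟨hp, hΩ, hnorm n Ω a A hΩ ha hA, hV, huc, hpos, hsol⟩
  exact ⟨fun g hg => hu.isHardyWeight_iff hg,
    fun g hg => ⟨capNorm_le_hardyNorm hp hΩ huc hpos g, hhardy hu hg⟩, hu.isBanachSpace⟩

theorem theorem3p14 (p s : ℝ) (hp : 1 < p) (hs : 1 < s) :
    -- the constant depends only on `p, s, n`, and only on `p, s` if `p ≤ s`
    ∃ C : ℕ → ℝ≥0, (∀ n, 0 < C n) ∧ (p ≤ s → ∀ m n, C m = C n) ∧
      ∀ (n : ℕ), 2 ≤ n → ∀ (Ω : Set (E n)), IsDom Ω →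
      ∀ (a : E n → Fin n → ℝ), IsWeight Ω a →
      ∀ (A : E n → Matrix (Fin n) (Fin n) ℝ), IsEllipticMatrix Ω A →
      ∀ (q : ℝ) (V : E n → ℝ), MemMorreyLoc p q Ω V →
      ∀ (u : E n → ℝ), ContinuousOn u Ω → (∀ x ∈ Ω, 0 < u x) →
        IsSolution p Ω (mixedNorm p s a A) V u →
        (∀ g : E n → ℝ, LocallyIntegrableOn g Ω →
          (IsHardyWeight p Ω (mixedNorm p s a A) V g ↔
            capNorm p Ω (mixedNorm p s a A) V u g < ⊤)) ∧
        (∀ g : E n → ℝ, IsHardyWeight p Ω (mixedNorm p s a A) V g →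
          capNorm p Ω (mixedNorm p s a A) V u g ≤ hardyNorm p Ω (mixedNorm p s a A) V g ∧
          hardyNorm p Ω (mixedNorm p s a A) V g ≤
            C n * capNorm p Ω (mixedNorm p s a A) V u g) ∧
        -- Hardy-weights, modulo equality a.e. in `Ω`, form a Banach space
        IsBanachSpace
          {f : E n →ₘ[volume.restrict Ω] ℝ | IsHardyWeight p Ω (mixedNorm p s a A) V f}
          (fun f => capNorm p Ω (mixedNorm p s a A) V u f) := by
  obtain ⟨C, hC, h⟩ := theorem3p14_general p s hp hs
  exact ⟨fun _ => C, fun _ => hC, fun _ _ _ => rfl, fun n _ Ω hΩ a ha A hA _ V hV =>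
    h n Ω hΩ.1 a ha A hA V (hV.locallyIntegrableOn hΩ.1)⟩
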